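/- Let $\mathbb{K}$ be a field and let $\mathbb{B}$ be an associative division algebra over $\mathbb{K}$ that is quadratic: there are a $\mathbb{K}$-linear trace $T$ with $T(1)=2$ and a quadratic norm form $N$ with $N(1)=1$ such that $b^2-T(b)b+N(b)=0$ for all $b\in\mathbb{B}$. Put $d=\dim_{\mathbb{K}}\mathbb{B}$ (possibly infinite; the dimension formulas below are then read as equalities of vector space dimensions as cardinals), $v=d-1$, and $\overline{b}=T(b)-b$. Let $\mathbb{A}=\mathsf{CD}(\mathbb{B},0)=\mathbb{B}\oplus t\mathbb{B}$ be the algebra on $\mathbb{B}\times\mathbb{B}$ (with $(a,b)=a+tb$) with product $(a,b)(c,e)=(ac,\overline{a}e+cb)$ and involution $\overline{(a,b)}=(\overline{a},-b)$. For $\mathbb{A}$ as above, and also for $\mathbb{B}$ in the place of $\mathbb{A}$ with $t=0$, let $\mathsf{G}(2,\mathbb{A})$ be the geometry with points $(x,y,1)$, $(1,y,tz_1)$, $(tx_1,1,tz_1)$ and lines $[a,1,c]$, $[1,tb_1,c]$, $[ta_1,tb_1,1]$ ($x,y,a,c\in\mathbb{A}$; $x_1,z_1,a_1,b_1\in\mathbb{B}$),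 where $(x,y,z)$ is incident with $[a,b,c]$ if and only if $ax+by+cz=0$. Its Veronese representation $\mathcal{V}_2(\mathbb{K},\mathbb{A})=(X,\Xi)$ consists of the set $X$ of the points $\rho(x,y,z)=\mathbb{K}(x\overline{x},y\overline{y},z\overline{z};y\overline{z},z\overline{x},x\overline{y})$ of the projective space of $\mathbb{K}^3\oplus\mathbb{A}^3$, and the set $\Xi$ of the subspaces $\langle\rho(L)\rangle$, with $L$ a line of the geometry. An ovoid in a projective space is a spanning point set $O$ such that for each $x\in O$ the union of the lines meeting $O$ only in $x$ is a hyperplane, and each other line through $x$ meets $O$ in exactly one further point. A $(d,v)$-tube of a $(d+v+2)$-space is the cone with vertex a $v$-space $V$ over an ovoid (its base) spanning a $(d+1)$-space complementary to $V$, with $V$ removed. The regulus determined by three pairwise disjoint $v$-spaces of a $(2v+1)$-space is the set of subspaces that meet each common transversal line of the three in exactly one point and are the union of these points. A set $\mathcal{S}$ of $v$-spaces is a regular spread of a projective space if each point lies in exactly one member, members meeting the span of two distinct members are contained in it, and for three distinct members one of which is contained in the span of the other two, the regulus determined by them is contained in $\mathcal{S}$. Now let $(X,\Xi)=\mathcal{V}_2(\mathbb{K},\mathsf{CD}(\mathbb{B},0))$.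 Then: 1. $X$ spans a projective space $\mathbb{P}=\mathsf{PG}(6d+2,\mathbb{K})$. 2. For each $\xi\in\Xi$ the set $X\cap\xi$ is a $(d,v)$-tube spanning $\xi$, with a unique vertex, of dimension $v=d-1$, and each base is a non-degenerate quadric of Witt index $1$. 3. The set $\mathcal{S}$ of all these vertices is a regular spread of a $(3v+2)$-space $Y$ of $\mathbb{P}$. 4. Let $\mathcal{B}$ be the set of subspaces spanned by two distinct members of $\mathcal{S}$. Its members have dimension $2v+1$, and $(\mathcal{S},\mathcal{B})$, with containment as incidence, is a projective plane isomorphic to $\mathsf{PG}(2,\mathbb{B})$. 5. There is a subspace $F$ of $\mathbb{P}$ complementary to $Y$ such that, with $X'=X\cap F$ and $\Xi'=\{\xi\cap F\mid \xi\in\Xi,\ \dim(\xi\cap F)=d+1\}$, one has $\Xi'=\{\langle\xi,Y\rangle\cap F\mid\xi\in\Xi\}$ and $(X',\Xi')$ is projectively equivalent to $\mathcal{V}_2(\mathbb{K},\mathbb{B})$, and 6. there is a linear duality $\chi$ between $(X',\Xi')$ and $(\mathcal{S},\mathcal{B})$ such that $X$ is the union of the sets $\langle x',\chi(x')\rangle\setminus\chi(x')$,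 for $x'$ ranging over $X'$. Here a duality is a pair of bijections $X'\to\mathcal{B}$ and $\Xi'\to\mathcal{S}$, both denoted $\chi$, with $x'\in\xi'$ if and only if $\chi(\xi')\subseteq\chi(x')$; it is linear if for each $\xi'\in\Xi'$ and each conic contained in $X'\cap\xi'$, the map $x'\mapsto\chi(x')$, followed by the projection from $\chi(\xi')$, maps the conic bijectively onto a regulus and preserves the cross-ratio. -/

import Mathlib

open scoped LinearAlgebra.Projectivization

namespace HjVeronese

noncomputable section

/-! ### Quadratic algebras and the (extended) Cayley-Dickson process -/

/-- The structure of a quadratic algebra on a unital, not necessarily associative `K`-algebra `A`: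
a linear trace `T` with `T 1 = 2` and a quadratic norm `N` with `N 1 = 1` such that
`a ^ 2 - T a * a + N a = 0` for all `a`.  (Such `T` and `N` are unique if they exist.) -/
structure QuadraticStructure (K A : Type*) [Field K] [NonAssocRing A] [Module K A] where
  trace : A →ₗ[K] K
  norm : QuadraticForm K A
  trace_one : trace 1 = 2
  norm_one : norm 1 = 1
  quadratic : ∀ a : A, a * a - trace a • a + norm a • (1 : A) = 0

section CD

variable {K A : Type*} [Field K] [NonAssocRing A] [Module K A]

/-- The standard involution `a ↦ T a - a`. -/
def QuadraticStructure.conj (Q : QuadraticStructure K A) : A →ₗ[K] A :=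
  Q.trace.smulRight (1 : A) - LinearMap.id

theorem QuadraticStructure.conj_apply (Q : QuadraticStructure K A) (a : A) :
    Q.conj a = Q.trace a • (1 : A) - a := rfl

theorem QuadraticStructure.conj_one (Q : QuadraticStructure K A) : Q.conj 1 = 1 := by
  rw [Q.conj_apply, Q.trace_one, two_smul]; abel

theorem QuadraticStructure.mul_conj [SMulCommClass K A A] (Q : QuadraticStructure K A) (a : A) :
    a * Q.conj a = Q.norm a • (1 : A) := by
  have h := Q.quadratic a
  rw [Q.conj_apply, mul_sub, mul_smul_comm, mul_one]
  rw [← sub_eq_zero]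
  rw [← neg_eq_zero, ← h]
  abel

/-- The underlying set `A × A` of the algebra `CD(A, ζ)`; the pair `(a, b)` stands for `a + t b`. -/
def CD (_Q : QuadraticStructure K A) (_ζ : K) : Type _ := A × A

variable (Q : QuadraticStructure K A) (ζ : K)

instance : AddCommGroup (CD Q ζ) := inferInstanceAs (AddCommGroup (A × A))

instance : Module K (CD Q ζ) := inferInstanceAs (Module K (A × A))

instance : One (CD Q ζ) := ⟨((1 : A), (0 : A))⟩

/-- `(a, b) (c, d) = (a c + ζ d b̄, ā d + c b)`. -/
instance : Mul (CD Q ζ) :=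
  ⟨fun x y => (x.1 * y.1 + ζ • (y.2 * Q.conj x.2), Q.conj x.1 * y.2 + y.1 * x.2)⟩

variable {Q ζ}

@[ext] theorem CD.ext {x y : CD Q ζ} (h₁ : x.1 = y.1) (h₂ : x.2 = y.2) : x = y := Prod.ext h₁ h₂

theorem CD.zero_fst : (0 : CD Q ζ).1 = 0 := rfl
theorem CD.zero_snd : (0 : CD Q ζ).2 = 0 := rfl
theorem CD.one_fst : (1 : CD Q ζ).1 = 1 := rfl
theorem CD.one_snd : (1 : CD Q ζ).2 = 0 := rfl
theorem CD.add_fst (x y : CD Q ζ) : (x + y).1 = x.1 + y.1 := rfl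
theorem CD.add_snd (x y : CD Q ζ) : (x + y).2 = x.2 + y.2 := rfl
theorem CD.sub_fst (x y : CD Q ζ) : (x - y).1 = x.1 - y.1 := rfl
theorem CD.sub_snd (x y : CD Q ζ) : (x - y).2 = x.2 - y.2 := rfl
theorem CD.smul_fst (c : K) (x : CD Q ζ) : (c • x).1 = c • x.1 := rfl
theorem CD.smul_snd (c : K) (x : CD Q ζ) : (c • x).2 = c • x.2 := rfl
theorem CD.mul_fst (x y : CD Q ζ) : (x * y).1 = x.1 * y.1 + ζ • (y.2 * Q.conj x.2) := rfl
theorem CD.mul_snd (x y : CD Q ζ) : (x * y).2 = Q.conj x.1 * y.2 + y.1 * x.2 := rfl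

variable (Q ζ)

instance : NonAssocRing (CD Q ζ) :=
  { (inferInstance : AddCommGroup (CD Q ζ)), (inferInstance : Mul (CD Q ζ)),
    (inferInstance : One (CD Q ζ)) with
    left_distrib := fun x y z => by
      ext
      · simp only [CD.mul_fst, CD.add_fst, CD.add_snd, mul_add, add_mul, smul_add]; abel
      · simp only [CD.mul_snd, CD.add_fst, CD.add_snd, mul_add, add_mul]; abel
    right_distrib := fun x y z => by
      ext
      · simp only [CD.mul_fst, CD.add_fst, CD.add_snd, mul_add, add_mul, smul_add, map_add]; abel
      · simp only [CD.mul_snd, CD.add_fst, CD.add_snd, mul_add, add_mul, map_add]; abel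
    zero_mul := fun x => by
      ext <;> simp [CD.mul_fst, CD.mul_snd, CD.zero_fst, CD.zero_snd]
    mul_zero := fun x => by
      ext <;> simp [CD.mul_fst, CD.mul_snd, CD.zero_fst, CD.zero_snd]
    one_mul := fun x => by
      ext <;> simp [CD.mul_fst, CD.mul_snd, CD.one_fst, CD.one_snd, Q.conj_one]
    mul_one := fun x => by
      ext <;> simp [CD.mul_fst, CD.mul_snd, CD.one_fst, CD.one_snd] }

/-- The algebra `CD(A, ζ)` is again quadratic, with trace `T (a, b) = T a` and norm
`N (a, b) = N a - ζ N b`; hence its involution is `(a, b) ↦ (ā, -b)`. -/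
def cdStructure [IsScalarTower K A A] [SMulCommClass K A A] : QuadraticStructure K (CD Q ζ) where
  trace := Q.trace.comp (LinearMap.fst K A A)
  norm := Q.norm.comp (LinearMap.fst K A A) - ζ • Q.norm.comp (LinearMap.snd K A A)
  trace_one := Q.trace_one
  norm_one := by
    change Q.norm (1 : A) - ζ • Q.norm (0 : A) = 1
    rw [Q.norm_one, QuadraticMap.map_zero, smul_zero, sub_zero]
  quadratic := fun x => by
    change x * x - Q.trace x.1 • x + (Q.norm x.1 - ζ • Q.norm x.2) • (1 : CD Q ζ) = 0
    ext
    · rw [CD.add_fst, CD.sub_fst, CD.mul_fst, CD.smul_fst, CD.smul_fst, CD.one_fst, CD.zero_fst,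
        Q.mul_conj, ← Q.quadratic x.1, sub_smul, smul_assoc]
      abel
    · rw [CD.add_snd, CD.sub_snd, CD.mul_snd, CD.smul_snd, CD.smul_snd, CD.one_snd, CD.zero_snd,
        smul_zero, add_zero, Q.conj_apply, sub_mul, smul_mul_assoc, one_mul]
      abel

end CD

/-! ### The ring geometry `G(2, A)` and its Veronese representation

The geometry is written for a quadratic algebra `A` and the subset `R = tB` of `A`; it is used for
`A = B` (with `t = 0`, so `R = {0}`) and for `A = CD(B, 0)` (with `R = {(0, b) | b ∈ B}`). -/

section Geometry

variable {K A : Type*} [Field K] [NonAssocRing A] [Module K A]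

/-- The points `(x, y, 1)`, `(1, y, t z₁)` and `(t x₁, 1, t z₁)` of `G(2, A)`. -/
def geomPoints (R : Set A) : Set (Fin 3 → A) :=
  {p | (∃ x y : A, p = ![x, y, 1]) ∨ (∃ y : A, ∃ z ∈ R, p = ![1, y, z]) ∨
    (∃ x ∈ R, ∃ z ∈ R, p = ![x, 1, z])}

/-- The lines `[a, 1, c]`, `[1, t b₁, c]` and `[t a₁, t b₁, 1]` of `G(2, A)`. -/
def geomLines (R : Set A) : Set (Fin 3 → A) :=
  {l | (∃ a c : A, l = ![a, 1, c]) ∨ (∃ b ∈ R, ∃ c : A, l = ![1, b, c]) ∨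
    (∃ a ∈ R, ∃ b ∈ R, l = ![a, b, 1])}

/-- Incidence of `(x, y, z)` with `[a, b, c]`: `a x + b y + c z = 0`. -/
def Incident (p l : Fin 3 → A) : Prop := l 0 * p 0 + l 1 * p 1 + l 2 * p 2 = 0

/-- The vector space underlying `PG(3 dim A + 2, K)`. -/
abbrev Ambient (K A : Type*) : Type _ := (Fin 3 → K) × (Fin 3 → A)

/-- The vector `(x x̄, y ȳ, z z̄; y z̄, z x̄, x ȳ)` (recall `x x̄ = N x ∈ K`). -/
def veroneseVec (Q : QuadraticStructure K A) (p : Fin 3 → A) : Ambient K A :=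
  (fun i => Q.norm (p i), ![p 1 * Q.conj (p 2), p 2 * Q.conj (p 0), p 0 * Q.conj (p 1)])

/-- The image under the Veronese map of those points of `G(2, A)` that lie in `S`. -/
def veroneseImage (Q : QuadraticStructure K A) (R : Set A) (S : Set (Fin 3 → A)) :
    Set (ℙ K (Ambient K A)) :=
  {P | ∃ p ∈ geomPoints R, p ∈ S ∧ ∃ h : veroneseVec Q p ≠ 0,
    P = Projectivization.mk K (veroneseVec Q p) h}

end Geometry

section Projective

variable {K E : Type*} [Field K] [AddCommGroup E] [Module K E]

/-- The subspace spanned by a set of points. -/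
def pspan (S : Set (ℙ K E)) : Submodule K E := ⨆ P ∈ S, P.submodule

/-- The set of points of a subspace. -/
def pts (W : Submodule K E) : Set (ℙ K E) := {P | P.submodule ≤ W}

/-- Ovoids (`Q⁰_d`-quadrics) of the projective space of `W`: spanning point sets such that for each
`x` in `O` the union of the lines through `x` meeting `O` only in `x` is a hyperplane `H` of `W`,
and each other line of `W` through `x` meets `O` in exactly one further point. -/
def IsOvoid (W : Submodule K E) (O : Set (ℙ K E)) : Prop :=
  pspan O = W ∧
  ∀ x ∈ O, ∃ H : Submodule K E, H ⋖ W ∧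
    (∀ y : ℙ K E, y ∈ pts H ↔
      y ∈ pts W ∧ ∀ z ∈ O, z ∈ pts (x.submodule ⊔ y.submodule) → z = x) ∧
    (∀ y ∈ pts W, y ∉ pts H →
      ∃! z, z ∈ O ∧ z ≠ x ∧ z ∈ pts (x.submodule ⊔ y.submodule))

/-- Non-degenerate quadrics of Witt index 1 in the projective space of `W`: the quadric is
non-empty, contains no line, and its form is anisotropic on the radical of its polar form. -/
def IsWittIndexOneQuadric (W : Submodule K E) (O : Set (ℙ K E)) : Prop :=
  ∃ q : QuadraticForm K W,
    O = {P | P ∈ pts W ∧ ∀ w : W, (w : E) ∈ P.submodule → q w = 0} ∧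
    O.Nonempty ∧
    (∀ U : Submodule K W, (∀ u ∈ U, q u = 0) → Module.rank K U ≤ 1) ∧
    (∀ r : W, q r = 0 → (∀ w : W, QuadraticMap.polar q r w = 0) → r = 0)

/-- `C` is the tube of `ξ` with vertex `V` and with base the ovoid `O` of the subspace `W`
complementary to `V` in `ξ`: the cone with vertex `V` over `O`, without its vertex. -/
def IsTube (ξ V W : Submodule K E) (O C : Set (ℙ K E)) : Prop :=
  V ⊓ W = ⊥ ∧ V ⊔ W = ξ ∧ IsOvoid W O ∧
    C = {P | P ∉ pts V ∧ ∃ q ∈ O, P ∈ pts (V ⊔ q.submodule)}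

/-- `V` is the vertex of the tube `C` of `ξ`. -/
def IsTubeVertex (ξ : Submodule K E) (C : Set (ℙ K E)) (V : Submodule K E) : Prop :=
  ∃ W O, IsTube ξ V W O C

/-- `T` is a line meeting each of `R₁`, `R₂`, `R₃`. -/
def IsTransversal (R₁ R₂ R₃ T : Submodule K E) : Prop :=
  Module.finrank K T = 2 ∧ T ⊓ R₁ ≠ ⊥ ∧ T ⊓ R₂ ≠ ⊥ ∧ T ⊓ R₃ ≠ ⊥

/-- The regulus determined by three pairwise disjoint `v`-spaces of a `(2v+1)`-space: the subspaces
that meet each transversal of the three in exactly one point, and consist of such points only. -/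
def regulus (R₁ R₂ R₃ : Submodule K E) : Set (Submodule K E) :=
  {R | (∀ T, IsTransversal R₁ R₂ R₃ T → Module.finrank K ↥(T ⊓ R) = 1) ∧
    ∀ P ∈ pts R, ∃ T, IsTransversal R₁ R₂ R₃ T ∧ P ∈ pts T}

/-- `S` is a regular spread of `Y`, with members of vector space dimension `r`: the members of `S`
partition the points of `Y`, the members meeting the span of two distinct members are contained in
that span, and in such a span each regulus determined by three members consists of members. -/
def IsRegularSpread (r : Cardinal) (S : Set (Submodule K E)) (Y : Submodule K E) : Prop :=
  (∀ V ∈ S, V ≤ Y ∧ Module.rank K V = r) ∧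
  (∀ P ∈ pts Y, ∃! V, V ∈ S ∧ P ∈ pts V) ∧
  (∀ V₁ ∈ S, ∀ V₂ ∈ S, V₁ ≠ V₂ → ∀ V ∈ S, V ⊓ (V₁ ⊔ V₂) ≠ ⊥ → V ≤ V₁ ⊔ V₂) ∧
  (∀ V₁ ∈ S, ∀ V₂ ∈ S, ∀ V₃ ∈ S, V₁ ≠ V₂ → V₁ ≠ V₃ → V₂ ≠ V₃ → V₃ ≤ V₁ ⊔ V₂ →
    regulus V₁ V₂ V₃ ⊆ S)

/-- Two structures of points and subspaces, the first one living in the subspace `F` of its ambient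
space, are projectively equivalent. -/
def ProjectivelyEquivalentIn {E' : Type*} [AddCommGroup E'] [Module K E'] (F : Submodule K E)
    (X : Set (ℙ K E)) (Ξ : Set (Submodule K E))
    (X' : Set (ℙ K E')) (Ξ' : Set (Submodule K E')) : Prop :=
  ∃ (φ : E' →ₗ[K] E) (hφ : Function.Injective φ), LinearMap.range φ = F ∧
    X = Projectivization.map φ hφ '' X' ∧ Ξ = Submodule.map φ '' Ξ'

/-- The structure `(S, ℬ)` of subspaces, with containment as incidence, is isomorphic to the
projective plane `PG(2, B)`. -/
def IsIsoToPG2 (B : Type*) [DivisionRing B] (S ℬ : Set (Submodule K E)) : Prop :=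
  ∃ (f : {U : Submodule B (Fin 3 → B) // Module.finrank B U = 1} ≃ S)
    (g : {U : Submodule B (Fin 3 → B) // Module.finrank B U = 2} ≃ ℬ),
    ∀ U L, U.1 ≤ L.1 ↔ (f U).1 ≤ (g L).1

/-- `γ` is a regular parametrization `(s, t) ↦ s² a + s t b + t² c` of a conic by the projective
line, where `a, b, c` are linearly independent. The cross-ratio on a conic is the one transported
from the projective line by such a `γ`. -/
def IsConicParam (γ : ℙ K (Fin 2 → K) → ℙ K E) : Prop :=
  ∃ a b c : E, LinearIndependent K ![a, b, c] ∧ ∀ (w : Fin 2 → K) (hw : w ≠ 0),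
    (γ (Projectivization.mk K w hw)).submodule =
      Submodule.span K {(w 0) ^ 2 • a + (w 0 * w 1) • b + (w 1) ^ 2 • c}

/-- The map `ρ` from the projective line to subspaces is a parametrization of a regulus that
preserves the cross-ratio: it is a bijection onto the regulus determined by three of its values,
and on each transversal `T` of it the map `p ↦ T ∩ ρ p` is a projectivity (i.e. it is induced by a
linear isomorphism of `K²` with `T`). -/
def IsRegulusParam (ρ : ℙ K (Fin 2 → K) → Submodule K E) : Prop :=
  Function.Injective ρ ∧
  ∃ p₁ p₂ p₃ : ℙ K (Fin 2 → K), p₁ ≠ p₂ ∧ p₁ ≠ p₃ ∧ p₂ ≠ p₃ ∧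
    Set.range ρ = regulus (ρ p₁) (ρ p₂) (ρ p₃) ∧
    ∀ T, IsTransversal (ρ p₁) (ρ p₂) (ρ p₃) T →
      ∃ (ℓ : (Fin 2 → K) →ₗ[K] E) (hℓ : Function.Injective ℓ), LinearMap.range ℓ = T ∧
        ∀ p, T ⊓ ρ p = (Projectivization.map ℓ hℓ p).submodule

/-- The maps `χ₀` (on points) and `χ₁` (on blocks) form a duality from the structure `(X, Ξ)` of
points and subspaces to the structure `(S, ℬ)`. -/
def IsDuality (X : Set (ℙ K E)) (Ξ S ℬ : Set (Submodule K E))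
    (χ₀ : ℙ K E → Submodule K E) (χ₁ : Submodule K E → Submodule K E) : Prop :=
  Set.BijOn χ₀ X ℬ ∧ Set.BijOn χ₁ Ξ S ∧ ∀ x ∈ X, ∀ ξ ∈ Ξ, x ∈ pts ξ ↔ χ₁ ξ ≤ χ₀ x

/-- The duality `(χ₀, χ₁)` is linear: for each `ξ` in `Ξ`, with `V = χ₁ ξ`, and each conic
contained in `X ∩ ξ`, the map `x ↦ χ₀ x / V` sends the conic to a regulus in the quotient by `V`
(i.e. after projection from `V`) and it preserves the cross-ratio. -/
def IsLinearDuality (X : Set (ℙ K E)) (Ξ S ℬ : Set (Submodule K E))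
    (χ₀ : ℙ K E → Submodule K E) (χ₁ : Submodule K E → Submodule K E) : Prop :=
  IsDuality X Ξ S ℬ χ₀ χ₁ ∧
  ∀ ξ ∈ Ξ, ∀ γ : ℙ K (Fin 2 → K) → ℙ K E, IsConicParam γ →
    (∀ p, γ p ∈ X ∩ pts ξ) →
    IsRegulusParam (fun p => (χ₀ (γ p)).map (χ₁ ξ).mkQ)

end Projective

section Veronese

variable {K A : Type*} [Field K] [NonAssocRing A] [Module K A]

/-- The point set of the Veronese representation of `G(2, A)`. -/
def veronesePoints (Q : QuadraticStructure K A) (R : Set A) : Set (ℙ K (Ambient K A)) :=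
  veroneseImage Q R Set.univ

/-- The set of subspaces `⟨ρ(L)⟩`, with `L` a line, of the Veronese representation of `G(2, A)`. -/
def veroneseSpaces (Q : QuadraticStructure K A) (R : Set A) :
    Set (Submodule K (Ambient K A)) :=
  {ξ | ∃ l ∈ geomLines R, ξ = pspan (veroneseImage Q R {p | Incident p l})}

/-- The subset `tB` of `CD(B, 0)`. -/
def tSet (Q : QuadraticStructure K A) : Set (CD Q (0 : K)) :=
  {x | ∃ b : A, x = ((0 : A), b)}

end Veronese

end

end HjVeronese

open HjVeronese

universe u v

/-! Write a point of the geometry over `CD(B, 0)` as a column `x` over `B` together with the row `c`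
of its conjugated `t`-components. Its Veronese vector then becomes the pair `(x x*, c × x)`: a rank
one Hermitian matrix over `B`, and a row annihilating `x` (`veroneseVec_cdRow`,
`crossRow_dotProduct`). For fixed normalized `x`, the row `c × x` takes every value `h` with `h x =
0`, so `X` is the set of points `K (x x*, h)` with `x ≠ 0` and `h x = 0` (`mem_veronesePoints_cd`).
The ambient space is `Herm₃(B) ⊕ B³`; `F` is the first summand and `Y` the second, and the rest is
linear algebra over `B`.

A line of the geometry lies over a line `l x = 0` of the plane over `B`. Its points are the `(x x*,
s (x x*) + r l)` with `r` free in `B` and `s` a `K`-linear map determined by the `t`-components of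
the line (`LineShift`). If `e`, `f` span the line `l`, the matrices `x x*` form the image of the
quadric `s t = N b` under the injective map `lineParam` (`veroneseVec_rcomb`). As `B` is a division
algebra, `N` is anisotropic, so this quadric has Witt index 1 and is an ovoid; the free `r` makes
the line a tube with vertex `B l`. That no other subspace can serve as vertex is `IsTube.vertex_eq`.

Hence the vertices are the one-dimensional left subspaces of `B³`, that is, the Desarguesian spread.
Its reguli are computed in `regulus_eq`: in suitable coordinates they are the families `B (w₁ g - w₀
h)` with `w` in `K²`.

Projection from `Y` to `F` forgets `s`, whereas `ξ ∩ F` has the full dimension only for `s = 0`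
(`LineShift.inf_eq_of_rank`); both descriptions of `Ξ'` thus give the Veronese representation over
`B`. The duality takes annihilators: `x x*` goes to the rows killing `x`, and the line `l` to `B l`.
It is linear because every conic on a line is, after rescaling `e` and `f`, the subline `e w₀ + f
w₁` with `w` in `K²` (`exists_frame_of_conic`), and its annihilators modulo `l` form the standard
regulus with the same parameter (`LineFrame.isRegulusParam`). -/

namespace HjVeronese

noncomputable section

open Matrix

/-! ### Quadratic division algebras: conjugation, norm, and Hermitian matrices. -/

section Algebra

variable {K : Type u} {B : Type v} [Field K] [DivisionRing B] [Algebra K B]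
  (Q : QuadraticStructure K B)

namespace QuadraticStructure

theorem trace_conj (a : B) : Q.trace (Q.conj a) = Q.trace a := by
  rw [conj_apply, map_sub, map_smul, Q.trace_one, smul_eq_mul]; ring

theorem conj_conj (a : B) : Q.conj (Q.conj a) = a := by
  rw [Q.conj_apply (Q.conj a), trace_conj, conj_apply]; abel

theorem conj_mul_self (a : B) : Q.conj a * a = Q.norm a • (1 : B) := by
  rw [← Q.mul_conj, conj_apply]; simp [sub_mul, mul_sub]

theorem smul_one_injective {k k' : K} (h : k • (1 : B) = k' • (1 : B)) : k = k' :=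
  smul_left_injective K (one_ne_zero (α := B)) h

theorem norm_conj (a : B) : Q.norm (Q.conj a) = Q.norm a := by
  apply smul_one_injective (B := B)
  rw [← Q.mul_conj, conj_conj, conj_mul_self]

/-- Anisotropy of the norm: since `a ā = N a`, this is the absence of zero divisors. The Witt index
of all the quadrics below rests on it. -/
theorem norm_eq_zero {a : B} : Q.norm a = 0 ↔ a = 0 := by
  refine ⟨fun h => ?_, fun h => by rw [h, QuadraticMap.map_zero]⟩
  have h1 := Q.mul_conj a
  rw [h, zero_smul, mul_eq_zero] at h1
  rcases h1 with h1 | h1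
  · exact h1
  · rw [← Q.conj_conj a, h1, map_zero]

theorem conj_eq_zero {a : B} : Q.conj a = 0 ↔ a = 0 := by
  rw [← Q.norm_eq_zero, norm_conj, norm_eq_zero]

theorem self_add_conj (a : B) : a + Q.conj a = Q.trace a • (1 : B) := by
  rw [conj_apply]; abel

theorem mul_conj_add_mul_conj (a b : B) :
    a * Q.conj b + b * Q.conj a = QuadraticMap.polar Q.norm a b • (1 : B) := by
  have h := Q.mul_conj (a + b)
  rw [QuadraticMap.polar, sub_smul, sub_smul, ← h, ← Q.mul_conj, ← Q.mul_conj, map_add, add_mul,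
    mul_add, mul_add]
  abel

/-- Put `c = a b` and `y = b̄ ā`. Polarizing the norm gives `c + y = s` in `K`, and `c y = N a N b`,
so `c` is a root of `X² - s X + N a N b` as well as of its own quadratic equation. Either the traces
agree and `y = c̄`, or `c` is a scalar. -/
theorem conj_mul (a b : B) : Q.conj (a * b) = Q.conj b * Q.conj a := by
  by_cases ha : a = 0
  · simp [ha]
  set c := a * b with hc
  set y := Q.conj b * Q.conj a with hy
  obtain ⟨s, hs⟩ : ∃ s : K, c + y = s • (1 : B) := by
    have h := Q.mul_conj_add_mul_conj a (Q.conj b)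
    rw [conj_conj] at h
    exact ⟨_, h⟩
  have hcy : c * y = (Q.norm a * Q.norm b) • (1 : B) := by
    rw [hc, hy, mul_assoc, ← mul_assoc b, Q.mul_conj, smul_mul_assoc, one_mul, mul_smul_comm,
      Q.mul_conj, smul_smul, mul_comm]
  have hy' : y = s • (1 : B) - c := by rw [← hs]; abel
  have hq := Q.quadratic c
  -- The difference of the two quadratic equations satisfied by `c`.
  have h1 : (s - Q.trace c) • c = (Q.norm a * Q.norm b - Q.norm c) • (1 : B) := by
    rw [hy', mul_sub, mul_smul_comm, mul_one] at hcy
    have hcc : c * c = Q.trace c • c - Q.norm c • (1 : B) := by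
      rw [← sub_eq_zero, ← hq]; abel
    rw [sub_smul, sub_smul, ← hcy, hcc]
    abel
  by_cases hT : s = Q.trace c
  · rw [conj_apply, hy', hT]
  have hck : ∃ k : K, c = k • (1 : B) := by
    refine ⟨(s - Q.trace c)⁻¹ * (Q.norm a * Q.norm b - Q.norm c), ?_⟩
    rw [mul_smul, ← h1, smul_smul, inv_mul_cancel₀ (sub_ne_zero.2 hT), one_smul]
  obtain ⟨k, hk⟩ := hck
  have hNa : Q.norm a ≠ 0 := fun h => ha (Q.norm_eq_zero.1 h)
  -- In the scalar case `b` is a `K`-multiple of `ā`, and both sides can be evaluated.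
  have hb : b = (k * (Q.norm a)⁻¹) • Q.conj a := by
    apply mul_left_cancel₀ ha
    rw [mul_smul_comm, Q.mul_conj, smul_smul, mul_assoc, inv_mul_cancel₀ hNa, mul_one, ← hk]
  rw [hk, map_smul, conj_one, hy, hb, map_smul, conj_conj, smul_mul_assoc, Q.mul_conj, smul_smul,
    mul_assoc, inv_mul_cancel₀ hNa, mul_one]

theorem norm_mul (a b : B) : Q.norm (a * b) = Q.norm a * Q.norm b := by
  apply smul_one_injective (B := B)
  rw [← Q.mul_conj, conj_mul, mul_assoc, ← mul_assoc b, Q.mul_conj, smul_mul_assoc, one_mul,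
    mul_smul_comm, Q.mul_conj, smul_smul, mul_comm]

theorem norm_add (a b : B) : Q.norm (a + b) = Q.norm a + Q.norm b + Q.trace (a * Q.conj b) := by
  apply smul_one_injective (B := B)
  rw [add_smul, add_smul, ← self_add_conj, conj_mul, conj_conj, ← Q.mul_conj, ← Q.mul_conj,
    ← Q.mul_conj, map_add, add_mul, mul_add, mul_add]
  abel

theorem norm_smul (k : K) (a : B) : Q.norm (k • a) = k * k * Q.norm a := by
  rw [QuadraticMap.map_smul, smul_eq_mul]

end QuadraticStructure

/-! ### Hermitian matrices and the Veronese map -/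

/-- The `j`-th entry of the product of the row `h` with the Hermitian matrix
with diagonal `n` and off-diagonal entries `w 0 = m₁₂`, `w 1 = m₂₀`, `w 2 = m₀₁`. -/
def rowMul (h : Fin 3 → B) : Ambient K B →ₗ[K] (Fin 3 → B) where
  toFun w := ![w.1 0 • h 0 + h 1 * Q.conj (w.2 2) + h 2 * w.2 1,
    h 0 * w.2 2 + w.1 1 • h 1 + h 2 * Q.conj (w.2 0),
    h 0 * Q.conj (w.2 1) + h 1 * w.2 0 + w.1 2 • h 2]
  map_add' w w' := by
    ext i
    fin_cases i <;> simp [add_smul, mul_add] <;> abel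
  map_smul' k w := by
    ext i
    fin_cases i <;> simp [smul_smul, smul_add]

/-- The Veronese vector of `x` is the Hermitian matrix `x x*`, and `h (x x*) = (h x) x*`. Incidence
thereby becomes a linear condition on the Veronese image. -/
theorem rowMul_veroneseVec (h x : Fin 3 → B) (j : Fin 3) :
    rowMul Q h (veroneseVec Q x) j = (h ⬝ᵥ x) * Q.conj (x j) := by
  fin_cases j <;>
  simp [rowMul, veroneseVec, dotProduct, Fin.sum_univ_three, add_mul, Q.conj_mul, Q.conj_conj,
    mul_assoc, Q.mul_conj]

theorem rowMul_veroneseVec_eq_zero_iff {h x : Fin 3 → B} (hx : x ≠ 0) :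
    rowMul Q h (veroneseVec Q x) = 0 ↔ h ⬝ᵥ x = 0 := by
  constructor
  · intro hh
    obtain ⟨j, hj⟩ := Function.ne_iff.1 hx
    have := congrFun hh j
    rw [rowMul_veroneseVec] at this
    rcases mul_eq_zero.1 this with h1 | h1
    · exact h1
    · exact absurd (Q.conj_eq_zero.1 h1) hj
  · intro hh
    ext j
    rw [rowMul_veroneseVec, hh, zero_mul, Pi.zero_apply]

theorem veroneseVec_ne_zero {x : Fin 3 → B} (hx : x ≠ 0) : veroneseVec Q x ≠ 0 := by
  intro h
  apply hx
  ext i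
  exact Q.norm_eq_zero.1 (congrFun (congrArg Prod.fst h) i)

/-- The Hermitian matrix `e b f* + f b* e*`. -/
def crossTerm (e f : Fin 3 → B) : B →ₗ[K] Ambient K B where
  toFun b := (fun i => Q.trace (e i * b * Q.conj (f i)),
    ![e 1 * b * Q.conj (f 2) + f 1 * Q.conj b * Q.conj (e 2),
      e 2 * b * Q.conj (f 0) + f 2 * Q.conj b * Q.conj (e 0),
      e 0 * b * Q.conj (f 1) + f 0 * Q.conj b * Q.conj (e 1)])
  map_add' b b' := by
    ext i
    · simp [mul_add, add_mul]
    · fin_cases i <;> simp [mul_add, add_mul] <;> abel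
  map_smul' k b := by
    ext i
    · simp
    · fin_cases i <;> simp [smul_add]

/-- The parametrization of the matrices supported on the right span of `e` and `f`. -/
def lineParam (e f : Fin 3 → B) : (K × K × B) →ₗ[K] Ambient K B where
  toFun m := m.1 • veroneseVec Q e + m.2.1 • veroneseVec Q f + crossTerm Q e f m.2.2
  map_add' m m' := by simp only [Prod.fst_add, Prod.snd_add, add_smul, map_add]; abel
  map_smul' k m := by
    simp only [Prod.smul_fst, Prod.smul_snd, map_smul, smul_add, smul_smul, smul_eq_mul,
      RingHom.id_apply]

theorem lineParam_apply (e f : Fin 3 → B) (m : K × K × B) : lineParam Q e f m =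
    m.1 • veroneseVec Q e + m.2.1 • veroneseVec Q f + crossTerm Q e f m.2.2 := rfl

/-- The vector `e α + f β`. -/
def rcomb (e f : Fin 3 → B) (α β : B) : Fin 3 → B := fun i => e i * α + f i * β

theorem dotProduct_rcomb (h e f : Fin 3 → B) (α β : B) :
    h ⬝ᵥ rcomb e f α β = (h ⬝ᵥ e) * α + (h ⬝ᵥ f) * β := by
  simp only [rcomb, dotProduct, Fin.sum_univ_three, mul_add, add_mul, mul_assoc]; abel

/-- Expansion of `(e α + f β)(e α + f β)*`. The three parameters satisfy `N α · N β = N (α β̄)`,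
which is how the quadric `s t = N b` enters. -/
theorem veroneseVec_rcomb (e f : Fin 3 → B) (α β : B) :
    veroneseVec Q (rcomb e f α β) = lineParam Q e f (Q.norm α, Q.norm β, α * Q.conj β) := by
  have key : ∀ i j, (e i * α + f i * β) * Q.conj (e j * α + f j * β) =
      Q.norm α • (e i * Q.conj (e j)) + Q.norm β • (f i * Q.conj (f j)) +
        (e i * (α * Q.conj β) * Q.conj (f j) +
          f i * Q.conj (α * Q.conj β) * Q.conj (e j)) := by
    intro i j
    have h1 : e i * α * (Q.conj α * Q.conj (e j)) = Q.norm α • (e i * Q.conj (e j)) := by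
      rw [mul_assoc, ← mul_assoc α, Q.mul_conj, smul_mul_assoc, one_mul, mul_smul_comm]
    have h2 : f i * β * (Q.conj β * Q.conj (f j)) = Q.norm β • (f i * Q.conj (f j)) := by
      rw [mul_assoc, ← mul_assoc β, Q.mul_conj, smul_mul_assoc, one_mul, mul_smul_comm]
    simp only [map_add, Q.conj_mul, Q.conj_conj, add_mul, mul_add, h1, h2]
    simp only [mul_assoc]
    abel
  rw [lineParam_apply]
  ext i
  · simp only [veroneseVec, rcomb, crossTerm, Q.norm_add, Q.norm_mul, LinearMap.coe_mk,
      AddHom.coe_mk, Prod.fst_add, Prod.smul_fst, Pi.add_apply, Pi.smul_apply, smul_eq_mul,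
      Q.conj_mul, mul_assoc]
    ring
  · fin_cases i <;>
    simp [veroneseVec, rcomb, crossTerm, key, -map_add]

theorem rowMul_lineParam (h e f : Fin 3 → B) (m : K × K × B) (j : Fin 3) :
    rowMul Q h (lineParam Q e f m) j =
      (h ⬝ᵥ e) * (m.1 • Q.conj (e j) + m.2.2 * Q.conj (f j)) +
      (h ⬝ᵥ f) * (m.2.1 • Q.conj (f j) + Q.conj m.2.2 * Q.conj (e j)) := by
  obtain ⟨s, t, b⟩ := m
  have hc : rowMul Q h (crossTerm Q e f b) j =
      (h ⬝ᵥ e) * (b * Q.conj (f j)) + (h ⬝ᵥ f) * (Q.conj b * Q.conj (e j)) := by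
    have ht : ∀ i, Q.trace (e i * b * Q.conj (f i)) • h i =
        h i * (e i * b * Q.conj (f i) + f i * Q.conj b * Q.conj (e i)) := by
      intro i
      have := Q.self_add_conj (e i * b * Q.conj (f i))
      rw [Q.conj_mul, Q.conj_mul, Q.conj_conj, ← mul_assoc (f i)] at this
      rw [this, mul_smul_comm, mul_one]
    fin_cases j <;>
    simp only [rowMul, crossTerm, LinearMap.coe_mk, AddHom.coe_mk, ht] <;>
    simp [dotProduct, Fin.sum_univ_three, add_mul, mul_add, Q.conj_mul,
      Q.conj_conj, mul_assoc] <;> abel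
  rw [lineParam_apply, map_add, map_add, map_smul, map_smul, Pi.add_apply, Pi.add_apply,
    Pi.smul_apply, Pi.smul_apply, rowMul_veroneseVec, rowMul_veroneseVec, hc]
  simp only [mul_add, mul_smul_comm]
  abel

theorem veroneseVec_right_mul (x : Fin 3 → B) (a : B) :
    veroneseVec Q (fun i => x i * a) = Q.norm a • veroneseVec Q x := by
  have := veroneseVec_rcomb Q x 0 a 0
  simpa [rcomb, lineParam_apply, veroneseVec] using this

/-! ### Duality between points and lines of the plane over `B` -/

/-- The left subspace of the rows annihilating `x`. -/
def perp (x : Fin 3 → B) : Submodule B (Fin 3 → B) where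
  carrier := {h | h ⬝ᵥ x = 0}
  add_mem' {a b} ha hb := by
    change (a + b) ⬝ᵥ x = 0
    rw [add_dotProduct, show a ⬝ᵥ x = 0 from ha, show b ⬝ᵥ x = 0 from hb, add_zero]
  zero_mem' := zero_dotProduct x
  smul_mem' r a ha := by
    change (r • a) ⬝ᵥ x = 0
    rw [smul_dotProduct, show a ⬝ᵥ x = 0 from ha, smul_zero]

theorem mem_perp {h x : Fin 3 → B} : h ∈ perp x ↔ h ⬝ᵥ x = 0 := Iff.rfl

theorem exists_dotProduct_eq_one {x : Fin 3 → B} (hx : x ≠ 0) : ∃ g : Fin 3 → B, g ⬝ᵥ x = 1 := by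
  obtain ⟨j, hj⟩ := Function.ne_iff.1 hx
  refine ⟨Pi.single j (x j)⁻¹, ?_⟩
  rw [single_dotProduct, inv_mul_cancel₀ hj]

theorem eq_of_forall_dotProduct {x y : Fin 3 → B} (h : ∀ v : Fin 3 → B, v ⬝ᵥ x = v ⬝ᵥ y) :
    x = y := by
  ext j
  have := h (Pi.single j 1)
  rwa [single_dotProduct, single_dotProduct, one_mul, one_mul] at this

theorem dotProduct_right_mul (h x : Fin 3 → B) (a : B) :
    h ⬝ᵥ (fun i => x i * a) = (h ⬝ᵥ x) * a := by
  simp only [dotProduct, Finset.sum_mul, mul_assoc]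

/-- Columns are points up to right multiplication. Encoding a point by its left space of
annihilating rows avoids right modules; this lemma recovers the point from it. If `g x = 1`, every
row `v` differs from `(v x) g` by a row killing `x`, so `y = x (g y)`. -/
theorem exists_right_mul_of_perp_le {x y : Fin 3 → B} (hx : x ≠ 0) (h : perp x ≤ perp y) :
    ∃ a : B, y = fun i => x i * a := by
  obtain ⟨g, hg⟩ := exists_dotProduct_eq_one hx
  refine ⟨g ⬝ᵥ y, eq_of_forall_dotProduct fun v => ?_⟩
  have hv : v - (v ⬝ᵥ x) • g ∈ perp x := by
    rw [mem_perp, sub_dotProduct, smul_dotProduct, hg, smul_eq_mul, mul_one, sub_self]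
  have := h hv
  rw [mem_perp, sub_dotProduct, smul_dotProduct, sub_eq_zero] at this
  rw [dotProduct_right_mul, this, smul_eq_mul]

theorem finrank_perp {x : Fin 3 → B} (hx : x ≠ 0) : Module.finrank B (perp x) = 2 := by
  let φ : (Fin 3 → B) →ₗ[B] B :=
    { toFun := fun h => h ⬝ᵥ x
      map_add' := fun a b => add_dotProduct a b x
      map_smul' := fun r a => smul_dotProduct r a x }
  have hker : LinearMap.ker φ = perp x := rfl
  have hφ : φ ≠ 0 := by
    obtain ⟨g, hg⟩ := exists_dotProduct_eq_one hx
    intro h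
    have h0 : φ g = 0 := by rw [h]; rfl
    exact one_ne_zero (hg.symm.trans h0)
  have h1 := LinearMap.finrank_range_add_finrank_ker φ
  rw [LinearMap.range_eq_top.2 (LinearMap.surjective hφ), finrank_top, Module.finrank_self, hker,
    Module.finrank_pi, Fintype.card_fin] at h1
  omega

theorem exists_eq_perp {U : Submodule B (Fin 3 → B)} (hU : Module.finrank B U = 2) :
    ∃ x : Fin 3 → B, x ≠ 0 ∧ U = perp x := by
  have hlt : U < ⊤ := by
    rw [lt_top_iff_ne_top]
    rintro rfl
    rw [finrank_top, Module.finrank_pi, Fintype.card_fin] at hU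
    omega
  obtain ⟨φ, hφ, hle⟩ := Submodule.exists_le_ker_of_lt_top U hlt
  have hφx : ∀ h, φ h = h ⬝ᵥ (fun i => φ (Pi.single i 1)) := by
    intro h
    conv_lhs => rw [← Finset.univ_sum_single h]
    rw [map_sum, dotProduct]
    refine Finset.sum_congr rfl fun i _ => ?_
    rw [← smul_eq_mul, ← map_smul, ← Pi.single_smul, smul_eq_mul, mul_one]
  have hx : (fun i => φ (Pi.single i 1)) ≠ (0 : Fin 3 → B) := by
    intro h0
    apply hφ
    refine LinearMap.ext fun h => ?_
    rw [hφx, h0, dotProduct_zero, LinearMap.zero_apply]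
  refine ⟨_, hx, Submodule.eq_of_le_of_finrank_eq (fun h hh => ?_) ?_⟩
  · rw [mem_perp, ← hφx]; exact hle hh
  · rw [hU, finrank_perp hx]

/-- The points `e` and `f` span the line with left coordinates `l`; the rows `g` and `h` restrict
to the dual basis of the line. -/
structure LineFrame (l e f g h : Fin 3 → B) : Prop where
  le : l ⬝ᵥ e = 0
  lf : l ⬝ᵥ f = 0
  ge : g ⬝ᵥ e = 1
  gf : g ⬝ᵥ f = 0
  he : h ⬝ᵥ e = 0
  hf : h ⬝ᵥ f = 1
  row : ∀ v : Fin 3 → B, ∃ r : B, v = r • l + (v ⬝ᵥ e) • g + (v ⬝ᵥ f) • h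

theorem LineFrame.exists_rcomb {l e f g h : Fin 3 → B} (F : LineFrame l e f g h)
    {x : Fin 3 → B} (hx : l ⬝ᵥ x = 0) : x = rcomb e f (g ⬝ᵥ x) (h ⬝ᵥ x) := by
  refine eq_of_forall_dotProduct fun v => ?_
  obtain ⟨r, hr⟩ := F.row v
  rw [dotProduct_rcomb]
  conv_lhs => rw [hr]
  rw [add_dotProduct, add_dotProduct, smul_dotProduct, smul_dotProduct, smul_dotProduct, hx,
    smul_zero, zero_add, smul_eq_mul, smul_eq_mul]

/-- A suitable `g` is any row killing `f` but not `e`, rescaled; likewise `h`. The last field holds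
because `perp e ⊓ perp f` has dimension one and hence is `B l`. -/
theorem exists_lineFrame {l e f : Fin 3 → B} (hl : l ≠ 0) (he : e ≠ 0) (hf : f ≠ 0)
    (hle : l ⬝ᵥ e = 0) (hlf : l ⬝ᵥ f = 0) (hef : perp e ≠ perp f) :
    ∃ g h, LineFrame l e f g h := by
  have aux : ∀ {x y : Fin 3 → B}, x ≠ 0 → y ≠ 0 → perp x ≠ perp y →
      ∃ g : Fin 3 → B, g ⬝ᵥ x = 1 ∧ g ⬝ᵥ y = 0 := by
    intro x y hx hy hxy
    have : ¬ perp y ≤ perp x := fun h =>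
      hxy (Submodule.eq_of_le_of_finrank_eq h (by rw [finrank_perp hx, finrank_perp hy])).symm
    obtain ⟨g, hg, hg'⟩ := SetLike.not_le_iff_exists.1 this
    refine ⟨(g ⬝ᵥ x)⁻¹ • g, ?_, ?_⟩
    · rw [smul_dotProduct, smul_eq_mul, inv_mul_cancel₀ hg']
    · rw [smul_dotProduct, mem_perp.1 hg, smul_zero]
  obtain ⟨g, ge, gf⟩ := aux he hf hef
  obtain ⟨h, hhf, hhe⟩ := aux hf he hef.symm
  have hlt : perp e ⊓ perp f < perp e := by
    refine lt_of_le_of_ne inf_le_left fun hh => ?_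
    have h1 : h ∈ perp e ⊓ perp f := by rw [hh]; exact hhe
    exact zero_ne_one ((mem_perp.1 h1.2).symm.trans hhf)
  have hrank := Submodule.finrank_lt_finrank_of_lt hlt
  rw [finrank_perp he] at hrank
  have hspan : Submodule.span B {l} = perp e ⊓ perp f := by
    refine Submodule.eq_of_le_of_finrank_le ?_ ?_
    · rw [Submodule.span_singleton_le_iff_mem]; exact ⟨hle, hlf⟩
    · rw [finrank_span_singleton hl]; omega
  refine ⟨g, h, hle, hlf, ge, gf, hhe, hhf, fun v => ?_⟩
  have hv : v - (v ⬝ᵥ e) • g - (v ⬝ᵥ f) • h ∈ perp e ⊓ perp f := by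
    constructor
    · change _ ⬝ᵥ _ = _
      simp [sub_dotProduct, smul_dotProduct, ge, hhe]
    · change _ ⬝ᵥ _ = _
      simp [sub_dotProduct, smul_dotProduct, gf, hhf]
  rw [← hspan, Submodule.mem_span_singleton] at hv
  obtain ⟨r, hr⟩ := hv
  exact ⟨r, by rw [hr]; abel⟩

/-- Multiplying the matrix on the left by the dual rows `g` and `h`, and the conjugated results by
them again, isolates its coefficients `s`, `b` and `t`. -/
theorem LineFrame.lineParam_injective {l e f g h : Fin 3 → B} (F : LineFrame l e f g h) :
    Function.Injective (lineParam Q e f) := by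
  rw [← LinearMap.ker_eq_bot, LinearMap.ker_eq_bot']
  rintro ⟨s, t, b⟩ hm
  have h1 : ∀ (r : K) (c : B) (x y : Fin 3 → B), (∀ j, r • Q.conj (x j) + c * Q.conj (y j) = 0) →
      ∀ v, (v ⬝ᵥ x) * (r • 1) + (v ⬝ᵥ y) * Q.conj c = 0 := by
    intro r c x y hxy v
    have h2 : ∀ j, x j * (r • 1) + y j * Q.conj c = 0 := by
      intro j
      have := congrArg Q.conj (hxy j)
      simpa [Q.conj_mul, Q.conj_conj] using this
    have h3 : rcomb x y (r • 1) (Q.conj c) = 0 := funext h2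
    rw [← dotProduct_rcomb, h3, dotProduct_zero]
  have hg : ∀ j, s • Q.conj (e j) + b * Q.conj (f j) = 0 := by
    intro j
    have := congrFun (congrArg (rowMul Q g) hm) j
    rw [rowMul_lineParam, F.ge, F.gf, map_zero] at this
    simpa using this
  have hh : ∀ j, t • Q.conj (f j) + Q.conj b * Q.conj (e j) = 0 := by
    intro j
    have := congrFun (congrArg (rowMul Q h) hm) j
    rw [rowMul_lineParam, F.he, F.hf, map_zero] at this
    simpa using this
  have e1 := h1 s b e f hg g
  have e2 := h1 s b e f hg h
  have e3 := h1 t _ f e hh h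
  rw [F.ge, F.gf] at e1
  rw [F.he, F.hf] at e2
  rw [F.he, F.hf] at e3
  simp only [one_mul, zero_mul, add_zero, zero_add, smul_eq_zero, one_ne_zero, or_false,
    Q.conj_eq_zero] at e1 e2 e3
  rw [e1, e2, e3]; rfl

/-- The span of the Veronese images of the points of the line with coordinates `l`. -/
def lineSpan (l : Fin 3 → B) : Submodule K (Ambient K B) :=
  Submodule.span K {w | ∃ x : Fin 3 → B, x ≠ 0 ∧ l ⬝ᵥ x = 0 ∧ w = veroneseVec Q x}

theorem LineFrame.lineSpan_eq {l e f g h : Fin 3 → B} (F : LineFrame l e f g h) :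
    lineSpan Q l = LinearMap.range (lineParam Q e f) := by
  have he : e ≠ 0 := by rintro rfl; simpa using F.ge
  have hf : f ≠ 0 := by rintro rfl; simpa using F.hf
  apply le_antisymm
  · rw [lineSpan, Submodule.span_le]
    rintro _ ⟨x, -, hx, rfl⟩
    rw [F.exists_rcomb hx, veroneseVec_rcomb]
    exact ⟨_, rfl⟩
  · rintro _ ⟨⟨s, t, b⟩, rfl⟩
    have hE : veroneseVec Q e ∈ lineSpan Q l := Submodule.subset_span ⟨e, he, F.le, rfl⟩
    have hF : veroneseVec Q f ∈ lineSpan Q l := Submodule.subset_span ⟨f, hf, F.lf, rfl⟩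
    -- The cross term with coefficient `b` is the Veronese vector of the point `e b + f`, up to
    -- multiples of those of `e` and `f`.
    have hx : rcomb e f b 1 ≠ 0 := by
      intro h0
      have := dotProduct_rcomb h e f b 1
      rw [h0, F.he, F.hf] at this
      simp at this
    have hC : veroneseVec Q (rcomb e f b 1) ∈ lineSpan Q l :=
      Submodule.subset_span ⟨_, hx, by rw [dotProduct_rcomb, F.le, F.lf]; simp, rfl⟩
    have : lineParam Q e f (s, t, b) = (s - Q.norm b) • veroneseVec Q e +
        (t - 1) • veroneseVec Q f + veroneseVec Q (rcomb e f b 1) := by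
      rw [veroneseVec_rcomb, lineParam_apply, lineParam_apply, Q.conj_one, mul_one, Q.norm_one]
      module
    rw [this]
    exact add_mem (add_mem (Submodule.smul_mem _ _ hE) (Submodule.smul_mem _ _ hF)) hC

theorem veroneseVec_mem_lineSpan_iff {l x : Fin 3 → B} (hx : x ≠ 0) :
    veroneseVec Q x ∈ lineSpan Q l ↔ l ⬝ᵥ x = 0 := by
  refine ⟨fun h => ?_, fun h => Submodule.subset_span ⟨x, hx, h, rfl⟩⟩
  rw [← rowMul_veroneseVec_eq_zero_iff Q hx]
  have : lineSpan Q l ≤ LinearMap.ker (rowMul Q l) := by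
    rw [lineSpan, Submodule.span_le]
    rintro _ ⟨y, hy, hly, rfl⟩
    exact (rowMul_veroneseVec_eq_zero_iff Q hy).2 hly
  exact this h

end Algebra

/-! ### Projective points versus representing vectors. -/

section PointSets

variable {K E : Type*} [Field K] [AddCommGroup E] [Module K E]

theorem mk_mem_pts {x : E} (hx : x ≠ 0) {W : Submodule K E} :
    Projectivization.mk K x hx ∈ pts W ↔ x ∈ W := by
  rw [pts, Set.mem_ofPred_eq, Projectivization.submodule_mk, Submodule.span_singleton_le_iff_mem]

theorem eq_mk_of_submodule {P : ℙ K E} {x : E} (hx : x ≠ 0)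
    (h : P.submodule = Submodule.span K {x}) : P = Projectivization.mk K x hx :=
  Projectivization.submodule_injective (h.trans (Projectivization.submodule_mk x hx).symm)

theorem ne_zero_of_submodule_eq {P : ℙ K E} {x : E} (h : P.submodule = Submodule.span K {x}) :
    x ≠ 0 := by
  rintro rfl
  have h1 : P.rep ∈ P.submodule := by
    rw [Projectivization.submodule_eq]; exact Submodule.mem_span_singleton_self _
  rw [h, Submodule.span_zero_singleton, Submodule.mem_bot] at h1
  exact P.rep_nonzero h1

theorem mk_eq_mk_iff_exists {x y : E} (hx : x ≠ 0) (hy : y ≠ 0) :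
    Projectivization.mk K x hx = Projectivization.mk K y hy ↔ ∃ c : K, c ≠ 0 ∧ x = c • y := by
  rw [Projectivization.mk_eq_mk_iff']
  constructor
  · rintro ⟨c, rfl⟩
    exact ⟨c, fun h => hx (by rw [h, zero_smul]), rfl⟩
  · rintro ⟨c, -, rfl⟩
    exact ⟨c, rfl⟩

theorem span_singleton_eq_iff_exists {x y : E} (hx : x ≠ 0) :
    Submodule.span K {x} = Submodule.span K {y} ↔ ∃ c : K, c ≠ 0 ∧ x = c • y := by
  constructor
  · intro h
    have hx' : x ∈ Submodule.span K {y} := by rw [← h]; exact Submodule.mem_span_singleton_self _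
    obtain ⟨c, rfl⟩ := Submodule.mem_span_singleton.1 hx'
    exact ⟨c, fun h => hx (by rw [h, zero_smul]), rfl⟩
  · rintro ⟨c, hc, rfl⟩
    exact Submodule.span_singleton_smul_eq (IsUnit.mk0 c hc) y

theorem mk_mem_pts_sup_iff {x y z : E} (hx : x ≠ 0) (hy : y ≠ 0) (hz : z ≠ 0) :
    Projectivization.mk K z hz ∈ pts ((Projectivization.mk K x hx).submodule ⊔
      (Projectivization.mk K y hy).submodule) ↔ ∃ a b : K, z = a • x + b • y := by
  rw [mk_mem_pts, Projectivization.submodule_mk, Projectivization.submodule_mk,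
    Submodule.mem_sup]
  constructor
  · rintro ⟨_, h1, _, h2, rfl⟩
    obtain ⟨a, rfl⟩ := Submodule.mem_span_singleton.1 h1
    obtain ⟨b, rfl⟩ := Submodule.mem_span_singleton.1 h2
    exact ⟨a, b, rfl⟩
  · rintro ⟨a, b, rfl⟩
    exact ⟨_, Submodule.smul_mem _ _ (Submodule.mem_span_singleton_self _), _,
      Submodule.smul_mem _ _ (Submodule.mem_span_singleton_self _), rfl⟩

theorem mk_mem_pspan {S : Set (ℙ K E)} {x : E} (hx : x ≠ 0) (h : Projectivization.mk K x hx ∈ S) :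
    x ∈ pspan S := by
  have : (Projectivization.mk K x hx).submodule ≤ pspan S := le_biSup (fun P => P.submodule) h
  rwa [Projectivization.submodule_mk, Submodule.span_singleton_le_iff_mem] at this

theorem pspan_le {S : Set (ℙ K E)} {W : Submodule K E} (h : S ⊆ pts W) : pspan S ≤ W :=
  iSup₂_le fun _ hP => h hP

end PointSets

/-! ### The quadric `s t = N b` with `N` anisotropic. -/

section Hyperbolic

variable {K B : Type*} [Field K] [AddCommGroup B] [Module K B] (N : QuadraticForm K B)

/-- The quadratic form `(s, t, b) ↦ s t - N b`. -/
def hyperbolicForm : QuadraticForm K (K × K × B) :=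
  QuadraticMap.linMulLin (LinearMap.fst K K (K × B))
    ((LinearMap.fst K K B).comp (LinearMap.snd K K (K × B))) -
  N.comp ((LinearMap.snd K K B).comp (LinearMap.snd K K (K × B)))

theorem hyperbolicForm_apply (m : K × K × B) : hyperbolicForm N m = m.1 * m.2.1 - N m.2.2 := rfl

theorem polar_hyperbolicForm (m m' : K × K × B) :
    QuadraticMap.polar (hyperbolicForm N) m m' =
      m.1 * m'.2.1 + m.2.1 * m'.1 - QuadraticMap.polar N m.2.2 m'.2.2 := by
  simp only [QuadraticMap.polar, hyperbolicForm_apply, Prod.fst_add, Prod.snd_add]; ring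

variable {N}

/-- Pairing with one of the hyperbolic vectors `(1, 0, 0)` and `(0, 1, 0)` already suffices. The
polar form of `N` plays no role, so characteristic 2 is no exception. -/
theorem exists_polar_ne_zero (hN : ∀ b, N b = 0 → b = 0) {x : K × K × B} (hx : x ≠ 0)
    (hq : hyperbolicForm N x = 0) : ∃ y, QuadraticMap.polar (hyperbolicForm N) x y ≠ 0 := by
  obtain ⟨s, t, b⟩ := x
  by_cases ht : t = 0
  · subst ht
    have hb : b = 0 := hN b (by simpa [hyperbolicForm_apply] using hq)
    subst hb
    refine ⟨(0, 1, 0), fun h => hx ?_⟩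
    have : s = 0 := by simpa [polar_hyperbolicForm] using h
    rw [this]; rfl
  · refine ⟨(1, 0, 0), fun h => ht ?_⟩
    simpa [polar_hyperbolicForm] using h

/-- This is Witt index 1: orthogonal singular vectors are proportional. When `t ≠ 0` the hypotheses
combine to `N (t' b - t b') = 0`, so anisotropy gives `t' b = t b'`, and the remaining coordinate
follows. -/
theorem exists_smul_of_polar_eq_zero (hN : ∀ b, N b = 0 → b = 0) {x z : K × K × B} (hx : x ≠ 0)
    (hqx : hyperbolicForm N x = 0) (hqz : hyperbolicForm N z = 0)
    (hxz : QuadraticMap.polar (hyperbolicForm N) x z = 0) : ∃ c : K, z = c • x := by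
  obtain ⟨s, t, b⟩ := x
  obtain ⟨s', t', b'⟩ := z
  rw [polar_hyperbolicForm] at hxz
  rw [hyperbolicForm_apply] at hqx hqz
  simp only at hxz hqx hqz
  by_cases ht : t = 0
  · subst ht
    have hb : b = 0 := hN b (by simpa using hqx)
    subst hb
    have hs : s ≠ 0 := by rintro rfl; exact hx rfl
    have ht' : t' = 0 := by simpa [hs] using hxz
    subst ht'
    have hb' : b' = 0 := hN b' (by simpa using hqz)
    subst hb'
    exact ⟨s' / s, by simp [hs]⟩
  · have hlin : t' • b + (-t) • b' = 0 := by
      apply hN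
      have hp : N (t' • b + (-t) • b') = N (t' • b) + N ((-t) • b') +
          QuadraticMap.polar N (t' • b) ((-t) • b') := by rw [QuadraticMap.polar]; ring
      rw [hp, QuadraticMap.map_smul, QuadraticMap.map_smul, QuadraticMap.polar_smul_left,
        QuadraticMap.polar_smul_right]
      simp only [smul_eq_mul]
      linear_combination (-t' * t') * hqx - t * t * hqz + t' * t * hxz
    have hb' : b' = (t' / t) • b := by
      rw [neg_smul, ← sub_eq_add_neg, sub_eq_zero] at hlin
      rw [div_eq_inv_mul, mul_smul, hlin, smul_smul, inv_mul_cancel₀ ht, one_smul]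
    refine ⟨t' / t, ?_⟩
    by_cases ht' : t' = 0
    · subst ht'
      rw [zero_div, zero_smul] at hb'
      subst hb'
      have hs' : s' = 0 := by simpa [ht] using hxz
      simp [hs']
    · have hs' : s' = t' / t * s := by
        apply mul_right_cancel₀ ht'
        rw [hb', QuadraticMap.map_smul, smul_eq_mul] at hqz
        rw [eq_comm, ← sub_eq_zero]
        have : s' * t' = t' / t * (t' / t) * (s * t) := by
          linear_combination hqz - t' / t * (t' / t) * hqx
        rw [this]; field_simp; ring
      rw [hb', hs']
      simp [ht]

theorem hyperbolicForm_add (x y : K × K × B) : hyperbolicForm N (x + y) =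
    hyperbolicForm N x + hyperbolicForm N y + QuadraticMap.polar (hyperbolicForm N) x y := by
  rw [QuadraticMap.polar]; ring

theorem hyperbolicForm_smul_add_smul (a b : K) (x y : K × K × B) :
    hyperbolicForm N (a • x + b • y) = a * a * hyperbolicForm N x + b * b * hyperbolicForm N y +
      a * b * QuadraticMap.polar (hyperbolicForm N) x y := by
  rw [hyperbolicForm_add, QuadraticMap.map_smul, QuadraticMap.map_smul,
    QuadraticMap.polar_smul_left, QuadraticMap.polar_smul_right]
  simp only [smul_eq_mul]; ring

theorem polar_hyperbolicForm_self {x : K × K × B} (hx : hyperbolicForm N x = 0) :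
    QuadraticMap.polar (hyperbolicForm N) x x = 0 := by
  rw [QuadraticMap.polar_self, hx, smul_zero]

/-- The vectors `(1, 0, 0)`, `(0, 1, 0)` and `(N b, 1, b)` are singular and span everything. -/
theorem mem_span_singular_of_le {W : Submodule K (K × K × B)}
    (h : ∀ m, hyperbolicForm N m = 0 → m ∈ W) (m : K × K × B) : m ∈ W := by
  obtain ⟨s, t, b⟩ := m
  have h1 : ((1, 0, 0) : K × K × B) ∈ W := h _ (by simp [hyperbolicForm_apply])
  have h2 : ((0, 1, 0) : K × K × B) ∈ W := h _ (by simp [hyperbolicForm_apply])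
  have h3 : ((N b, 1, b) : K × K × B) ∈ W := h _ (by simp [hyperbolicForm_apply])
  have : ((s, t, b) : K × K × B) = (s - N b) • (1, 0, 0) + (t - 1) • (0, 1, 0) + (N b, 1, b) := by
    simp
  rw [this]
  exact add_mem (add_mem (W.smul_mem _ h1) (W.smul_mem _ h2)) h3

variable {E : Type*} [AddCommGroup E] [Module K E]

/-- The image under `ψ` of the quadric `s t = N b`. -/
def quadricImage (N : QuadraticForm K B) (ψ : (K × K × B) →ₗ[K] E) : Set (ℙ K E) :=
  {P | ∃ m, m ≠ 0 ∧ hyperbolicForm N m = 0 ∧ P.submodule = Submodule.span K {ψ m}}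

theorem mk_mem_quadricImage {ψ : (K × K × B) →ₗ[K] E} (hψ : Function.Injective ψ) {m : K × K × B}
    (hm : ψ m ≠ 0) :
    Projectivization.mk K (ψ m) hm ∈ quadricImage N ψ ↔ hyperbolicForm N m = 0 := by
  constructor
  · rintro ⟨m', hm', hq, h⟩
    rw [Projectivization.submodule_mk, span_singleton_eq_iff_exists hm] at h
    obtain ⟨c, hc, h⟩ := h
    rw [← map_smul] at h
    rw [hψ h, QuadraticMap.map_smul, hq, smul_zero]
  · intro hq
    exact ⟨m, fun h => hm (by rw [h, map_zero]), hq, Projectivization.submodule_mk _ _⟩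

/-- The tangent hyperplane at `x` is the kernel of the polar form with `x`. A line through `x`
outside it meets the quadric again, because on such a line the equation is linear once the root `x`
is removed. -/
theorem isOvoid_quadricImage (hN : ∀ b, N b = 0 → b = 0) {ψ : (K × K × B) →ₗ[K] E}
    (hψ : Function.Injective ψ) : IsOvoid (LinearMap.range ψ) (quadricImage N ψ) := by
  have h0 : ∀ {m}, m ≠ 0 → ψ m ≠ 0 := fun hm h => hm (hψ (h.trans (map_zero ψ).symm))
  refine ⟨le_antisymm (pspan_le ?_) ?_, ?_⟩
  · rintro P ⟨m, hm, -, hP⟩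
    rw [eq_mk_of_submodule (h0 hm) hP, mk_mem_pts]
    exact ⟨m, rfl⟩
  · rintro _ ⟨m, rfl⟩
    refine mem_span_singular_of_le (N := N) (W := (pspan (quadricImage N ψ)).comap ψ) (fun m hm => ?_) m
    by_cases hm0 : m = 0
    · rw [hm0]; exact zero_mem _
    · exact mk_mem_pspan (h0 hm0) ((mk_mem_quadricImage hψ _).2 hm)
  rintro P ⟨x, hx, hqx, hP⟩
  obtain rfl := eq_mk_of_submodule (h0 hx) hP
  set pol := QuadraticMap.polar (hyperbolicForm N) with hpol
  let φ : (K × K × B) →ₗ[K] K := (hyperbolicForm N).polarBilin x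
  have hφ : ∀ y, φ y = pol x y := fun y => rfl
  obtain ⟨y₀, hy₀⟩ := exists_polar_ne_zero hN hx hqx
  have hmem : ∀ y, ψ y ∈ Submodule.map ψ (LinearMap.ker φ) ↔ pol x y = 0 := by
    intro y
    constructor
    · rintro ⟨y', hy', h⟩
      rw [← hψ h]; exact hy'
    · intro h; exact ⟨y, h, rfl⟩
  refine ⟨Submodule.map ψ (LinearMap.ker φ), ⟨?_, ?_⟩, ?_, ?_⟩
  · refine lt_of_le_of_ne (LinearMap.map_le_range) fun h => hy₀ ?_
    rw [← hpol, ← hmem, h]; exact ⟨_, rfl⟩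
  · intro U h1 h2
    obtain ⟨u, hu, hu'⟩ := SetLike.exists_of_lt h1
    obtain ⟨m, rfl⟩ := h2.le hu
    rw [hmem] at hu'
    refine h2.not_ge ?_
    rintro _ ⟨w, rfl⟩
    have : ψ (w - (pol x w / pol x m) • m) ∈ U := by
      apply h1.le
      rw [hmem, ← hφ, map_sub, map_smul, hφ, hφ, smul_eq_mul, div_mul_cancel₀ _ hu', sub_self]
    have := add_mem this (U.smul_mem (pol x w / pol x m) hu)
    rwa [← map_smul, ← map_add, sub_add_cancel] at this
  · intro y
    induction y using Projectivization.ind with | h y hy => ?_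
    rw [mk_mem_pts, mk_mem_pts]
    constructor
    · rintro ⟨m, hm, rfl⟩
      have hm0 : m ≠ 0 := by rintro rfl; exact hy (map_zero ψ)
      have hxm : pol x m = 0 := hm
      refine ⟨⟨m, rfl⟩, ?_⟩
      rintro z ⟨m', hm', hqm', hz⟩ hz'
      obtain rfl := eq_mk_of_submodule (h0 hm') hz
      rw [mk_mem_pts_sup_iff] at hz'
      obtain ⟨a, b, hab⟩ := hz'
      rw [← map_smul, ← map_smul, ← map_add] at hab
      have hab := hψ hab
      have hp : pol x m' = 0 := by
        rw [← hφ, hab, map_add, map_smul, map_smul, hφ, hφ, hxm, hpol,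
          polar_hyperbolicForm_self hqx]
        simp
      obtain ⟨c, rfl⟩ := exists_smul_of_polar_eq_zero hN hx hqx hqm' hp
      rw [mk_eq_mk_iff_exists]
      exact ⟨c, fun h => hm' (by rw [h, zero_smul]), map_smul _ _ _⟩
    · rintro ⟨⟨m, rfl⟩, h⟩
      rw [hmem]
      by_contra hne
      have hm0 : m ≠ 0 := by rintro rfl; exact hy (map_zero ψ)
      -- The second intersection of the line `x m` with the quadric: `q (α x + β m) = β (α pol x m +
      -- β q m)` vanishes for this choice of coefficients.
      set z := (-hyperbolicForm N m) • x + pol x m • m with hz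
      have hpz : pol x z = pol x m * pol x m := by
        rw [← hφ, hz, map_add, map_smul, map_smul, hφ, hφ, hpol, polar_hyperbolicForm_self hqx]
        simp
      have hqz : hyperbolicForm N z = 0 := by
        rw [hz, hyperbolicForm_smul_add_smul, hqx]; ring
      have hz0 : z ≠ 0 := by
        intro h'
        rw [h', ← hφ, map_zero] at hpz
        exact mul_ne_zero hne hne hpz.symm
      have := h (Projectivization.mk K (ψ z) (h0 hz0)) ((mk_mem_quadricImage hψ _).2 hqz)
        ((mk_mem_pts_sup_iff _ _ _).2 ⟨_, _, by rw [hz, map_add, map_smul, map_smul]⟩)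
      rw [mk_eq_mk_iff_exists] at this
      obtain ⟨c, -, hc⟩ := this
      rw [← map_smul] at hc
      rw [hψ hc, ← hφ, map_smul, hφ, hpol, polar_hyperbolicForm_self hqx, smul_zero] at hpz
      exact mul_ne_zero hne hne hpz.symm
  · intro y
    induction y using Projectivization.ind with | h y hy => ?_
    rw [mk_mem_pts, mk_mem_pts]
    rintro ⟨m, rfl⟩ hne
    rw [hmem] at hne
    have hm0 : m ≠ 0 := by rintro rfl; exact hy (map_zero ψ)
    set z := (-hyperbolicForm N m) • x + pol x m • m with hz
    have hpz : pol x z = pol x m * pol x m := by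
      rw [← hφ, hz, map_add, map_smul, map_smul, hφ, hφ, hpol, polar_hyperbolicForm_self hqx]
      simp
    have hqz : hyperbolicForm N z = 0 := by
      rw [hz, hyperbolicForm_smul_add_smul, hqx]; ring
    have hz0 : z ≠ 0 := by
      intro h'
      rw [h', ← hφ, map_zero] at hpz
      exact mul_ne_zero hne hne hpz.symm
    refine ⟨Projectivization.mk K (ψ z) (h0 hz0), ⟨(mk_mem_quadricImage hψ _).2 hqz, ?_,
      (mk_mem_pts_sup_iff _ _ _).2 ⟨_, _, by rw [hz, map_add, map_smul, map_smul]⟩⟩, ?_⟩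
    · rw [Ne, mk_eq_mk_iff_exists]
      rintro ⟨c, -, hc⟩
      rw [← map_smul] at hc
      rw [hψ hc, ← hφ, map_smul, hφ, hpol, polar_hyperbolicForm_self hqx, smul_zero] at hpz
      exact mul_ne_zero hne hne hpz.symm
    · rintro P ⟨⟨m', hm', hqm', hP'⟩, hPx, hPm⟩
      obtain rfl := eq_mk_of_submodule (h0 hm') hP'
      rw [mk_mem_pts_sup_iff] at hPm
      obtain ⟨a, b, hab⟩ := hPm
      rw [← map_smul, ← map_smul, ← map_add] at hab
      have hab := hψ hab
      have hb : b ≠ 0 := by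
        rintro rfl
        rw [zero_smul, add_zero] at hab
        apply hPx
        rw [mk_eq_mk_iff_exists]
        exact ⟨a, fun h => hm' (by rw [hab, h, zero_smul]), by rw [hab, map_smul]⟩
      rw [hab, hyperbolicForm_smul_add_smul, hqx, ← hpol] at hqm'
      have ha : a * pol x m = -(b * hyperbolicForm N m) := by
        apply mul_left_cancel₀ hb
        linear_combination hqm'
      rw [mk_eq_mk_iff_exists]
      refine ⟨b / pol x m, div_ne_zero hb hne, ?_⟩
      rw [← map_smul, hab, hz, smul_add, smul_smul, smul_smul, div_mul_cancel₀ _ hne]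
      congr 3
      field_simp
      linear_combination ha

theorem isWittIndexOneQuadric_quadricImage (hN : ∀ b, N b = 0 → b = 0)
    {ψ : (K × K × B) →ₗ[K] E} (hψ : Function.Injective ψ) :
    IsWittIndexOneQuadric (LinearMap.range ψ) (quadricImage N ψ) := by
  have h0 : ∀ {m}, m ≠ 0 → ψ m ≠ 0 := fun hm h => hm (hψ (h.trans (map_zero ψ).symm))
  let e := LinearEquiv.ofInjective ψ hψ
  have he : ∀ m, e.symm ⟨ψ m, m, rfl⟩ = m := fun m => by
    rw [LinearEquiv.symm_apply_eq]; rfl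
  refine ⟨(hyperbolicForm N).comp e.symm.toLinearMap, ?_, ?_, ?_, ?_⟩
  · ext P
    constructor
    · rintro ⟨m, hm, hq, hP⟩
      obtain rfl := eq_mk_of_submodule (h0 hm) hP
      refine ⟨(mk_mem_pts _).2 ⟨m, rfl⟩, ?_⟩
      rintro ⟨_, m', rfl⟩ hw
      rw [Projectivization.submodule_mk] at hw
      obtain ⟨c, hc⟩ := Submodule.mem_span_singleton.1 hw
      rw [← map_smul] at hc
      change hyperbolicForm N (e.symm _) = 0
      rw [he, ← hψ hc, QuadraticMap.map_smul, hq, smul_zero]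
    · rintro ⟨hP, h⟩
      induction P using Projectivization.ind with | h y hy => ?_
      obtain ⟨m, rfl⟩ := (mk_mem_pts hy).1 hP
      have := h ⟨ψ m, m, rfl⟩ (by
        rw [Projectivization.submodule_mk]; exact Submodule.mem_span_singleton_self _)
      change hyperbolicForm N (e.symm _) = 0 at this
      rw [he] at this
      exact (mk_mem_quadricImage hψ hy).2 this
  · have hne : ((1, 0, 0) : K × K × B) ≠ 0 := fun h => one_ne_zero (congrArg Prod.fst h)
    exact ⟨Projectivization.mk K (ψ (1, 0, 0)) (h0 hne),
      (mk_mem_quadricImage hψ _).2 (by simp [hyperbolicForm_apply])⟩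
  · intro U hU
    rw [rank_submodule_le_one_iff']
    by_cases hbot : U = ⊥
    · exact ⟨0, by simp [hbot]⟩
    obtain ⟨u, hu, hu0⟩ := U.ne_bot_iff.1 hbot
    refine ⟨u, fun w hw => ?_⟩
    -- On a totally singular subspace the polar form vanishes, so any two of its vectors are
    -- proportional.
    have hp : QuadraticMap.polar (hyperbolicForm N) (e.symm u) (e.symm w) = 0 := by
      rw [QuadraticMap.polar, ← map_add]
      have h1 := hU _ (add_mem hu hw)
      have h2 := hU _ hu
      have h3 := hU _ hw
      change hyperbolicForm N (e.symm _) = 0 at h1 h2 h3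
      rw [h1, h2, h3]; ring
    obtain ⟨c, hc⟩ := exists_smul_of_polar_eq_zero hN
      (by simpa using hu0) (hU u hu) (hU w hw) hp
    rw [← map_smul] at hc
    exact Submodule.mem_span_singleton.2 ⟨c, (e.symm.injective hc).symm⟩
  · intro r hr hpr
    by_contra hr0
    obtain ⟨y, hy⟩ := exists_polar_ne_zero hN (x := e.symm r) (by simpa using hr0) hr
    apply hy
    have := hpr (e y)
    change QuadraticMap.polar (fun w => hyperbolicForm N (e.symm w)) r (e y) = 0 at this
    simpa [QuadraticMap.polar] using this

/-! ### Tubes -/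

variable {D : Type*} [AddCommGroup D] [Module K D]

/-- The image under `Θ` of the cone with vertex `D` over the quadric `s t = N b`, without its
vertex. -/
def tubeSet (N : QuadraticForm K B) (Θ : ((K × K × B) × D) →ₗ[K] E) : Set (ℙ K E) :=
  {P | ∃ m n, m ≠ 0 ∧ hyperbolicForm N m = 0 ∧ P.submodule = Submodule.span K {Θ (m, n)}}

/-- The vertex of the tube `tubeSet N Θ`. -/
def tubeVertex (Θ : ((K × K × B) × D) →ₗ[K] E) : Submodule K E :=
  LinearMap.range (Θ.comp (LinearMap.inr K (K × K × B) D))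

theorem mem_tubeVertex {Θ : ((K × K × B) × D) →ₗ[K] E} (hΘ : Function.Injective Θ)
    {m : K × K × B} {n : D} : Θ (m, n) ∈ tubeVertex Θ ↔ m = 0 := by
  constructor
  · rintro ⟨n', hn'⟩
    exact (congrArg Prod.fst (hΘ hn')).symm
  · rintro rfl; exact ⟨n, rfl⟩

theorem mk_mem_tubeSet {Θ : ((K × K × B) × D) →ₗ[K] E} (hΘ : Function.Injective Θ)
    {m : K × K × B} {n : D} (h : Θ (m, n) ≠ 0) :
    Projectivization.mk K (Θ (m, n)) h ∈ tubeSet N Θ ↔ m ≠ 0 ∧ hyperbolicForm N m = 0 := by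
  constructor
  · rintro ⟨m', n', hm', hq, hs⟩
    rw [Projectivization.submodule_mk, span_singleton_eq_iff_exists h] at hs
    obtain ⟨c, hc, hs⟩ := hs
    rw [← map_smul] at hs
    have : m = c • m' := congrArg Prod.fst (hΘ hs)
    rw [this, QuadraticMap.map_smul, hq, smul_zero]
    exact ⟨smul_ne_zero hc hm', rfl⟩
  · rintro ⟨hm, hq⟩
    exact ⟨m, n, hm, hq, Projectivization.submodule_mk _ _⟩

/-- A complement of the vertex is the graph of a linear map into the vertex, so forgetting the
`D`-component identifies it with the space of the quadric. Every base is thus a copy of the same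
quadric. -/
theorem exists_param_of_complement {Θ : ((K × K × B) × D) →ₗ[K] E} (hΘ : Function.Injective Θ)
    {W : Submodule K E} (h1 : tubeVertex Θ ⊓ W = ⊥) (h2 : tubeVertex Θ ⊔ W = LinearMap.range Θ) :
    ∃ ψ : (K × K × B) →ₗ[K] E, Function.Injective ψ ∧ LinearMap.range ψ = W ∧
      ∀ m, ∃ n, ψ m = Θ (m, n) := by
  let π : W.comap Θ →ₗ[K] (K × K × B) :=
    (LinearMap.fst K (K × K × B) D).comp (W.comap Θ).subtype
  have hinj : Function.Injective π := by
    rw [← LinearMap.ker_eq_bot, LinearMap.ker_eq_bot']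
    rintro ⟨⟨m, n⟩, hmn⟩ h
    have hm : m = 0 := h
    subst hm
    have : Θ (0, n) ∈ tubeVertex Θ ⊓ W := ⟨⟨n, rfl⟩, hmn⟩
    rw [h1, Submodule.mem_bot] at this
    exact Subtype.ext (hΘ (this.trans (map_zero Θ).symm))
  have hsurj : Function.Surjective π := by
    intro m
    have : Θ (m, 0) ∈ tubeVertex Θ ⊔ W := by rw [h2]; exact ⟨_, rfl⟩
    obtain ⟨_, ⟨n, rfl⟩, w, hw, h⟩ := Submodule.mem_sup.1 this
    have hw' : w = Θ (m, -n) := by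
      rw [← sub_eq_iff_eq_add'.2 h.symm]
      change Θ _ - Θ (0, n) = _
      rw [← map_sub]; simp
    refine ⟨⟨(m, -n), ?_⟩, rfl⟩
    rw [Submodule.mem_comap, ← hw']; exact hw
  let e := LinearEquiv.ofBijective π ⟨hinj, hsurj⟩
  refine ⟨Θ.comp ((W.comap Θ).subtype.comp e.symm.toLinearMap), ?_, ?_, ?_⟩
  · exact hΘ.comp (Subtype.val_injective.comp e.symm.injective)
  · rw [LinearMap.range_comp, LinearMap.range_comp, LinearEquiv.range, Submodule.map_top,
      Submodule.range_subtype, Submodule.map_comap_eq, inf_eq_right, ← h2]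
    exact le_sup_right
  · intro m
    refine ⟨(e.symm m).1.2, ?_⟩
    have : (e.symm m).1.1 = m := e.apply_symm_apply m
    change Θ (e.symm m).1 = _
    congr 1
    exact Prod.ext this rfl

theorem tubeSet_inter_pts {Θ : ((K × K × B) × D) →ₗ[K] E} (hΘ : Function.Injective Θ)
    {ψ : (K × K × B) →ₗ[K] E}
    (h1 : tubeVertex Θ ⊓ LinearMap.range ψ = ⊥) (h : ∀ m, ∃ n, ψ m = Θ (m, n)) :
    tubeSet N Θ ∩ pts (LinearMap.range ψ) = quadricImage N ψ := by
  ext P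
  constructor
  · rintro ⟨⟨m, n, hm, hq, hP⟩, hW⟩
    refine ⟨m, hm, hq, ?_⟩
    rw [pts, Set.mem_ofPred_eq, hP, Submodule.span_singleton_le_iff_mem] at hW
    obtain ⟨n', hn'⟩ := h m
    have : Θ (0, n - n') ∈ tubeVertex Θ ⊓ LinearMap.range ψ := by
      refine ⟨⟨_, rfl⟩, ?_⟩
      have := sub_mem hW (LinearMap.mem_range_self ψ m)
      rwa [hn', ← map_sub, Prod.mk_sub_mk, sub_self] at this
    rw [h1, Submodule.mem_bot] at this
    have h0 : n - n' = 0 := congrArg Prod.snd (hΘ (this.trans (map_zero Θ).symm))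
    rw [hP, hn', sub_eq_zero.1 h0]
  · rintro ⟨m, hm, hq, hP⟩
    refine ⟨?_, ?_⟩
    · obtain ⟨n', hn'⟩ := h m
      exact ⟨m, n', hm, hq, by rw [hP, hn']⟩
    · rw [pts, Set.mem_ofPred_eq, hP, Submodule.span_singleton_le_iff_mem]
      exact ⟨m, rfl⟩

/-- The base is recovered from the cone: a vector of `W` of the form `v + c y` with `v` in `V` and
`y` in the base has `v` in `V ⊓ W = ⊥`. -/
theorem IsTube.base_eq {ξ V W : Submodule K E} {O C : Set (ℙ K E)} (h : IsTube ξ V W O C) :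
    O = C ∩ pts W := by
  obtain ⟨h1, h2, h3, rfl⟩ := h
  have hOW : O ⊆ pts W := by
    intro P hP
    rw [← h3.1]
    exact le_biSup (fun P : ℙ K E => P.submodule) hP
  ext P
  constructor
  · intro hP
    refine ⟨⟨fun hV => ?_, P, hP, ?_⟩, hOW hP⟩
    · have := le_inf (show P.submodule ≤ V from hV) (show P.submodule ≤ W from hOW hP)
      rw [h1, le_bot_iff, Projectivization.submodule_eq, Submodule.span_singleton_eq_bot] at this
      exact P.rep_nonzero this
    · exact le_sup_right (a := V) (b := P.submodule)
  · rintro ⟨⟨hV, q, hq, hPq⟩, hW⟩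
    induction P using Projectivization.ind with | h x hx => ?_
    have hqW := hOW hq
    induction q using Projectivization.ind with | h y hy => ?_
    rw [mk_mem_pts] at hPq hW hV
    rw [mk_mem_pts] at hqW
    rw [Projectivization.submodule_mk] at hPq
    obtain ⟨w, hw, y', hy', rfl⟩ := Submodule.mem_sup.1 hPq
    obtain ⟨c, rfl⟩ := Submodule.mem_span_singleton.1 hy'
    have hwW : w ∈ W := by
      have := sub_mem hW (W.smul_mem c hqW)
      rwa [add_sub_cancel_right] at this
    have hw0 : w ∈ V ⊓ W := ⟨hw, hwW⟩
    rw [h1, Submodule.mem_bot] at hw0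
    subst hw0
    convert hq using 1
    rw [mk_eq_mk_iff_exists]
    exact ⟨c, fun h => hV (by rw [h, zero_smul, add_zero]; exact zero_mem _), zero_add _⟩

theorem IsTube.not_mem {ξ V W : Submodule K E} {O C : Set (ℙ K E)} (h : IsTube ξ V W O C)
    {x : E} (hx : x ≠ 0) (hxC : Projectivization.mk K x hx ∈ C) : x ∉ V := by
  obtain ⟨h1, h2, h3, rfl⟩ := h
  exact fun hV => hxC.1 ((mk_mem_pts hx).2 hV)

/-- A tube is invariant under translation by its vertex. This is the only property of the vertex
needed to bound it from above. -/
theorem IsTube.add_mem {ξ V W : Submodule K E} {O C : Set (ℙ K E)} (h : IsTube ξ V W O C)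
    {x v : E} (hx : x ≠ 0) (hxC : Projectivization.mk K x hx ∈ C) (hv : v ∈ V) (hxv : x + v ≠ 0) :
    Projectivization.mk K (x + v) hxv ∈ C := by
  have hxV := h.not_mem hx hxC
  obtain ⟨h1, h2, h3, rfl⟩ := h
  obtain ⟨-, q, hq, hxq⟩ := hxC
  rw [mk_mem_pts] at hxq
  refine ⟨fun hV => hxV ?_, q, hq, ?_⟩
  · rw [mk_mem_pts] at hV
    have := sub_mem hV hv
    rwa [add_sub_cancel_right] at this
  · rw [mk_mem_pts]
    exact Submodule.add_mem _ hxq (Submodule.mem_sup_left hv)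

theorem isTube_tubeSet (hN : ∀ b, N b = 0 → b = 0) {Θ : ((K × K × B) × D) →ₗ[K] E}
    (hΘ : Function.Injective Θ) :
    IsTubeVertex (LinearMap.range Θ) (tubeSet N Θ) (tubeVertex Θ) := by
  set ψ := Θ.comp (LinearMap.inl K (K × K × B) D) with hψ
  have hψi : Function.Injective ψ := hΘ.comp LinearMap.inl_injective
  have h1 : tubeVertex Θ ⊓ LinearMap.range ψ = ⊥ := by
    rw [eq_bot_iff]
    rintro _ ⟨⟨n, rfl⟩, ⟨m, hm⟩⟩
    have : n = 0 := (congrArg Prod.snd (hΘ hm)).symm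
    subst this
    rw [map_zero]; exact zero_mem _
  have h2 : tubeVertex Θ ⊔ LinearMap.range ψ = LinearMap.range Θ := by
    apply le_antisymm
    · exact sup_le (LinearMap.range_comp_le_range _ _) (LinearMap.range_comp_le_range _ _)
    · rintro _ ⟨⟨m, n⟩, rfl⟩
      have : Θ (m, n) = Θ (0, n) + Θ (m, 0) := by rw [← map_add]; simp
      rw [this]
      exact Submodule.add_mem_sup ⟨n, rfl⟩ ⟨m, rfl⟩
  refine ⟨LinearMap.range ψ, quadricImage N ψ, h1, h2, isOvoid_quadricImage hN hψi, ?_⟩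
  ext P
  constructor
  · rintro ⟨m, n, hm, hq, hP⟩
    have h0 : Θ (m, n) ≠ 0 := ne_zero_of_submodule_eq hP
    have h0' : ψ m ≠ 0 := fun h => hm (hψi (h.trans (map_zero ψ).symm))
    obtain rfl := eq_mk_of_submodule h0 hP
    refine ⟨fun h => hm ?_, Projectivization.mk K (ψ m) h0', ⟨m, hm, hq, ?_⟩, ?_⟩
    · rw [mk_mem_pts, mem_tubeVertex hΘ] at h; exact h
    · rw [Projectivization.submodule_mk]
    · rw [mk_mem_pts, Projectivization.submodule_mk]
      have : Θ (m, n) = Θ (0, n) + Θ (m, 0) := by rw [← map_add]; simp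
      rw [this]
      exact Submodule.add_mem_sup ⟨n, rfl⟩ (Submodule.mem_span_singleton_self _)
  · rintro ⟨hV, q, ⟨m, hm, hqm, hq⟩, hPq⟩
    induction P using Projectivization.ind with | h x hx => ?_
    rw [mk_mem_pts] at hV hPq
    rw [hq] at hPq
    obtain ⟨_, ⟨n, rfl⟩, y, hy, rfl⟩ := Submodule.mem_sup.1 hPq
    obtain ⟨c, rfl⟩ := Submodule.mem_span_singleton.1 hy
    have hsum : Θ.comp (LinearMap.inr K (K × K × B) D) n + c • ψ m = Θ (c • m, n) := by
      change Θ (0, n) + c • Θ (m, 0) = _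
      rw [← map_smul, ← map_add]; simp
    have hc : c ≠ 0 := by
      rintro rfl
      exact hV (by rw [zero_smul, add_zero]; exact ⟨n, rfl⟩)
    refine ⟨c • m, n, smul_ne_zero hc hm, ?_, ?_⟩
    · rw [QuadraticMap.map_smul, hqm, smul_zero]
    · rw [Projectivization.submodule_mk, hsum]

/-- If `V` contained a vector with quadric component `m ≠ 0`, then `m` would be non-singular, and
translation invariance would force `polar w m = -q m` for every singular `w ≠ 0`. Testing rescaled
hyperbolic vectors excludes every field but the one with two elements; there the singular vector
`(1, 1, o)` gives the contradiction. -/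
theorem IsTube.vertex_le (hN : ∀ b, N b = 0 → b = 0) {o : B} (ho : N o = 1)
    {Θ : ((K × K × B) × D) →ₗ[K] E} (hΘ : Function.Injective Θ) {V W : Submodule K E}
    {O : Set (ℙ K E)} (h : IsTube (LinearMap.range Θ) V W O (tubeSet N Θ)) :
    V ≤ tubeVertex Θ := by
  intro v hv
  have hvξ : v ∈ LinearMap.range Θ := by rw [← h.2.1]; exact Submodule.mem_sup_left hv
  obtain ⟨⟨m, n⟩, rfl⟩ := hvξ
  rw [mem_tubeVertex hΘ]
  by_contra hm
  have hv0 : Θ (m, n) ≠ 0 := fun h0 => hm (congrArg Prod.fst (hΘ (h0.trans (map_zero Θ).symm)))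
  have hqm : hyperbolicForm N m ≠ 0 := fun hq =>
    h.not_mem hv0 ((mk_mem_tubeSet hΘ hv0).2 ⟨hm, hq⟩) hv
  have key : ∀ w : K × K × B, w ≠ 0 → hyperbolicForm N w = 0 →
      QuadraticMap.polar (hyperbolicForm N) w m = -hyperbolicForm N m := by
    intro w hw hqw
    have hw0 : Θ (w, 0) ≠ 0 := fun h0 => hw (congrArg Prod.fst (hΘ (h0.trans (map_zero Θ).symm)))
    have hwC := (mk_mem_tubeSet (N := N) hΘ hw0).2 ⟨hw, hqw⟩
    have hsum : Θ (w, 0) + Θ (m, n) = Θ (w + m, n) := by rw [← map_add]; simp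
    have hne : Θ (w, 0) + Θ (m, n) ≠ 0 := fun h0 => h.not_mem hw0 hwC (by
      rw [eq_neg_of_add_eq_zero_left h0]; exact neg_mem hv)
    have := h.add_mem hw0 hwC hv hne
    simp only [hsum] at this
    have h3 := ((mk_mem_tubeSet hΘ _).1 this).2
    rw [hyperbolicForm_add, hqw, zero_add] at h3
    exact eq_neg_of_add_eq_zero_right h3
  obtain ⟨s, t, b⟩ := m
  have hs : ∀ c : K, c ≠ 0 → c * t = -hyperbolicForm N (s, t, b) := by
    intro c hc
    have := key (c, 0, 0) (fun h => hc (congrArg Prod.fst h)) (by simp [hyperbolicForm_apply])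
    simpa [polar_hyperbolicForm] using this
  have ht : ∀ c : K, c ≠ 0 → c * s = -hyperbolicForm N (s, t, b) := by
    intro c hc
    have := key (0, c, 0) (fun h => hc (congrArg (fun x => x.2.1) h))
      (by simp [hyperbolicForm_apply])
    simpa [polar_hyperbolicForm] using this
  have hb := key (1, 1, o) (fun h => one_ne_zero (congrArg Prod.fst h))
    (by simp [hyperbolicForm_apply, ho])
  rw [polar_hyperbolicForm] at hb
  have t1 := hs 1 one_ne_zero
  have s1 := ht 1 one_ne_zero
  -- `c t = t` for all `c ≠ 0`, and `t = -q m` is non-zero, so `K` has two elements.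
  have hall : ∀ c : K, c ≠ 0 → c = 1 := fun c hc => by
    have := (hs c hc).trans t1.symm
    exact mul_right_cancel₀ (fun h0 => hqm (neg_eq_zero.1 (t1.symm.trans (by rw [h0, mul_zero])))) this
  rw [one_mul] at t1 s1
  have hk := hall (-hyperbolicForm N (s, t, b)) (neg_ne_zero.2 hqm)
  have h11 : (-1 : K) = 1 := hall _ (neg_ne_zero.2 one_ne_zero)
  rw [hk] at t1 s1 hb
  subst t1 s1
  -- Now `s = t = 1`. For `b = 0` the test vector `(1, 1, o)` would give `1 + 1 = 1`; for `b ≠ 0`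
  -- the value `N b = 1` makes `m` singular.
  have hb0 : b ≠ 0 := by
    rintro rfl
    simp at hb
  have hNb := hall (N b) (fun h0 => hb0 (hN b h0))
  exact hqm (by rw [hyperbolicForm_apply, hNb]; ring)

/-- A smaller vertex would leave a point `y` of the true vertex in the base space `W`. The ovoid
axiom for `W` fails: since `y` is outside the tangent hyperplane at a base point `x`, a second point
`z`, independent of `x` modulo the vertex, can be moved along `y` into that hyperplane while staying
in the base. -/
theorem IsTube.vertex_eq (hN : ∀ b, N b = 0 → b = 0) {o : B} (ho : N o = 1)
    {Θ : ((K × K × B) × D) →ₗ[K] E} (hΘ : Function.Injective Θ) {V W : Submodule K E}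
    {O : Set (ℙ K E)} (h : IsTube (LinearMap.range Θ) V W O (tubeSet N Θ)) :
    V = tubeVertex Θ := by
  have hle := h.vertex_le hN ho hΘ
  refine le_antisymm hle fun y₀ hy₀ => ?_
  have hO := h.base_eq
  obtain ⟨h1, h2, h3, h4⟩ := h
  -- Because `V` lies in the true vertex, splitting a vector along `V ⊔ W` alters only its
  -- `D`-component.
  have lift : ∀ m n, ∃ n', Θ (m, n') ∈ W ∧ Θ (m, n) - Θ (m, n') ∈ V := by
    intro m n
    have : Θ (m, n) ∈ V ⊔ W := by rw [h2]; exact ⟨_, rfl⟩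
    obtain ⟨w, hw, x, hx, hxw⟩ := Submodule.mem_sup.1 this
    obtain ⟨n₁, rfl⟩ := hle hw
    have hx' : x = Θ (m, n - n₁) := by
      rw [← sub_eq_iff_eq_add'.2 hxw.symm]
      change Θ _ - Θ (0, n₁) = _
      rw [← map_sub]; simp
    refine ⟨n - n₁, hx' ▸ hx, ?_⟩
    rw [← hx', ← hxw, add_sub_cancel_right]; exact hw
  obtain ⟨n₀, rfl⟩ := hy₀
  obtain ⟨ny, hyW, hyV⟩ := lift 0 n₀
  by_cases hny : ny = 0
  · subst hny
    rw [show ((0 : K × K × B), (0 : D)) = 0 from rfl, map_zero, sub_zero] at hyV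
    exact hyV
  exfalso
  have hy0 : Θ (0, ny) ≠ 0 := fun h0 =>
    hny (congrArg Prod.snd (hΘ (h0.trans (map_zero Θ).symm)))
  obtain ⟨nx, hxW, -⟩ := lift (1, 0, 0) 0
  obtain ⟨nz, hzW, -⟩ := lift (0, 1, 0) 0
  have he : ((1, 0, 0) : K × K × B) ≠ 0 := fun h => one_ne_zero (congrArg Prod.fst h)
  have hf : ((0, 1, 0) : K × K × B) ≠ 0 := fun h => one_ne_zero (congrArg (fun x => x.2.1) h)
  have h0 : ∀ {m n}, m ≠ 0 → Θ (m, n) ≠ 0 := fun hm h =>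
    hm (congrArg Prod.fst (hΘ (h.trans (map_zero Θ).symm)))
  have memO : ∀ {m n} (hm : m ≠ 0), hyperbolicForm N m = 0 → Θ (m, n) ∈ W →
      Projectivization.mk K (Θ (m, n)) (h0 hm) ∈ O := by
    intro m n hm hq hW
    rw [hO]
    exact ⟨(mk_mem_tubeSet hΘ _).2 ⟨hm, hq⟩, (mk_mem_pts _).2 hW⟩
  have hxO := memO he (by simp [hyperbolicForm_apply]) hxW
  obtain ⟨H, hHW, hH, -⟩ := h3.2 _ hxO
  -- The line `x y` carries the further base point `x + y`, so it is not tangent at `x`.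
  have hyH : Θ (0, ny) ∉ H := by
    intro hyH
    have hxy : Θ ((1, 0, 0), nx + ny) = Θ ((1, 0, 0), nx) + Θ (0, ny) := by
      rw [← map_add]; simp
    have := ((hH (Projectivization.mk K _ hy0)).1 ((mk_mem_pts hy0).2 hyH)).2 _
      (memO he (n := nx + ny) (by simp [hyperbolicForm_apply]) (hxy ▸ W.add_mem hxW hyW))
      ((mk_mem_pts_sup_iff _ _ _).2 ⟨1, 1, by rw [one_smul, one_smul, hxy]⟩)
    rw [mk_eq_mk_iff_exists] at this
    obtain ⟨c, -, hc⟩ := this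
    rw [← map_smul] at hc
    have hc := hΘ hc
    have hc1 : c = 1 := by
      have h5 := congrArg (fun x => x.1.1) hc
      have h6 : (1 : K) = c * 1 := h5
      rw [h6, mul_one]
    have h5 : nx + ny = c • nx := congrArg Prod.snd hc
    rw [hc1, one_smul, add_eq_left] at h5
    exact hny h5
  have hsup : H ⊔ Submodule.span K {Θ (0, ny)} = W := by
    rcases hHW.eq_or_eq (c := H ⊔ Submodule.span K {Θ (0, ny)}) le_sup_left
      (sup_le hHW.le ((Submodule.span_singleton_le_iff_mem _ _).2 hyW)) with h5 | h5
    · exact absurd ((h5 ▸ Submodule.mem_sup_right (Submodule.mem_span_singleton_self _))) hyH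
    · exact h5
  rw [← hsup] at hzW
  -- The translate `w` of `z` lies in the tangent hyperplane and still in the base, so it would have
  -- to be the point `x`.
  obtain ⟨w, hw, y', hy', hwy⟩ := Submodule.mem_sup.1 hzW
  obtain ⟨c, rfl⟩ := Submodule.mem_span_singleton.1 hy'
  have hw' : w = Θ ((0, 1, 0), nz - c • ny) := by
    rw [← sub_eq_iff_eq_add.2 hwy.symm, ← map_smul, ← map_sub]; simp
  subst hw'
  have := ((hH (Projectivization.mk K _ (h0 hf))).1 ((mk_mem_pts _).2 hw)).2 _
    (memO hf (by simp [hyperbolicForm_apply]) (hHW.le hw))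
    ((mk_mem_pts_sup_iff _ _ _).2 ⟨0, 1, by rw [zero_smul, one_smul, zero_add]⟩)
  rw [mk_eq_mk_iff_exists] at this
  obtain ⟨c, -, hc⟩ := this
  rw [← map_smul] at hc
  have h5 : (1 : K) = c * 0 := congrArg (fun x => x.1.2.1) (hΘ hc)
  rw [mul_zero] at h5
  exact one_ne_zero h5

theorem IsTube.base_param (hN : ∀ b, N b = 0 → b = 0) {o : B} (ho : N o = 1)
    {Θ : ((K × K × B) × D) →ₗ[K] E} (hΘ : Function.Injective Θ) {V W : Submodule K E}
    {O : Set (ℙ K E)} (h : IsTube (LinearMap.range Θ) V W O (tubeSet N Θ)) :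
    Nonempty ((K × K × B) ≃ₗ[K] W) ∧ IsWittIndexOneQuadric W O := by
  have hO := h.base_eq
  have hV := h.vertex_eq hN ho hΘ
  obtain ⟨h1, h2, h3, h4⟩ := h
  subst hV
  obtain ⟨ψ, hψ, rfl, hn⟩ := exists_param_of_complement hΘ h1 h2
  refine ⟨⟨LinearEquiv.ofInjective ψ hψ⟩, ?_⟩
  rw [hO, tubeSet_inter_pts hΘ h1 hn]
  exact isWittIndexOneQuadric_quadricImage hN hψ

end Hyperbolic

/-! ### The standard regulus of `B × B`. -/

section Regulus

variable {K B E : Type*} [Field K] [DivisionRing B] [Algebra K B] [AddCommGroup E] [Module K E]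

theorem exists_smul_of_det_eq_zero {w u : Fin 2 → K} (hw : w ≠ 0) (h : w 0 * u 1 = w 1 * u 0) :
    ∃ k : K, u = k • w := by
  by_cases h0 : w 0 = 0
  · have h1 : w 1 ≠ 0 := fun h1 => hw (by ext i; fin_cases i <;> assumption)
    refine ⟨u 1 / w 1, ?_⟩
    rw [h0, zero_mul, eq_comm, mul_eq_zero, or_iff_right h1] at h
    ext i
    fin_cases i <;> simp [h0, h, h1]
  · refine ⟨u 0 / w 0, ?_⟩
    ext i
    fin_cases i
    · simp [h0]
    · simp only [Fin.mk_one, Pi.smul_apply, smul_eq_mul]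
      field_simp
      linear_combination h

/-- The map `w ↦ (w₁ b, -w₀ b)`, with `B × B` embedded by `j`; its image is a transversal of
the standard regulus. -/
def transversalMap (j : (B × B) →ₗ[K] E) (b : B) : (Fin 2 → K) →ₗ[K] E where
  toFun w := j (w 1 • b, -(w 0 • b))
  map_add' w w' := by
    rw [← map_add]; simp [add_smul, add_comm]
  map_smul' k w := by
    rw [← map_smul]; simp [smul_smul]

/-- The member with parameter `w` of the standard regulus of `B × B`, embedded by `j`. -/
def regulusMember (j : (B × B) →ₗ[K] E) (w : Fin 2 → K) : Submodule K E where
  carrier := {y | ∃ b, y = transversalMap j b w}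
  add_mem' := by
    rintro _ _ ⟨b, rfl⟩ ⟨b', rfl⟩
    refine ⟨b + b', ?_⟩
    simp only [transversalMap, LinearMap.coe_mk, AddHom.coe_mk]
    rw [← map_add]; simp [smul_add, add_comm]
  zero_mem' := ⟨0, by simp [transversalMap, Prod.mk_zero_zero]⟩
  smul_mem' := by
    rintro k _ ⟨b, rfl⟩
    refine ⟨k • b, ?_⟩
    simp only [transversalMap, LinearMap.coe_mk, AddHom.coe_mk]
    rw [← map_smul]; simp [smul_comm k]

variable {j : (B × B) →ₗ[K] E}

theorem mem_regulusMember {w : Fin 2 → K} {y : E} :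
    y ∈ regulusMember j w ↔ ∃ b, y = transversalMap j b w := Iff.rfl

theorem transversalMap_apply (b : B) (w : Fin 2 → K) :
    transversalMap j b w = j (w 1 • b, -(w 0 • b)) := rfl

theorem transversalMap_smul (k : K) (b : B) (w : Fin 2 → K) :
    transversalMap j (k • b) w = transversalMap j b (k • w) := by
  simp only [transversalMap_apply, Pi.smul_apply, smul_smul, smul_eq_mul, mul_comm]

theorem transversalMap_zero (w : Fin 2 → K) : transversalMap j (0 : B) w = 0 := by
  simp [transversalMap_apply, Prod.mk_zero_zero]

theorem transversalMap_injective (hj : Function.Injective j) {b : B} (hb : b ≠ 0) :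
    Function.Injective (transversalMap j b) := by
  rw [← LinearMap.ker_eq_bot, LinearMap.ker_eq_bot']
  intro w hw
  have := hj (hw.trans (map_zero j).symm)
  have h1 : w 1 • b = 0 := congrArg Prod.fst this
  have h2 : -(w 0 • b) = 0 := congrArg Prod.snd this
  rw [neg_eq_zero] at h2
  ext i
  fin_cases i
  · exact (smul_eq_zero.1 h2).resolve_right hb
  · exact (smul_eq_zero.1 h1).resolve_right hb

theorem exists_smul_of_transversalMap_eq (hj : Function.Injective j) {b c : B} (hc : c ≠ 0)
    {w u : Fin 2 → K} (hw : w ≠ 0) (h : transversalMap j b w = transversalMap j c u) :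
    ∃ k : K, u = k • w := by
  have := hj h
  have h1 : w 1 • b = u 1 • c := congrArg Prod.fst this
  have h2 : w 0 • b = u 0 • c := neg_injective (congrArg Prod.snd this)
  apply exists_smul_of_det_eq_zero hw
  apply smul_left_injective K hc
  change (w 0 * u 1) • c = (w 1 * u 0) • c
  rw [mul_smul, mul_smul, ← h1, ← h2, smul_comm]

theorem range_transversalMap_inf (hj : Function.Injective j) {b : B} (hb : b ≠ 0)
    {w : Fin 2 → K} (hw : w ≠ 0) :
    LinearMap.range (transversalMap j b) ⊓ regulusMember j w =
      Submodule.span K {transversalMap j b w} := by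
  apply le_antisymm
  · rintro _ ⟨⟨u, rfl⟩, ⟨c, hc⟩⟩
    obtain ⟨k, rfl⟩ := exists_smul_of_transversalMap_eq hj hb hw hc.symm
    exact Submodule.mem_span_singleton.2 ⟨k, (map_smul _ _ _).symm⟩
  · rw [Submodule.span_singleton_le_iff_mem]
    exact ⟨⟨w, rfl⟩, b, rfl⟩

theorem isTransversal_range (hj : Function.Injective j) {b : B} (hb : b ≠ 0) :
    IsTransversal (regulusMember j ![1, 0]) (regulusMember j ![0, 1]) (regulusMember j ![1, 1])
      (LinearMap.range (transversalMap j b)) := by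
  have hi := transversalMap_injective hj hb
  have h : ∀ w : Fin 2 → K, w ≠ 0 →
      LinearMap.range (transversalMap j b) ⊓ regulusMember j w ≠ ⊥ := by
    intro w hw
    rw [range_transversalMap_inf hj hb hw, Ne, Submodule.span_singleton_eq_bot]
    exact fun h => hw (hi (h.trans (map_zero _).symm))
  refine ⟨?_, h _ (by simp), h _ (by simp), h _ (by simp)⟩
  rw [LinearMap.finrank_range_of_inj hi, Module.finrank_pi, Fintype.card_fin]

/-- A transversal is spanned by its points `(0, -b₁)` and `(b₂, 0)` on the first two members. A
point `(b, -b)` of the third then makes `b₁` and `b₂` both `K`-multiples of `b`. -/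
theorem isTransversal_iff (hj : Function.Injective j) {T : Submodule K E} :
    IsTransversal (regulusMember j ![1, 0]) (regulusMember j ![0, 1]) (regulusMember j ![1, 1]) T ↔
      ∃ b : B, b ≠ 0 ∧ T = LinearMap.range (transversalMap j b) := by
  constructor
  · rintro ⟨hT, h1, h2, h3⟩
    have : FiniteDimensional K T := FiniteDimensional.of_finrank_pos (by omega)
    obtain ⟨_, ⟨hT1, b₁, rfl⟩, hy1⟩ := Submodule.ne_bot_iff _ |>.1 h1
    obtain ⟨_, ⟨hT2, b₂, rfl⟩, hy2⟩ := Submodule.ne_bot_iff _ |>.1 h2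
    obtain ⟨_, ⟨hT3, b, rfl⟩, hy3⟩ := Submodule.ne_bot_iff _ |>.1 h3
    simp only [transversalMap_apply, cons_val_zero, cons_val_one, zero_smul, one_smul,
      neg_zero] at hT1 hT2 hT3 hy1 hy2 hy3
    have hb1 : b₁ ≠ 0 := by rintro rfl; simp [Prod.mk_zero_zero] at hy1
    have hb2 : b₂ ≠ 0 := by rintro rfl; simp [Prod.mk_zero_zero] at hy2
    have hb : b ≠ 0 := by rintro rfl; simp [Prod.mk_zero_zero] at hy3
    have hli : LinearIndependent K ![j (0, -b₁), j (b₂, 0)] := by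
      rw [LinearIndependent.pair_iff]
      intro s t hst
      rw [← map_smul, ← map_smul, ← map_add] at hst
      have := hj (hst.trans (map_zero j).symm)
      simpa [hb1, hb2, and_comm] using this
    have hspan : Submodule.span K (Set.range ![j (0, -b₁), j (b₂, 0)]) = T := by
      apply Submodule.eq_of_le_of_finrank_eq
      · rw [Submodule.span_le]
        rintro _ ⟨i, rfl⟩
        fin_cases i
        · exact hT1
        · exact hT2
      · rw [finrank_span_eq_card hli, hT, Fintype.card_fin]
    have hmem := hT3
    rw [← hspan, range_cons, range_cons, range_empty, Set.union_empty, Set.singleton_union,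
      SetLike.mem_coe, Submodule.mem_span_pair] at hmem
    obtain ⟨s, t, hst⟩ := hmem
    rw [← map_smul, ← map_smul, ← map_add] at hst
    have hst := hj hst
    have e1 : t • b₂ = b := by simpa using congrArg Prod.fst hst
    have e2 : s • b₁ = b := by simpa using congrArg Prod.snd hst
    refine ⟨b, hb, (Submodule.eq_of_le_of_finrank_eq ?_ ?_).symm⟩
    · rintro _ ⟨w, rfl⟩
      have : transversalMap j b w = (w 0 * s) • j (0, -b₁) + (w 1 * t) • j (b₂, 0) := by
        rw [transversalMap_apply, ← map_smul, ← map_smul, ← map_add]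
        simp [mul_smul, e1, e2]
      rw [this]
      exact add_mem (T.smul_mem _ hT1) (T.smul_mem _ hT2)
    · rw [hT, LinearMap.finrank_range_of_inj (transversalMap_injective hj hb), Module.finrank_pi,
        Fintype.card_fin]
  · rintro ⟨b, hb, rfl⟩
    exact isTransversal_range hj hb

/-- A member `R` meets the transversal of each `b ≠ 0` in one point, with some parameter in `K²`.
The content is that this parameter does not depend on `b`; then `R` is the standard member with it.
-/
theorem regulus_eq (hj : Function.Injective j) :
    regulus (regulusMember j ![1, 0]) (regulusMember j ![0, 1]) (regulusMember j ![1, 1]) =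
      {R | ∃ w : Fin 2 → K, w ≠ 0 ∧ R = regulusMember j w} := by
  ext R
  constructor
  · rintro ⟨hR1, hR2⟩
    have h1 : ∀ b : B, b ≠ 0 →
        Module.finrank K ↥(LinearMap.range (transversalMap j b) ⊓ R) = 1 := fun b hb =>
      hR1 _ (isTransversal_range hj hb)
    have hex : ∀ b : B, b ≠ 0 → ∃ u : Fin 2 → K, u ≠ 0 ∧ transversalMap j b u ∈ R := by
      intro b hb
      obtain ⟨⟨_, ⟨u, rfl⟩, hu⟩, hu0, -⟩ := finrank_eq_one_iff'.1 (h1 b hb)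
      refine ⟨u, ?_, hu⟩
      rintro rfl
      exact hu0 (Subtype.ext (map_zero _))
    obtain ⟨w, hw, hwR⟩ := hex 1 one_ne_zero
    -- Comparison with the transversal of `1`. For scalar `c` the two transversals coincide;
    -- otherwise `1` and `c` are independent over `K` and the sum of the two points is used.
    have hind : ∀ c : B, c ≠ 0 → ∀ u : Fin 2 → K, transversalMap j c u ∈ R →
        ∃ k : K, u = k • w := by
      intro c hc u hu
      by_cases hcK : ∃ k : K, c = k • (1 : B)
      · obtain ⟨k, rfl⟩ := hcK
        have hk : k ≠ 0 := by rintro rfl; simp at hc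
        rw [transversalMap_smul] at hu
        have hw0 : (⟨transversalMap j 1 w, ⟨w, rfl⟩, hwR⟩ :
            ↥(LinearMap.range (transversalMap j (1 : B)) ⊓ R)) ≠ 0 := by
          intro h
          exact hw (transversalMap_injective hj one_ne_zero
            ((congrArg Subtype.val h).trans (map_zero _).symm))
        obtain ⟨a, ha⟩ := (finrank_eq_one_iff_of_nonzero' _ hw0).1 (h1 1 one_ne_zero)
          ⟨transversalMap j 1 (k • u), ⟨_, rfl⟩, hu⟩
        have ha : a • transversalMap j (1 : B) w = transversalMap j 1 (k • u) :=
          congrArg Subtype.val ha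
        rw [← map_smul] at ha
        have ha := transversalMap_injective hj one_ne_zero ha
        refine ⟨k⁻¹ * a, ?_⟩
        rw [mul_smul, ha, smul_smul, inv_mul_cancel₀ hk, one_smul]
      · have hindep : ∀ a b : K, a • (1 : B) + b • c = 0 → a = 0 ∧ b = 0 := by
          intro a b hab
          by_cases hb : b = 0
          · rw [hb, zero_smul, add_zero] at hab
            exact ⟨(smul_eq_zero.1 hab).resolve_right one_ne_zero, hb⟩
          · refine absurd ⟨-(b⁻¹ * a), ?_⟩ hcK
            rw [neg_smul, mul_smul, eq_neg_of_add_eq_zero_left hab, smul_neg, neg_neg, smul_smul,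
              inv_mul_cancel₀ hb, one_smul]
        -- The sum lies in `R`, hence on a transversal, so the tensor `w ⊗ 1 + u ⊗ c` equals a pure
        -- tensor `t ⊗ e`. As `1` and `c` are independent, `w` and `u` are both multiples of `t`.
        obtain ⟨e, t, ht⟩ : ∃ (e : B) (t : Fin 2 → K),
            transversalMap j 1 w + transversalMap j c u = transversalMap j e t := by
          by_cases h0 : transversalMap j 1 w + transversalMap j c u = 0
          · exact ⟨0, 0, by rw [h0, map_zero]⟩
          · obtain ⟨T, hT, hPT⟩ := hR2 (Projectivization.mk K _ h0)
              ((mk_mem_pts h0).2 (R.add_mem hwR hu))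
            obtain ⟨e, -, rfl⟩ := (isTransversal_iff hj).1 hT
            obtain ⟨t, ht⟩ := (mk_mem_pts h0).1 hPT
            exact ⟨e, t, ht.symm⟩
        simp only [transversalMap_apply] at ht
        rw [← map_add] at ht
        have ht := hj ht
        have t1 : w 1 • (1 : B) + u 1 • c = t 1 • e := congrArg Prod.fst ht
        have t0 : w 0 • (1 : B) + u 0 • c = t 0 • e := by
          apply neg_injective
          rw [neg_add]
          exact congrArg Prod.snd ht
        have ht0 : t ≠ 0 := by
          rintro rfl
          rw [Pi.zero_apply, zero_smul] at t0 t1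
          exact hw (by ext i; fin_cases i; exacts [(hindep _ _ t0).1, (hindep _ _ t1).1])
        have hcomb : (t 0 * w 1 - t 1 * w 0) • (1 : B) + (t 0 * u 1 - t 1 * u 0) • c = 0 := by
          have : t 0 • (w 1 • (1 : B) + u 1 • c) - t 1 • (w 0 • (1 : B) + u 0 • c) = 0 := by
            rw [t0, t1, smul_comm, sub_self]
          rw [← this]
          module
        obtain ⟨d1, d2⟩ := hindep _ _ hcomb
        obtain ⟨k, hk⟩ := exists_smul_of_det_eq_zero ht0 (u := w) (by linear_combination d1)
        obtain ⟨k', hk'⟩ := exists_smul_of_det_eq_zero ht0 (u := u) (by linear_combination d2)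
        have hk0 : k ≠ 0 := by rintro rfl; exact hw (by rw [hk, zero_smul])
        refine ⟨k' * k⁻¹, ?_⟩
        rw [hk', hk, smul_smul, mul_assoc, inv_mul_cancel₀ hk0, mul_one]
    refine ⟨w, hw, le_antisymm ?_ ?_⟩
    · intro y hy
      by_cases hy0 : y = 0
      · rw [hy0]; exact zero_mem _
      obtain ⟨T, hT, hPT⟩ := hR2 (Projectivization.mk K _ hy0) ((mk_mem_pts hy0).2 hy)
      obtain ⟨b, hb, rfl⟩ := (isTransversal_iff hj).1 hT
      obtain ⟨u, rfl⟩ := (mk_mem_pts hy0).1 hPT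
      obtain ⟨k, rfl⟩ := hind b hb u hy
      exact ⟨k • b, (transversalMap_smul _ _ _).symm⟩
    · rintro _ ⟨b, rfl⟩
      by_cases hb : b = 0
      · rw [hb, transversalMap_zero]; exact zero_mem _
      obtain ⟨u, hu0, hu⟩ := hex b hb
      obtain ⟨k, rfl⟩ := hind b hb u hu
      have hk : k ≠ 0 := by rintro rfl; simp at hu0
      have := R.smul_mem k⁻¹ hu
      rwa [← map_smul, smul_smul, inv_mul_cancel₀ hk, one_smul] at this
  · rintro ⟨w, hw, rfl⟩
    refine ⟨fun T hT => ?_, fun P hP => ?_⟩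
    · obtain ⟨b, hb, rfl⟩ := (isTransversal_iff hj).1 hT
      rw [range_transversalMap_inf hj hb hw]
      exact finrank_span_singleton fun h =>
        hw (transversalMap_injective hj hb (h.trans (map_zero _).symm))
    · induction P using Projectivization.ind with | h y hy => ?_
      obtain ⟨b, rfl⟩ := (mk_mem_pts hy).1 hP
      have hb : b ≠ 0 := by rintro rfl; exact hy (transversalMap_zero w)
      exact ⟨_, isTransversal_range hj hb, (mk_mem_pts hy).2 ⟨w, rfl⟩⟩

/-- On the transversal of `b` the member with parameter `w` is cut out at `transversalMap j b w`,
which is linear in `w`. Hence the cross-ratio is preserved. -/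
theorem isRegulusParam_of_regulusMember (hj : Function.Injective j)
    {ρ : ℙ K (Fin 2 → K) → Submodule K E}
    (hρ : ∀ w (hw : w ≠ 0), ρ (Projectivization.mk K w hw) = regulusMember j w) :
    IsRegulusParam ρ := by
  have hinj : Function.Injective ρ := by
    intro p p' h
    induction p using Projectivization.ind with | h w hw => ?_
    induction p' using Projectivization.ind with | h w' hw' => ?_
    rw [hρ, hρ] at h
    have : transversalMap j 1 w ∈ regulusMember j w' := by rw [← h]; exact ⟨1, rfl⟩
    obtain ⟨b, hb⟩ := this
    obtain ⟨k, rfl⟩ := exists_smul_of_transversalMap_eq hj one_ne_zero hw' hb.symm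
    rw [mk_eq_mk_iff_exists]
    exact ⟨k, fun h => hw (by rw [h, zero_smul]), rfl⟩
  have h10 : (![1, 0] : Fin 2 → K) ≠ 0 := by simp
  have h01 : (![0, 1] : Fin 2 → K) ≠ 0 := by simp
  have h11 : (![1, 1] : Fin 2 → K) ≠ 0 := by simp
  refine ⟨hinj, Projectivization.mk K _ h10, Projectivization.mk K _ h01,
    Projectivization.mk K _ h11, ?_, ?_, ?_, ?_, ?_⟩
  · rw [Ne, mk_eq_mk_iff_exists]
    rintro ⟨c, -, hc⟩
    simpa using congrFun hc 0
  · rw [Ne, mk_eq_mk_iff_exists]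
    rintro ⟨c, hc0, hc⟩
    have := congrFun hc 1
    simp at this
    exact hc0 this.symm
  · rw [Ne, mk_eq_mk_iff_exists]
    rintro ⟨c, hc0, hc⟩
    have := congrFun hc 0
    simp at this
    exact hc0 this.symm
  · rw [hρ, hρ, hρ, regulus_eq hj]
    ext R
    constructor
    · rintro ⟨p, rfl⟩
      induction p using Projectivization.ind with | h w hw => ?_
      exact ⟨w, hw, hρ w hw⟩
    · rintro ⟨w, hw, rfl⟩
      exact ⟨Projectivization.mk K w hw, hρ w hw⟩
  · intro T hT
    rw [hρ, hρ, hρ, isTransversal_iff hj] at hT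
    obtain ⟨b, hb, rfl⟩ := hT
    refine ⟨transversalMap j b, transversalMap_injective hj hb, rfl, fun p => ?_⟩
    induction p using Projectivization.ind with | h w hw => ?_
    rw [hρ, range_transversalMap_inf hj hb hw, Projectivization.map_mk,
      Projectivization.submodule_mk]

end Regulus

/-! ### Coordinates over `CD(B, 0)`: points and lines in terms of rows over `B`. -/

section Coordinates

variable {K : Type u} {B : Type v} [Field K] [DivisionRing B] [Algebra K B]
  (Q : QuadraticStructure K B)

/-- The element `a + t b̄` of `CD(B, 0)`. -/
def cdMk (a b : B) : CD Q (0 : K) := (a, Q.conj b)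

theorem cdMk_fst (a b : B) : (cdMk Q a b).1 = a := rfl
theorem cdMk_snd (a b : B) : (cdMk Q a b).2 = Q.conj b := rfl

theorem cdMk_eta (x : CD Q (0 : K)) : cdMk Q x.1 (Q.conj x.2) = x :=
  CD.ext rfl (Q.conj_conj _)

theorem mem_tSet {x : CD Q (0 : K)} : x ∈ tSet Q ↔ x.1 = 0 :=
  ⟨fun ⟨_, h⟩ => congrArg Prod.fst h, fun h => ⟨x.2, CD.ext h rfl⟩⟩

theorem cdStructure_conj_fst (x : CD Q (0 : K)) : ((cdStructure Q 0).conj x).1 = Q.conj x.1 := rfl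

theorem cdStructure_conj_snd (x : CD Q (0 : K)) : ((cdStructure Q 0).conj x).2 = -x.2 := by
  rw [QuadraticStructure.conj_apply, CD.sub_snd, CD.smul_snd, CD.one_snd, smul_zero, zero_sub]

theorem cdStructure_norm (x : CD Q (0 : K)) : (cdStructure Q 0).norm x = Q.norm x.1 := by
  change Q.norm x.1 - (0 : K) • Q.norm x.2 = _
  rw [zero_smul, sub_zero]

/-- The coordinates of the ambient space of `CD(B, 0)`: the first part is the ambient space of `B`,
the second one the row of the conjugates of the `t`-components. -/
def ambientCoord : (Ambient K B × (Fin 3 → B)) →ₗ[K] Ambient K (CD Q (0 : K)) where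
  toFun v := (v.1.1, fun i => cdMk Q (v.1.2 i) (v.2 i))
  map_add' _ _ := Prod.ext rfl (funext fun _ => CD.ext rfl (map_add Q.conj _ _))
  map_smul' k _ := Prod.ext rfl (funext fun _ => CD.ext rfl (map_smul Q.conj k _))

theorem ambientCoord_injective : Function.Injective (ambientCoord Q) := by
  rintro ⟨⟨n, w⟩, h⟩ ⟨⟨n', w'⟩, h'⟩ heq
  have h1 : n = n' := congrArg Prod.fst heq
  have h2 : w = w' := funext fun i => congrArg Prod.fst (congrFun (congrArg Prod.snd heq) i)
  have h3 : h = h' := funext fun i => by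
    have : Q.conj (h i) = Q.conj (h' i) :=
      congrArg Prod.snd (congrFun (congrArg Prod.snd heq) i)
    rw [← Q.conj_conj (h i), this, Q.conj_conj]
  rw [h1, h2, h3]

theorem ambientCoord_surjective : Function.Surjective (ambientCoord Q) := fun v =>
  ⟨((v.1, fun i => (v.2 i).1), fun i => Q.conj (v.2 i).2),
    Prod.ext rfl (funext fun i => cdMk_eta Q (v.2 i))⟩

/-- A row of `CD(B, 0)` from its components. -/
def cdRow (x c : Fin 3 → B) : Fin 3 → CD Q (0 : K) := fun i => cdMk Q (x i) (c i)

theorem cdRow_eta (p : Fin 3 → CD Q (0 : K)) :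
    cdRow Q (fun i => (p i).1) (fun i => Q.conj (p i).2) = p := funext fun i => cdMk_eta Q (p i)

/-- The cross product of rows. -/
def crossRow (c x : Fin 3 → B) : Fin 3 → B :=
  ![c 1 * x 2 - c 2 * x 1, c 2 * x 0 - c 0 * x 2, c 0 * x 1 - c 1 * x 0]

/-- Recording the conjugate of each `t`-component turns the twisted product into left
multiplication: the entry of `xᵢ x̄ⱼ` over `CD(B, 0)` acquires the `t`-part `cᵢ xⱼ - cⱼ xᵢ`, an
entry of a cross product. -/
theorem veroneseVec_cdRow (x c : Fin 3 → B) : veroneseVec (cdStructure Q 0) (cdRow Q x c) =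
    ambientCoord Q (veroneseVec Q x, crossRow c x) := by
  have key : ∀ i j, cdRow Q x c i * (cdStructure Q 0).conj (cdRow Q x c j) =
      cdMk Q (x i * Q.conj (x j)) (c i * x j - c j * x i) := by
    intro i j
    apply CD.ext
    · rw [CD.mul_fst, zero_smul, add_zero]; rfl
    · rw [CD.mul_snd, cdStructure_conj_fst, cdStructure_conj_snd]
      simp only [cdRow, cdMk_fst, cdMk_snd, map_sub, Q.conj_mul]
      rw [mul_neg]; abel
  refine Prod.ext (funext fun i => cdStructure_norm Q _) (funext fun i => ?_)
  fin_cases i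
  · exact key 1 2
  · exact key 2 0
  · exact key 0 1

theorem incident_cdRow {x c l m : Fin 3 → B} : Incident (cdRow Q x c) (cdRow Q l m) ↔
    l ⬝ᵥ x = 0 ∧ c ⬝ᵥ l + m ⬝ᵥ (fun i => Q.conj (x i)) = 0 := by
  have h1 : (cdRow Q l m 0 * cdRow Q x c 0 + cdRow Q l m 1 * cdRow Q x c 1 +
      cdRow Q l m 2 * cdRow Q x c 2).1 = l ⬝ᵥ x := by
    simp only [CD.add_fst, CD.mul_fst, zero_smul, add_zero, cdRow, cdMk_fst, dotProduct,
      Fin.sum_univ_three]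
  have h2 : (cdRow Q l m 0 * cdRow Q x c 0 + cdRow Q l m 1 * cdRow Q x c 1 +
      cdRow Q l m 2 * cdRow Q x c 2).2 =
      Q.conj (c ⬝ᵥ l + m ⬝ᵥ (fun i => Q.conj (x i))) := by
    simp only [CD.add_snd, CD.mul_snd, cdRow, cdMk_fst, cdMk_snd, dotProduct,
      Fin.sum_univ_three, map_add, Q.conj_mul, Q.conj_conj]
    abel
  rw [Incident]
  constructor
  · intro h
    rw [h] at h1 h2
    exact ⟨h1.symm, Q.conj_eq_zero.1 h2.symm⟩
  · rintro ⟨h3, h4⟩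
    exact CD.ext (h1.trans h3) (h2.trans (by rw [h4, map_zero]; rfl))

/-- The row `x` is a normalized point, and `c` vanishes at its pivot. -/
def NormalizedPair (x c : Fin 3 → B) : Prop :=
  (x 2 = 1 ∧ c 2 = 0) ∨ (x 2 = 0 ∧ x 0 = 1 ∧ c 0 = 0) ∨ (x 2 = 0 ∧ x 0 = 0 ∧ x 1 = 1 ∧ c 1 = 0)

theorem NormalizedPair.ne_zero {x c : Fin 3 → B} (h : NormalizedPair x c) : x ≠ 0 := by
  rintro rfl
  simp [NormalizedPair] at h

theorem row_ext {A : Type*} {x y : Fin 3 → A} (h0 : x 0 = y 0) (h1 : x 1 = y 1) (h2 : x 2 = y 2) :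
    x = y := by
  ext i; fin_cases i <;> assumption

theorem cdRow_mem_geomPoints {x c : Fin 3 → B} :
    cdRow Q x c ∈ geomPoints (tSet Q) ↔ NormalizedPair x c := by
  have hz : ∀ {a b : B}, cdMk Q a b = 1 ↔ a = 1 ∧ b = 0 := by
    intro a b
    constructor
    · intro h
      exact ⟨congrArg Prod.fst h, Q.conj_eq_zero.1 (congrArg Prod.snd h)⟩
    · rintro ⟨rfl, rfl⟩
      exact CD.ext rfl (map_zero Q.conj)
  constructor
  · rintro (⟨X, Y, h⟩ | ⟨Y, Z, hZ, h⟩ | ⟨X, hX, Z, hZ, h⟩)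
    · have h2 := congrFun h 2
      exact Or.inl (hz.1 h2)
    · have h0 := congrFun h 0
      have h2 : cdMk Q (x 2) (c 2) = Z := congrFun h 2
      rw [← h2, mem_tSet] at hZ
      exact Or.inr (Or.inl ⟨hZ, hz.1 h0⟩)
    · have h0 : cdMk Q (x 0) (c 0) = X := congrFun h 0
      have h1 := congrFun h 1
      have h2 : cdMk Q (x 2) (c 2) = Z := congrFun h 2
      rw [← h2, mem_tSet] at hZ
      rw [← h0, mem_tSet] at hX
      exact Or.inr (Or.inr ⟨hZ, hX, hz.1 h1⟩)
  · rintro (h | ⟨h2, h⟩ | ⟨h2, h0, h⟩)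
    · exact Or.inl ⟨_, _, row_ext rfl rfl (hz.2 h)⟩
    · exact Or.inr (Or.inl ⟨_, _, (mem_tSet Q).2 h2, row_ext (hz.2 h) rfl rfl⟩)
    · exact Or.inr (Or.inr ⟨_, (mem_tSet Q).2 h0, _, (mem_tSet Q).2 h2,
        row_ext rfl (hz.2 h) rfl⟩)

theorem mem_geomPoints_zero {x : Fin 3 → B} :
    x ∈ geomPoints ({0} : Set B) ↔ NormalizedPair x 0 := by
  constructor
  · rintro (⟨X, Y, rfl⟩ | ⟨Y, Z, rfl, rfl⟩ | ⟨X, rfl, Z, rfl, rfl⟩)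
    · exact Or.inl ⟨rfl, rfl⟩
    · exact Or.inr (Or.inl ⟨rfl, rfl, rfl⟩)
    · exact Or.inr (Or.inr ⟨rfl, rfl, rfl, rfl⟩)
  · rintro (⟨h, -⟩ | ⟨h2, h, -⟩ | ⟨h2, h0, h, -⟩)
    · exact Or.inl ⟨_, _, row_ext rfl rfl h⟩
    · exact Or.inr (Or.inl ⟨_, _, h2, row_ext h rfl rfl⟩)
    · exact Or.inr (Or.inr ⟨_, h0, _, h2, row_ext rfl h rfl⟩)

theorem exists_normalized {x : Fin 3 → B} (hx : x ≠ 0) :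
    ∃ (y : Fin 3 → B) (a : B), a ≠ 0 ∧ NormalizedPair y 0 ∧ x = fun i => y i * a := by
  by_cases h2 : x 2 = 0
  · by_cases h0 : x 0 = 0
    · have h1 : x 1 ≠ 0 := fun h1 => hx (row_ext h0 h1 h2)
      exact ⟨fun i => x i * (x 1)⁻¹, x 1, h1, Or.inr (Or.inr (by simp [h0, h1, h2])),
        funext fun i => by rw [mul_assoc, inv_mul_cancel₀ h1, mul_one]⟩
    · exact ⟨fun i => x i * (x 0)⁻¹, x 0, h0, Or.inr (Or.inl (by simp [h0, h2])),
        funext fun i => by rw [mul_assoc, inv_mul_cancel₀ h0, mul_one]⟩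
  · exact ⟨fun i => x i * (x 2)⁻¹, x 2, h2, Or.inl (by simp [h2]),
      funext fun i => by rw [mul_assoc, inv_mul_cancel₀ h2, mul_one]⟩

/-- Over a non-commutative `B` the identity `(c × x) x = 0` needs the normalization: the pivot of
`x` is `1` and `c` vanishes there, after which the terms cancel in pairs. -/
theorem crossRow_dotProduct {x c : Fin 3 → B} (h : NormalizedPair x c) :
    crossRow c x ⬝ᵥ x = 0 := by
  simp only [crossRow, dotProduct, Fin.sum_univ_three, cons_val_zero, cons_val_one, cons_val]
  rcases h with ⟨h, h'⟩ | ⟨h2, h, h'⟩ | ⟨h2, h0, h, h'⟩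
  · rw [h, h']; simp; abel
  · rw [h, h', h2]; simp
  · rw [h, h', h2, h0]; simp

/-- Two entries of the cross product are the free entries of `c` up to sign, because the pivot of
`x` is `1`; the third is then determined by `h x = 0`. -/
theorem exists_crossRow_eq {x h : Fin 3 → B} (hx : NormalizedPair x 0) (hh : h ⬝ᵥ x = 0) :
    ∃ c, NormalizedPair x c ∧ crossRow c x = h := by
  simp only [dotProduct, Fin.sum_univ_three] at hh
  rcases hx with ⟨h2, -⟩ | ⟨h2, h0, -⟩ | ⟨h2, h0, h1, -⟩
  · refine ⟨![-h 1, h 0, 0], Or.inl ⟨h2, rfl⟩, row_ext ?_ ?_ ?_⟩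
    · simp [crossRow, h2]
    · simp [crossRow, h2]
    · rw [h2, mul_one] at hh
      simp only [crossRow, cons_val, cons_val_zero, cons_val_one]
      rw [eq_neg_of_add_eq_zero_right hh, neg_mul]; abel
  · refine ⟨![0, -h 2, h 1], Or.inr (Or.inl ⟨h2, h0, rfl⟩), row_ext ?_ ?_ ?_⟩
    · rw [h2, h0, mul_one, mul_zero, add_zero] at hh
      simp [crossRow, h2, eq_neg_of_add_eq_zero_left hh]
    · simp [crossRow, h2, h0]
    · simp [crossRow, h0]
  · refine ⟨![h 2, 0, -h 0], Or.inr (Or.inr ⟨h2, h0, h1, rfl⟩), row_ext ?_ ?_ ?_⟩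
    · simp [crossRow, h1]
    · rw [h2, h0, h1, mul_one, mul_zero, mul_zero, add_zero, zero_add] at hh
      simp [crossRow, h2, h0, hh]
    · simp [crossRow, h1]

/-- The vectors of the points of the Veronese representation of `CD(B, 0)`. -/
def pointVec (x h : Fin 3 → B) : Ambient K (CD Q (0 : K)) :=
  ambientCoord Q (veroneseVec Q x, h)

theorem ambientCoord_eq_zero {v : Ambient K B × (Fin 3 → B)} : ambientCoord Q v = 0 ↔ v = 0 :=
  map_eq_zero_iff _ (ambientCoord_injective Q)

theorem pointVec_ne_zero {x : Fin 3 → B} (hx : x ≠ 0) (h : Fin 3 → B) : pointVec Q x h ≠ 0 :=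
  fun h0 => veroneseVec_ne_zero Q hx (congrArg Prod.fst ((ambientCoord_eq_zero Q).1 h0))

/-- Rescaling the column only rescales the annihilating row, so points may be described by arbitrary
non-zero columns in place of normalized ones. -/
theorem pointVec_right_mul {x : Fin 3 → B} {a : B} (ha : a ≠ 0) (h : Fin 3 → B) :
    pointVec Q (fun i => x i * a) h = Q.norm a • pointVec Q x ((Q.norm a)⁻¹ • h) := by
  rw [pointVec, pointVec, ← map_smul, veroneseVec_right_mul]
  change ambientCoord Q _ = ambientCoord Q (_ • veroneseVec Q x, _ • (_ • h))
  rw [smul_smul,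
    mul_inv_cancel₀ (mt Q.norm_eq_zero.1 ha), one_smul]

theorem smul_row_dotProduct (k : K) (h x : Fin 3 → B) : (k • h) ⬝ᵥ x = k • (h ⬝ᵥ x) :=
  smul_dotProduct k h x

theorem mem_veronesePoints_cd {P : ℙ K (Ambient K (CD Q (0 : K)))} :
    P ∈ veronesePoints (cdStructure Q 0) (tSet Q) ↔ ∃ x h, x ≠ 0 ∧ h ⬝ᵥ x = 0 ∧
      P.submodule = Submodule.span K {pointVec Q x h} := by
  constructor
  · rintro ⟨p, hp, -, h0, rfl⟩
    obtain ⟨x, c, rfl⟩ : ∃ x c, p = cdRow Q x c := ⟨_, _, (cdRow_eta Q p).symm⟩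
    rw [cdRow_mem_geomPoints] at hp
    refine ⟨_, _, hp.ne_zero, crossRow_dotProduct hp, ?_⟩
    rw [Projectivization.submodule_mk, veroneseVec_cdRow]; rfl
  · rintro ⟨x, h, hx, hh, hP⟩
    obtain ⟨y, a, ha, hy, rfl⟩ := exists_normalized hx
    have hN : Q.norm a ≠ 0 := mt Q.norm_eq_zero.1 ha
    rw [pointVec_right_mul Q ha, Submodule.span_singleton_smul_eq (IsUnit.mk0 _ hN)] at hP
    rw [dotProduct_right_mul, mul_eq_zero, or_iff_left ha] at hh
    obtain ⟨c, hc, hch⟩ := exists_crossRow_eq hy (h := (Q.norm a)⁻¹ • h)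
      (by rw [smul_row_dotProduct, hh, smul_zero])
    have heq : veroneseVec (cdStructure Q 0) (cdRow Q y c) = pointVec Q y ((Q.norm a)⁻¹ • h) := by
      rw [veroneseVec_cdRow, hch]; rfl
    refine ⟨cdRow Q y c, (cdRow_mem_geomPoints Q).2 hc, trivial,
      by rw [heq]; exact pointVec_ne_zero Q hy.ne_zero _, ?_⟩
    apply Projectivization.submodule_injective
    rw [hP, Projectivization.submodule_mk, heq]

theorem mem_veronesePoints_base {P : ℙ K (Ambient K B)} :
    P ∈ veronesePoints Q {0} ↔ ∃ x, x ≠ 0 ∧ P.submodule = Submodule.span K {veroneseVec Q x} := by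
  constructor
  · rintro ⟨p, hp, -, h0, rfl⟩
    exact ⟨p, (mem_geomPoints_zero.1 hp).ne_zero, Projectivization.submodule_mk _ _⟩
  · rintro ⟨x, hx, hP⟩
    obtain ⟨y, a, ha, hy, rfl⟩ := exists_normalized hx
    have hN : Q.norm a ≠ 0 := mt Q.norm_eq_zero.1 ha
    rw [veroneseVec_right_mul, Submodule.span_singleton_smul_eq (IsUnit.mk0 _ hN)] at hP
    exact ⟨y, mem_geomPoints_zero.2 hy, trivial, veroneseVec_ne_zero Q hy.ne_zero,
      eq_mk_of_submodule _ hP⟩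

/-! ### The lines -/

/-- The line `ℓ` of the geometry of `CD(B, 0)` lies over the line `l` of the plane over `B`, and
the `t`-components of its points are given by the linear map `s` modulo multiples of `l`. -/
structure LineShift (ℓ : Fin 3 → CD Q (0 : K)) (l : Fin 3 → B)
    (s : Ambient K B →ₗ[K] (Fin 3 → B)) : Prop where
  ne_zero : l ≠ 0
  of_incident : ∀ x c, NormalizedPair x c → Incident (cdRow Q x c) ℓ →
    l ⬝ᵥ x = 0 ∧ ∃ r : B, crossRow c x = s (veroneseVec Q x) + r • l
  exists_incident : ∀ x, NormalizedPair x 0 → l ⬝ᵥ x = 0 → ∀ r : B, ∃ c, NormalizedPair x c ∧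
    Incident (cdRow Q x c) ℓ ∧ crossRow c x = s (veroneseVec Q x) + r • l
  proper : s = 0 ∨ ∃ π : Ambient K B →ₗ[K] (K × K), ∀ w, rowMul Q l w = 0 →
    (∃ r : B, s w = r • l) → π w = 0 → w = 0

variable {Q}

theorem LineShift.smul {ℓ : Fin 3 → CD Q (0 : K)} {l : Fin 3 → B}
    {s : Ambient K B →ₗ[K] (Fin 3 → B)} (H : LineShift Q ℓ l s) {a : B} (ha : a ≠ 0) :
    LineShift Q ℓ (a • l) s where
  ne_zero := smul_ne_zero ha H.ne_zero
  of_incident x c hx hi := by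
    obtain ⟨h1, r, hr⟩ := H.of_incident x c hx hi
    refine ⟨by rw [smul_dotProduct, h1, smul_zero], r * a⁻¹, ?_⟩
    rw [hr, smul_smul, mul_assoc, inv_mul_cancel₀ ha, mul_one]
  exists_incident x hx hl r := by
    rw [smul_dotProduct, smul_eq_mul, mul_eq_zero, or_iff_right ha] at hl
    rw [smul_smul]
    exact H.exists_incident x hx hl (r * a)
  proper := by
    refine H.proper.imp_right ?_
    rintro ⟨π, hπ⟩
    refine ⟨π, fun w h1 h2 h3 => hπ w ?_ ?_ h3⟩
    · have h4 : rowMul Q (a • l) w = a • rowMul Q l w := by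
        apply row_ext <;> simp [rowMul, mul_add, mul_assoc]
      rw [h4] at h1
      exact (smul_eq_zero.1 h1).resolve_left ha
    · obtain ⟨r, hr⟩ := h2
      exact ⟨r * a, by rw [hr, smul_smul]⟩

variable (Q)

/-- The shift of the line `[a, 1, g]` with `t`-components `b, 0, d`. -/
def shiftMid (b d : B) : Ambient K B →ₗ[K] (Fin 3 → B) where
  toFun w := ![-(b * w.2 1 + w.1 2 • d), 0, w.1 0 • b + d * Q.conj (w.2 1)]
  map_add' w w' := by
    apply row_ext <;> simp [mul_add, add_smul] <;> abel
  map_smul' k w := by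
    apply row_ext <;> simp [smul_smul, smul_add]

/-- The shift of the line `[1, 0, g]` with `t`-components `0, b, d`. -/
def shiftFst (b d : B) : Ambient K B →ₗ[K] (Fin 3 → B) where
  toFun w := ![0, b * Q.conj (w.2 0) + w.1 2 • d, -(w.1 1 • b + d * w.2 0)]
  map_add' w w' := by
    apply row_ext <;> simp [mul_add, add_smul] <;> abel
  map_smul' k w := by
    apply row_ext <;> simp [smul_smul, smul_add]

/-- The shift of the line `[0, 0, 1]` with `t`-components `b, d, 0`. -/
def shiftLast (b d : B) : Ambient K B →ₗ[K] (Fin 3 → B) where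
  toFun w := ![b * Q.conj (w.2 2) + w.1 1 • d, -(w.1 0 • b + d * w.2 2), 0]
  map_add' w w' := by
    apply row_ext <;> simp [mul_add, add_smul] <;> abel
  map_smul' k w := by
    apply row_ext <;> simp [smul_smul, smul_add]

theorem eq_zero_of_mul_eq_zero_of_mul_conj_eq_zero {b d y : B} (h : b ≠ 0 ∨ d ≠ 0) (h1 : b * y = 0)
    (h2 : d * Q.conj y = 0) : y = 0 := by
  rcases h with h | h
  · exact (mul_eq_zero.1 h1).resolve_left h
  · exact Q.conj_eq_zero.1 ((mul_eq_zero.1 h2).resolve_left h)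

/-- The `t`-part of the incidence equation expresses `c 1` through the other entries of `c`. After
substitution in the cross product, the terms with `b` and `d` are linear in the entries of `x x*`,
and the free entry of `c` contributes a multiple of `l`. -/
theorem lineShift_mid (a g b d : B) :
    LineShift Q (cdRow Q ![a, 1, g] ![b, 0, d]) ![a, 1, g] (shiftMid Q b d) where
  ne_zero h := one_ne_zero (congrFun h 1)
  of_incident x c hx hi := by
    rw [incident_cdRow] at hi
    -- Where `l` has its entry `1` the shift is `0`, so the multiple of `l` must be that entry of
    -- the cross product.
    refine ⟨hi.1, c 2 * x 0 - c 0 * x 2, ?_⟩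
    obtain ⟨h1, h2⟩ := hi
    simp only [dotProduct, Fin.sum_univ_three, cons_val_zero, cons_val_one, cons_val, one_mul,
      mul_one, zero_mul, add_zero] at h1 h2
    rcases hx with ⟨e2, e⟩ | ⟨e2, e0, e⟩ | ⟨e2, e0, e1, e⟩
    · rw [e2, Q.conj_one] at h2
      rw [e2] at h1
      have hx1 : x 1 = -(a * x 0 + g) := by
        rw [eq_neg_iff_add_eq_zero, ← h1]; simp; abel
      have hc1 : c 1 = -(c 0 * a + (b * Q.conj (x 0) + d)) := by
        rw [eq_neg_iff_add_eq_zero, ← h2, e]; simp; abel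
      apply row_ext
      · simp [crossRow, shiftMid, veroneseVec, e, e2, hc1, Q.conj_one, Q.norm_one]
      · simp [crossRow, shiftMid, e, e2]
      · simp [crossRow, shiftMid, veroneseVec, e, e2, hc1, hx1, Q.conj_conj, mul_add, add_mul,
          mul_assoc, Q.conj_mul_self]
        abel
    · rw [e2, e0, Q.conj_one, map_zero] at h2
      rw [e2, e0] at h1
      have hx1 : x 1 = -a := by
        rw [eq_neg_iff_add_eq_zero, ← h1]; simp; abel
      have hc1 : c 1 = -(c 2 * g + b) := by
        rw [eq_neg_iff_add_eq_zero, ← h2, e]; simp; abel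
      apply row_ext
      · simp [crossRow, shiftMid, veroneseVec, e, e2, hx1, e0]
      · simp [crossRow, shiftMid, e, e2, e0]
      · simp [crossRow, shiftMid, veroneseVec, e, e2, hc1, e0, Q.norm_one]
        abel
    · rw [e2, e0, e1] at h1
      simp at h1
  exists_incident x hx hl r := by
    have h1 := hl
    simp only [dotProduct, Fin.sum_univ_three, cons_val_zero, cons_val_one, cons_val,
      one_mul] at h1
    rcases hx with ⟨e2, -⟩ | ⟨e2, e0, -⟩ | ⟨e2, e0, e1, -⟩
    · rw [e2] at h1
      have hx1 : x 1 = -(a * x 0 + g) := by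
        rw [eq_neg_iff_add_eq_zero, ← h1]; simp; abel
      -- The entry `c 0 = -r` is forced by the middle entry of the cross product, and `c 1` by
      -- incidence.
      refine ⟨![-r, r * a - (b * Q.conj (x 0) + d), 0], Or.inl ⟨e2, rfl⟩,
        (incident_cdRow Q).2 ⟨hl, ?_⟩, row_ext ?_ ?_ ?_⟩
      · simp [dotProduct, Fin.sum_univ_three, e2, Q.conj_one]; abel
      · simp [crossRow, shiftMid, veroneseVec, e2, Q.conj_one, Q.norm_one]; abel
      · simp [crossRow, shiftMid, e2]
      · simp [crossRow, shiftMid, veroneseVec, e2, hx1, Q.conj_conj, mul_add, add_mul, sub_mul,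
          mul_assoc, Q.conj_mul_self]
        abel
    · rw [e2, e0] at h1
      have hx1 : x 1 = -a := by
        rw [eq_neg_iff_add_eq_zero, ← h1]; simp; abel
      refine ⟨![0, -(r * g + b), r], Or.inr (Or.inl ⟨e2, e0, rfl⟩),
        (incident_cdRow Q).2 ⟨hl, ?_⟩, row_ext ?_ ?_ ?_⟩
      · simp [dotProduct, Fin.sum_univ_three, e2, e0, Q.conj_one]
      · simp [crossRow, shiftMid, veroneseVec, e2, hx1]
      · simp [crossRow, shiftMid, e2, e0]
      · simp [crossRow, shiftMid, veroneseVec, e2, e0, Q.norm_one]; abel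
    · rw [e2, e0, e1] at h1
      simp at h1
  proper := by
    -- For a non-zero shift, two diagonal entries detect the matrices `w` with `l w = 0` and `s w`
    -- in `B l`: the entry where `l` is `1` forces the multiple to be `0`, the other two entries
    -- kill `w 1`, and `l w = 0` kills the remainder.
    by_cases hbd : b ≠ 0 ∨ d ≠ 0
    · refine Or.inr ⟨((LinearMap.proj 0).comp (LinearMap.fst K _ _)).prod
        ((LinearMap.proj 2).comp (LinearMap.fst K _ _)), ?_⟩
      rintro ⟨n, w⟩ h1 ⟨r, h2⟩ h3
      have n0 : n 0 = 0 := congrArg Prod.fst h3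
      have n2 : n 2 = 0 := congrArg Prod.snd h3
      have hr : r = 0 := by simpa [shiftMid, eq_comm] using congrFun h2 1
      subst hr
      have s0 : b * w 1 = 0 := by simpa [shiftMid, n2] using congrFun h2 0
      have s2 : d * Q.conj (w 1) = 0 := by simpa [shiftMid, n0] using congrFun h2 2
      have w1 := eq_zero_of_mul_eq_zero_of_mul_conj_eq_zero Q hbd s0 s2
      have w2 : w 2 = 0 := by simpa [rowMul, n0, w1, Q.conj_eq_zero] using congrFun h1 0
      have w0 : w 0 = 0 := by simpa [rowMul, n2, w1] using congrFun h1 2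
      have n1 : n 1 = 0 := by simpa [rowMul, w2, w0] using congrFun h1 1
      exact Prod.ext (row_ext n0 n1 n2) (row_ext w0 w1 w2)
    · push Not at hbd
      left
      refine LinearMap.ext fun w => row_ext ?_ ?_ ?_ <;> simp [shiftMid, hbd.1, hbd.2]

theorem lineShift_fst (g b d : B) :
    LineShift Q (cdRow Q ![1, 0, g] ![0, b, d]) ![1, 0, g] (shiftFst Q b d) where
  ne_zero h := one_ne_zero (congrFun h 0)
  of_incident x c hx hi := by
    rw [incident_cdRow] at hi
    refine ⟨hi.1, c 1 * x 2 - c 2 * x 1, ?_⟩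
    obtain ⟨h1, h2⟩ := hi
    simp only [dotProduct, Fin.sum_univ_three, cons_val_zero, cons_val_one, cons_val, one_mul,
      mul_one, mul_zero, zero_mul, add_zero, zero_add] at h1 h2
    rcases hx with ⟨e2, e⟩ | ⟨e2, e0, e⟩ | ⟨e2, e0, e1, e⟩
    · rw [e2, Q.conj_one] at h2
      rw [e2] at h1
      have hx0 : x 0 = -g := by
        rw [eq_neg_iff_add_eq_zero, ← h1]; simp
      have hc0 : c 0 = -(b * Q.conj (x 1) + d) := by
        rw [eq_neg_iff_add_eq_zero, ← h2, e]; simp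
      apply row_ext
      · simp [crossRow, shiftFst, e, e2]
      · simp [crossRow, shiftFst, veroneseVec, e, e2, hc0, Q.conj_one, Q.norm_one]
      · simp [crossRow, shiftFst, veroneseVec, e, e2, hc0, hx0, Q.conj_one, add_mul,
          mul_assoc, Q.conj_mul_self]
    · rw [e2, e0] at h1
      simp at h1
    · rw [e2, e1, Q.conj_one, map_zero] at h2
      have hc0 : c 0 = -(c 2 * g + b) := by
        rw [eq_neg_iff_add_eq_zero, ← h2]; simp; abel
      apply row_ext
      · simp [crossRow, shiftFst, e, e2, e1]
      · simp [crossRow, shiftFst, veroneseVec, e, e2, e0, e1]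
      · simp [crossRow, shiftFst, veroneseVec, e, e2, hc0, e1, Q.norm_one]
  exists_incident x hx hl r := by
    have h1 := hl
    simp only [dotProduct, Fin.sum_univ_three, cons_val_zero, cons_val_one, cons_val,
      one_mul, zero_mul, add_zero] at h1
    rcases hx with ⟨e2, -⟩ | ⟨e2, e0, -⟩ | ⟨e2, e0, e1, -⟩
    · rw [e2] at h1
      have hx0 : x 0 = -g := by
        rw [eq_neg_iff_add_eq_zero, ← h1]; simp
      refine ⟨![-(b * Q.conj (x 1) + d), r, 0], Or.inl ⟨e2, rfl⟩,
        (incident_cdRow Q).2 ⟨hl, ?_⟩, row_ext ?_ ?_ ?_⟩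
      · simp [dotProduct, Fin.sum_univ_three, e2, Q.conj_one]
      · simp [crossRow, shiftFst, e2]
      · simp [crossRow, shiftFst, veroneseVec, e2, Q.conj_one, Q.norm_one]
      · simp [crossRow, shiftFst, veroneseVec, e2, hx0, Q.conj_one, add_mul, mul_assoc,
          Q.conj_mul_self]
    · rw [e2, e0] at h1
      simp at h1
    · refine ⟨![r * g - b, 0, -r], Or.inr (Or.inr ⟨e2, e0, e1, rfl⟩),
        (incident_cdRow Q).2 ⟨hl, ?_⟩, row_ext ?_ ?_ ?_⟩
      · simp [dotProduct, Fin.sum_univ_three, e2, e1, Q.conj_one]; abel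
      · simp [crossRow, shiftFst, e1]
      · simp [crossRow, shiftFst, veroneseVec, e2, e0]
      · simp [crossRow, shiftFst, veroneseVec, e2, e1, Q.norm_one]; abel
  proper := by
    by_cases hbd : d ≠ 0 ∨ b ≠ 0
    · refine Or.inr ⟨((LinearMap.proj 1).comp (LinearMap.fst K _ _)).prod
        ((LinearMap.proj 2).comp (LinearMap.fst K _ _)), ?_⟩
      rintro ⟨n, w⟩ h1 ⟨r, h2⟩ h3
      have n1 : n 1 = 0 := congrArg Prod.fst h3
      have n2 : n 2 = 0 := congrArg Prod.snd h3
      have hr : r = 0 := by simpa [shiftFst, eq_comm] using congrFun h2 0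
      subst hr
      have s1 : b * Q.conj (w 0) + n 2 • d = (0 : B) • (0 : B) := congrFun h2 1
      rw [n2, zero_smul, zero_smul, add_zero] at s1
      have s2 : -(n 1 • b + d * w 0) = (0 : B) • g := congrFun h2 2
      rw [n1, zero_smul, zero_smul, zero_add, neg_eq_zero] at s2
      have w0 := eq_zero_of_mul_eq_zero_of_mul_conj_eq_zero Q hbd s2 s1
      have w2 : w 2 = 0 := by simpa [rowMul, n1, w0] using congrFun h1 1
      have w1 : w 1 = 0 := by simpa [rowMul, n2, w0, Q.conj_eq_zero] using congrFun h1 2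
      have n0 : n 0 = 0 := by simpa [rowMul, w2, w1] using congrFun h1 0
      exact Prod.ext (row_ext n0 n1 n2) (row_ext w0 w1 w2)
    · push Not at hbd
      left
      refine LinearMap.ext fun w => row_ext ?_ ?_ ?_ <;> simp [shiftFst, hbd.1, hbd.2]

theorem lineShift_last (b d : B) :
    LineShift Q (cdRow Q ![0, 0, 1] ![b, d, 0]) ![0, 0, 1] (shiftLast Q b d) where
  ne_zero h := one_ne_zero (congrFun h 2)
  of_incident x c hx hi := by
    rw [incident_cdRow] at hi
    refine ⟨hi.1, c 0 * x 1 - c 1 * x 0, ?_⟩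
    obtain ⟨h1, h2⟩ := hi
    simp only [dotProduct, Fin.sum_univ_three, cons_val_zero, cons_val_one, cons_val, one_mul,
      mul_one, mul_zero, zero_mul, add_zero, zero_add] at h1 h2
    rcases hx with ⟨e2, e⟩ | ⟨e2, e0, e⟩ | ⟨e2, e0, e1, e⟩
    · exact absurd (e2.symm.trans h1) one_ne_zero
    · rw [e0, Q.conj_one] at h2
      have hc2 : c 2 = -(b + d * Q.conj (x 1)) := by
        rw [eq_neg_iff_add_eq_zero, ← h2]; simp
      apply row_ext
      · simp [crossRow, shiftLast, veroneseVec, e2, e0, hc2, Q.conj_conj, add_mul, mul_assoc,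
          Q.conj_mul_self]
      · simp [crossRow, shiftLast, veroneseVec, e, e2, e0, hc2, Q.norm_one]
      · simp [crossRow, shiftLast, e, e0]
    · rw [e0, e1, Q.conj_one, map_zero] at h2
      have hc2 : c 2 = -d := by
        rw [eq_neg_iff_add_eq_zero, ← h2]; simp
      apply row_ext
      · simp [crossRow, shiftLast, veroneseVec, e2, e0, e1, hc2, Q.norm_one]
      · simp [crossRow, shiftLast, veroneseVec, e2, e0]
      · simp [crossRow, shiftLast, e, e0, e1]
  exists_incident x hx hl r := by
    have h1 := hl
    simp only [dotProduct, Fin.sum_univ_three, cons_val_zero, cons_val_one, cons_val,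
      one_mul, zero_mul, zero_add] at h1
    rcases hx with ⟨e2, -⟩ | ⟨e2, e0, -⟩ | ⟨e2, e0, e1, -⟩
    · exact absurd (e2.symm.trans h1) one_ne_zero
    · refine ⟨![0, -r, -(b + d * Q.conj (x 1))], Or.inr (Or.inl ⟨e2, e0, rfl⟩),
        (incident_cdRow Q).2 ⟨hl, ?_⟩, row_ext ?_ ?_ ?_⟩
      · simp [dotProduct, Fin.sum_univ_three, e0, Q.conj_one]
      · simp [crossRow, shiftLast, veroneseVec, e2, e0, Q.conj_conj, add_mul, mul_assoc,
          Q.conj_mul_self]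
      · simp [crossRow, shiftLast, veroneseVec, e2, e0, Q.norm_one]
      · simp [crossRow, shiftLast, e0]
    · refine ⟨![r, 0, -d], Or.inr (Or.inr ⟨e2, e0, e1, rfl⟩),
        (incident_cdRow Q).2 ⟨hl, ?_⟩, row_ext ?_ ?_ ?_⟩
      · simp [dotProduct, Fin.sum_univ_three, e0, e1, Q.conj_one]
      · simp [crossRow, shiftLast, veroneseVec, e2, e0, e1, Q.norm_one]
      · simp [crossRow, shiftLast, veroneseVec, e2, e0]
      · simp [crossRow, shiftLast, e1]
  proper := by
    by_cases hbd : d ≠ 0 ∨ b ≠ 0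
    · refine Or.inr ⟨((LinearMap.proj 0).comp (LinearMap.fst K _ _)).prod
        ((LinearMap.proj 1).comp (LinearMap.fst K _ _)), ?_⟩
      rintro ⟨n, w⟩ h1 ⟨r, h2⟩ h3
      have n0 : n 0 = 0 := congrArg Prod.fst h3
      have n1 : n 1 = 0 := congrArg Prod.snd h3
      have hr : r = 0 := by simpa [shiftLast, eq_comm] using congrFun h2 2
      subst hr
      have s1 : b * Q.conj (w 2) + n 1 • d = (0 : B) • (0 : B) := congrFun h2 0
      rw [n1, zero_smul, zero_smul, add_zero] at s1
      have s2 : -(n 0 • b + d * w 2) = (0 : B) • (0 : B) := congrFun h2 1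
      rw [n0, zero_smul, zero_smul, zero_add, neg_eq_zero] at s2
      have w2 := eq_zero_of_mul_eq_zero_of_mul_conj_eq_zero Q hbd s2 s1
      have w1 : w 1 = 0 := by simpa [rowMul] using congrFun h1 0
      have w0 : w 0 = 0 := by simpa [rowMul, Q.conj_eq_zero] using congrFun h1 1
      have n2 : n 2 = 0 := by simpa [rowMul] using congrFun h1 2
      exact Prod.ext (row_ext n0 n1 n2) (row_ext w0 w1 w2)
    · push Not at hbd
      left
      refine LinearMap.ext fun w => row_ext ?_ ?_ ?_ <;> simp [shiftLast, hbd.1, hbd.2]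

theorem exists_lineShift {ℓ : Fin 3 → CD Q (0 : K)} (hℓ : ℓ ∈ geomLines (tSet Q)) :
    ∃ l s, LineShift Q ℓ l s := by
  have h1 : cdMk Q (1 : B) 0 = 1 := CD.ext rfl (map_zero Q.conj)
  have ht : ∀ {z : CD Q (0 : K)}, z ∈ tSet Q → cdMk Q 0 (Q.conj z.2) = z := by
    intro z hz
    rw [← (mem_tSet Q).1 hz, cdMk_eta]
  rcases hℓ with ⟨a, c, rfl⟩ | ⟨b, hb, c, rfl⟩ | ⟨a, ha, b, hb, rfl⟩
  · have := lineShift_mid Q a.1 c.1 (Q.conj a.2) (Q.conj c.2)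
    rw [show cdRow Q ![a.1, 1, c.1] ![Q.conj a.2, 0, Q.conj c.2] = ![a, 1, c] from
      row_ext (cdMk_eta Q a) h1 (cdMk_eta Q c)] at this
    exact ⟨_, _, this⟩
  · have := lineShift_fst Q c.1 (Q.conj b.2) (Q.conj c.2)
    rw [show cdRow Q ![1, 0, c.1] ![0, Q.conj b.2, Q.conj c.2] = ![1, b, c] from
      row_ext h1 (ht hb) (cdMk_eta Q c)] at this
    exact ⟨_, _, this⟩
  · have := lineShift_last Q (Q.conj a.2) (Q.conj b.2)
    rw [show cdRow Q ![0, 0, 1] ![Q.conj a.2, Q.conj b.2, 0] = ![a, b, 1] from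
      row_ext (ht ha) (ht hb) h1] at this
    exact ⟨_, _, this⟩

theorem exists_normalized_line {l : Fin 3 → B} (hl : l ≠ 0) :
    ∃ (r : B) (l' : Fin 3 → B), r ≠ 0 ∧ l = r • l' ∧ l' ∈ geomLines ({0} : Set B) := by
  by_cases h1 : l 1 = 0
  · by_cases h0 : l 0 = 0
    · have h2 : l 2 ≠ 0 := fun h2 => hl (row_ext h0 h1 h2)
      exact ⟨l 2, ![0, 0, 1], h2, row_ext (by simp [h0]) (by simp [h1]) (by simp),
        Or.inr (Or.inr ⟨0, rfl, 0, rfl, rfl⟩)⟩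
    · exact ⟨l 0, ![1, 0, (l 0)⁻¹ * l 2], h0, row_ext (by simp) (by simp [h1]) (by simp [h0]),
        Or.inr (Or.inl ⟨0, rfl, _, rfl⟩)⟩
  · exact ⟨l 1, ![(l 1)⁻¹ * l 0, 1, (l 1)⁻¹ * l 2], h1,
      row_ext (by simp [h1]) (by simp) (by simp [h1]), Or.inl ⟨_, _, rfl⟩⟩

theorem geomLines_ne_zero {l : Fin 3 → B} (hl : l ∈ geomLines ({0} : Set B)) : l ≠ 0 := by
  rcases hl with ⟨a, c, rfl⟩ | ⟨b, rfl, c, rfl⟩ | ⟨a, rfl, b, rfl, rfl⟩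
  · exact fun h => one_ne_zero (congrFun h 1)
  · exact fun h => one_ne_zero (congrFun h 0)
  · exact fun h => one_ne_zero (congrFun h 2)

/-- The line with zero `t`-components. It ensures that every line of the plane over `B` contributes
a vertex and a full section with `F`. -/
theorem exists_lineShift_zero {l : Fin 3 → B} (hl : l ≠ 0) :
    ∃ ℓ ∈ geomLines (tSet Q), LineShift Q ℓ l 0 := by
  have h1 : cdMk Q (1 : B) 0 = 1 := CD.ext rfl (map_zero Q.conj)
  obtain ⟨r, l', hr, rfl, hl'⟩ := exists_normalized_line hl
  have m0 : shiftMid Q 0 0 = 0 :=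
    LinearMap.ext fun w => row_ext (by simp [shiftMid]) (by simp [shiftMid]) (by simp [shiftMid])
  have f0 : shiftFst Q 0 0 = 0 :=
    LinearMap.ext fun w => row_ext (by simp [shiftFst]) (by simp [shiftFst]) (by simp [shiftFst])
  have l0 : shiftLast Q 0 0 = 0 := LinearMap.ext fun w =>
    row_ext (by simp [shiftLast]) (by simp [shiftLast]) (by simp [shiftLast])
  rcases hl' with ⟨a, c, rfl⟩ | ⟨b, rfl, c, rfl⟩ | ⟨a, rfl, b, rfl, rfl⟩
  · refine ⟨cdRow Q ![a, 1, c] ![0, 0, 0], Or.inl ⟨cdMk Q a 0, cdMk Q c 0, row_ext rfl h1 rfl⟩, ?_⟩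
    rw [← m0]
    exact (lineShift_mid Q a c 0 0).smul hr
  · refine ⟨cdRow Q ![1, 0, c] ![0, 0, 0], Or.inr (Or.inl ⟨cdMk Q 0 0, (mem_tSet Q).2 rfl,
      cdMk Q c 0, row_ext h1 rfl rfl⟩), ?_⟩
    rw [← f0]
    exact (lineShift_fst Q c 0 0).smul hr
  · refine ⟨cdRow Q ![0, 0, 1] ![0, 0, 0], Or.inr (Or.inr ⟨cdMk Q 0 0, (mem_tSet Q).2 rfl,
      cdMk Q 0 0, (mem_tSet Q).2 rfl, row_ext rfl rfl h1⟩), ?_⟩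
    rw [← l0]
    exact (lineShift_last Q 0 0).smul hr

end Coordinates

/-! ### Universe lifts of cardinals. -/

theorem cardinal_lift_max (c : Cardinal.{v}) :
    Cardinal.lift.{max u v, v} c = Cardinal.lift.{u, v} c :=
  congrFun Cardinal.lift_umax.{v, u} c

theorem cardinal_lift_self (c : Cardinal.{max u v}) : Cardinal.lift.{v, max u v} c = c :=
  Cardinal.lift_id'.{v, max u v} c

/-! ### Row spaces, spans of lines and their tubes. -/

section Subspaces

variable {K : Type u} {B : Type v} [Field K] [DivisionRing B] [Algebra K B]
  (Q : QuadraticStructure K B)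

theorem exists_frame {l : Fin 3 → B} (hl : l ≠ 0) : ∃ e f g h, LineFrame l e f g h := by
  obtain ⟨r, l', hr, rfl, hl'⟩ := exists_normalized_line hl
  suffices h : ∃ e f : Fin 3 → B, e ≠ 0 ∧ f ≠ 0 ∧ l' ⬝ᵥ e = 0 ∧ l' ⬝ᵥ f = 0 ∧
      ∀ a : B, f ≠ fun i => e i * a by
    obtain ⟨e, f, he, hf, hle, hlf, hef⟩ := h
    obtain ⟨g, h, F⟩ := exists_lineFrame hl he hf (by rw [smul_dotProduct, hle, smul_zero])
      (by rw [smul_dotProduct, hlf, smul_zero]) (fun hp => by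
        obtain ⟨a, ha⟩ := exists_right_mul_of_perp_le he hp.le
        exact hef a ha)
    exact ⟨e, f, g, h, F⟩
  rcases hl' with ⟨a, c, rfl⟩ | ⟨b, rfl, c, rfl⟩ | ⟨a, rfl, b, rfl, rfl⟩
  · refine ⟨![1, -a, 0], ![0, -c, 1], fun h => one_ne_zero (congrFun h 0),
      fun h => one_ne_zero (congrFun h 2), ?_, ?_, fun b h => ?_⟩
    · simp [dotProduct, Fin.sum_univ_three]
    · simp [dotProduct, Fin.sum_univ_three]
    · simpa using congrFun h 2
  · refine ⟨![0, 1, 0], ![-c, 0, 1], fun h => one_ne_zero (congrFun h 1),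
      fun h => one_ne_zero (congrFun h 2), ?_, ?_, fun b h => ?_⟩
    · simp [dotProduct, Fin.sum_univ_three]
    · simp [dotProduct, Fin.sum_univ_three]
    · simpa using congrFun h 2
  · refine ⟨![1, 0, 0], ![0, 1, 0], fun h => one_ne_zero (congrFun h 0),
      fun h => one_ne_zero (congrFun h 1), ?_, ?_, fun b h => ?_⟩
    · simp [dotProduct, Fin.sum_univ_three]
    · simp [dotProduct, Fin.sum_univ_three]
    · simpa using congrFun h 1

theorem LineFrame.e_ne_zero {l e f g h : Fin 3 → B} (F : LineFrame l e f g h) : e ≠ 0 := by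
  rintro rfl; simpa using F.ge

/-- The subspace of the ambient space of `CD(B, 0)` corresponding to a left subspace of rows. -/
def rowSpace (U : Submodule B (Fin 3 → B)) : Submodule K (Ambient K (CD Q (0 : K))) :=
  (U.restrictScalars K).map ((ambientCoord Q).comp (LinearMap.inr K (Ambient K B) (Fin 3 → B)))

/-- The embedding of the ambient space of `B`. -/
def baseEmb : Ambient K B →ₗ[K] Ambient K (CD Q (0 : K)) :=
  (ambientCoord Q).comp (LinearMap.inl K (Ambient K B) (Fin 3 → B))

/-- The projection onto the ambient space of `B`. -/
def baseProj : Ambient K (CD Q (0 : K)) →ₗ[K] Ambient K B where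
  toFun v := (v.1, fun i => (v.2 i).1)
  map_add' _ _ := rfl
  map_smul' _ _ := rfl

theorem baseEmb_apply (w : Ambient K B) : baseEmb Q w = ambientCoord Q (w, 0) := rfl

theorem baseEmb_injective : Function.Injective (baseEmb Q) :=
  (ambientCoord_injective Q).comp LinearMap.inl_injective

theorem mem_range_baseEmb {w : Ambient K B} {h : Fin 3 → B} :
    ambientCoord Q (w, h) ∈ LinearMap.range (baseEmb Q) ↔ h = 0 := by
  constructor
  · rintro ⟨w', hw⟩
    exact (congrArg Prod.snd (ambientCoord_injective Q hw)).symm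
  · rintro rfl; exact ⟨w, rfl⟩

theorem mem_rowSpace {U : Submodule B (Fin 3 → B)} {w : Ambient K B} {h : Fin 3 → B} :
    ambientCoord Q (w, h) ∈ rowSpace Q U ↔ w = 0 ∧ h ∈ U := by
  constructor
  · rintro ⟨h', hh', heq⟩
    have := ambientCoord_injective Q heq
    have h1 : 0 = w := congrArg Prod.fst this
    have h2 : h' = h := congrArg Prod.snd this
    exact ⟨h1.symm, h2 ▸ hh'⟩
  · rintro ⟨rfl, hh⟩
    exact ⟨h, hh, rfl⟩

theorem exists_of_mem_rowSpace {U : Submodule B (Fin 3 → B)} {v : Ambient K (CD Q (0 : K))}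
    (hv : v ∈ rowSpace Q U) : ∃ h ∈ U, v = ambientCoord Q (0, h) := by
  obtain ⟨h, hh, rfl⟩ := hv
  exact ⟨h, hh, rfl⟩

theorem rowSpace_le_iff {U V : Submodule B (Fin 3 → B)} :
    rowSpace Q U ≤ rowSpace Q V ↔ U ≤ V := by
  constructor
  · intro h x hx
    exact ((mem_rowSpace Q).1 (h ((mem_rowSpace Q).2 ⟨rfl, hx⟩))).2
  · intro h
    exact Submodule.map_mono h

theorem rowSpace_injective : Function.Injective (rowSpace Q) := fun _ _ h =>
  le_antisymm ((rowSpace_le_iff Q).1 h.le) ((rowSpace_le_iff Q).1 h.ge)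

theorem rowSpace_sup (U V : Submodule B (Fin 3 → B)) :
    rowSpace Q (U ⊔ V) = rowSpace Q U ⊔ rowSpace Q V := by
  apply le_antisymm
  · intro v hv
    obtain ⟨h, hh, rfl⟩ := exists_of_mem_rowSpace Q hv
    obtain ⟨a, ha, b, hb, rfl⟩ := Submodule.mem_sup.1 hh
    have : ambientCoord Q ((0 : Ambient K B), a + b) =
        ambientCoord Q (0, a) + ambientCoord Q (0, b) := by
      rw [← map_add, Prod.mk_add_mk, add_zero]
    rw [this]
    exact Submodule.add_mem_sup ((mem_rowSpace Q).2 ⟨rfl, ha⟩) ((mem_rowSpace Q).2 ⟨rfl, hb⟩)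
  · exact sup_le ((rowSpace_le_iff Q).2 le_sup_left) ((rowSpace_le_iff Q).2 le_sup_right)

theorem mem_rowSpace_span {l : Fin 3 → B} {v : Ambient K (CD Q (0 : K))} :
    v ∈ rowSpace Q (Submodule.span B {l}) ↔ ∃ r : B, v = ambientCoord Q (0, r • l) := by
  constructor
  · intro hv
    obtain ⟨h, hh, rfl⟩ := exists_of_mem_rowSpace Q hv
    obtain ⟨r, rfl⟩ := Submodule.mem_span_singleton.1 hh
    exact ⟨r, rfl⟩
  · rintro ⟨r, rfl⟩
    exact (mem_rowSpace Q).2 ⟨rfl, Submodule.smul_mem _ _ (Submodule.mem_span_singleton_self _)⟩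

theorem rank_rowSpace (U : Submodule B (Fin 3 → B)) :
    Module.rank K (rowSpace Q U) =
      (Module.finrank B U : Cardinal.{max u v}) * Cardinal.lift.{u} (Module.rank K B) := by
  let e₁ : U.restrictScalars K ≃ₗ[K] rowSpace Q U := Submodule.equivMapOfInjective
    ((ambientCoord Q).comp (LinearMap.inr K (Ambient K B) (Fin 3 → B))) ((ambientCoord_injective Q).comp LinearMap.inr_injective) _
  let e₂ : U ≃ₗ[B] (Fin (Module.finrank B U) → B) := (Module.finBasis B U).equivFun
  let e₃ : U.restrictScalars K ≃ₗ[K] (Fin (Module.finrank B U) → B) := e₂.restrictScalars K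
  have h1 := (e₁.symm.trans e₃).lift_rank_eq
  rw [rank_fun_eq_lift_mul, Fintype.card_fin] at h1
  rw [Cardinal.lift_uzero, Cardinal.lift_mul, Cardinal.lift_natCast] at h1
  refine (cardinal_lift_self.{u, v} _).symm.trans (h1.trans ?_)
  exact congrArg (fun c : Cardinal.{max u v} => (Module.finrank B U : Cardinal.{max u v}) * c)
    (cardinal_lift_max.{u, v} _)

theorem rank_ambient_cd : Module.rank K (Ambient K (CD Q (0 : K))) =
    6 * Cardinal.lift.{u} (Module.rank K B) + 3 := by
  have h := (LinearEquiv.ofBijective (ambientCoord Q)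
    ⟨ambientCoord_injective Q, ambientCoord_surjective Q⟩).rank_eq
  rw [← h, rank_prod, rank_prod, rank_fun_eq_lift_mul, rank_fun_eq_lift_mul]
  simp
  ring_nf
  exact congrArg (fun c : Cardinal.{max u v} => 3 + c * 6) (cardinal_lift_max.{u, v} _)

theorem rank_lineModel : Module.rank K (K × K × B) =
    Cardinal.lift.{u} (Module.rank K B) + 2 := by
  rw [rank_prod, rank_prod]
  simp
  ring

/-! ### The subspaces spanned by the lines -/

/-- `(w, r) ↦ (w, s w + r l)`. -/
def shiftMap (l : Fin 3 → B) (s : Ambient K B →ₗ[K] (Fin 3 → B)) :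
    (Ambient K B × B) →ₗ[K] Ambient K (CD Q (0 : K)) :=
  (ambientCoord Q).comp ((LinearMap.fst K (Ambient K B) B).prod
    (s.comp (LinearMap.fst K (Ambient K B) B) +
      ((LinearMap.toSpanSingleton B (Fin 3 → B) l).restrictScalars K).comp
        (LinearMap.snd K (Ambient K B) B)))

theorem shiftMap_apply (l : Fin 3 → B) (s : Ambient K B →ₗ[K] (Fin 3 → B)) (w : Ambient K B)
    (r : B) : shiftMap Q l s (w, r) = ambientCoord Q (w, s w + r • l) := rfl

/-- The subspace spanned by the line lying over `l` with shift `s`. -/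
def lineSpace (l : Fin 3 → B) (s : Ambient K B →ₗ[K] (Fin 3 → B)) :
    Submodule K (Ambient K (CD Q (0 : K))) :=
  ((lineSpan Q l).prod ⊤).map (shiftMap Q l s)

theorem mem_lineSpace {l : Fin 3 → B} {s : Ambient K B →ₗ[K] (Fin 3 → B)} {w : Ambient K B}
    {h : Fin 3 → B} : ambientCoord Q (w, h) ∈ lineSpace Q l s ↔
      w ∈ lineSpan Q l ∧ ∃ r : B, h = s w + r • l := by
  constructor
  · rintro ⟨⟨w', r⟩, ⟨hw', -⟩, heq⟩
    have := ambientCoord_injective Q heq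
    have h1 : w' = w := congrArg Prod.fst this
    have h2 : s w' + r • l = h := congrArg Prod.snd this
    subst h1
    exact ⟨hw', r, h2.symm⟩
  · rintro ⟨hw, r, rfl⟩
    exact ⟨(w, r), ⟨hw, trivial⟩, rfl⟩

variable {Q}

/-- For normalized `x`, `s (x x*)` is itself a cross product with `x`, namely that of the point of
the line with `r = 0`. This is what puts the whole cone inside `X`. -/
theorem LineShift.dotProduct_eq_zero {ℓ : Fin 3 → CD Q (0 : K)} {l : Fin 3 → B}
    {s : Ambient K B →ₗ[K] (Fin 3 → B)} (H : LineShift Q ℓ l s) {x : Fin 3 → B} (hx : x ≠ 0)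
    (hl : l ⬝ᵥ x = 0) : s (veroneseVec Q x) ⬝ᵥ x = 0 := by
  obtain ⟨y, a, ha, hy, rfl⟩ := exists_normalized hx
  rw [dotProduct_right_mul, mul_eq_zero, or_iff_left ha] at hl
  obtain ⟨c, hc, -, hcr⟩ := H.exists_incident y hy hl 0
  rw [zero_smul, add_zero] at hcr
  rw [veroneseVec_right_mul, map_smul, dotProduct_right_mul, smul_row_dotProduct, ← hcr,
    crossRow_dotProduct hc, smul_zero, zero_mul]

theorem LineShift.pspan_eq {ℓ : Fin 3 → CD Q (0 : K)} {l : Fin 3 → B}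
    {s : Ambient K B →ₗ[K] (Fin 3 → B)} (H : LineShift Q ℓ l s) :
    pspan (veroneseImage (cdStructure Q 0) (tSet Q) {p | Incident p ℓ}) = lineSpace Q l s := by
  apply le_antisymm
  · apply pspan_le
    rintro _ ⟨p, hp, hi, h0, rfl⟩
    obtain ⟨x, c, rfl⟩ : ∃ x c, p = cdRow Q x c := ⟨_, _, (cdRow_eta Q p).symm⟩
    rw [cdRow_mem_geomPoints] at hp
    obtain ⟨hl, r, hr⟩ := H.of_incident x c hp hi
    rw [mk_mem_pts, veroneseVec_cdRow, mem_lineSpace]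
    exact ⟨(veroneseVec_mem_lineSpan_iff Q hp.ne_zero).2 hl, r, hr⟩
  · set Z := pspan (veroneseImage (cdStructure Q 0) (tSet Q) {p | Incident p ℓ}) with hZ
    have key : ∀ x : Fin 3 → B, x ≠ 0 → l ⬝ᵥ x = 0 → ∀ r : B,
        ambientCoord Q (veroneseVec Q x, s (veroneseVec Q x) + r • l) ∈ Z := by
      intro x hx hl r
      obtain ⟨y, a, ha, hy, rfl⟩ := exists_normalized hx
      rw [dotProduct_right_mul, mul_eq_zero, or_iff_left ha] at hl
      have hN : Q.norm a ≠ 0 := mt Q.norm_eq_zero.1 ha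
      obtain ⟨c, hc, hi, hcr⟩ := H.exists_incident y hy hl ((Q.norm a)⁻¹ • r)
      change pointVec Q _ _ ∈ Z
      rw [pointVec_right_mul Q ha, veroneseVec_right_mul, map_smul, smul_add, smul_smul,
        inv_mul_cancel₀ hN, one_smul, ← smul_assoc, ← hcr, pointVec, ← veroneseVec_cdRow]
      apply Z.smul_mem
      have h0 : veroneseVec (cdStructure Q 0) (cdRow Q y c) ≠ 0 := by
        rw [veroneseVec_cdRow]; exact pointVec_ne_zero Q hc.ne_zero _
      exact mk_mem_pspan h0 ⟨_, (cdRow_mem_geomPoints Q).2 hc, hi, h0, rfl⟩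
    have hbase : ∀ w ∈ lineSpan Q l, shiftMap Q l s (w, 0) ∈ Z := by
      intro w hw
      have : lineSpan Q l ≤ Z.comap ((shiftMap Q l s).comp (LinearMap.inl K _ B)) := by
        rw [lineSpan, Submodule.span_le]
        rintro _ ⟨x, hx, hl, rfl⟩
        exact key x hx hl 0
      exact this hw
    -- Two points of the line over the same `e` differ by a vector of the vertex.
    have hvert : ∀ r : B, shiftMap Q l s (0, r) ∈ Z := by
      intro r
      obtain ⟨e, f, g, h, F⟩ := exists_frame H.ne_zero
      have h1 := key e F.e_ne_zero F.le r
      have h2 := key e F.e_ne_zero F.le 0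
      have := sub_mem h1 h2
      rw [← shiftMap_apply, ← shiftMap_apply, ← map_sub, Prod.mk_sub_mk, sub_self, sub_zero] at this
      exact this
    rintro _ ⟨⟨w, r⟩, ⟨hw, -⟩, rfl⟩
    have : shiftMap Q l s (w, r) = shiftMap Q l s (w, 0) + shiftMap Q l s (0, r) := by
      rw [← map_add, Prod.mk_add_mk, add_zero, zero_add]
    rw [this]
    exact add_mem (hbase w hw) (hvert r)

variable (Q)

theorem veroneseSpaces_cd : veroneseSpaces (cdStructure Q 0) (tSet Q) =
    {ξ | ∃ ℓ ∈ geomLines (tSet Q), ∃ l s, LineShift Q ℓ l s ∧ ξ = lineSpace Q l s} := by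
  ext ξ
  constructor
  · rintro ⟨ℓ, hℓ, rfl⟩
    obtain ⟨l, s, H⟩ := exists_lineShift Q hℓ
    exact ⟨ℓ, hℓ, l, s, H, H.pspan_eq⟩
  · rintro ⟨ℓ, hℓ, l, s, H, rfl⟩
    exact ⟨ℓ, hℓ, H.pspan_eq.symm⟩

theorem incident_iff {l p : Fin 3 → B} : Incident p l ↔ l ⬝ᵥ p = 0 := by
  rw [Incident, dotProduct, Fin.sum_univ_three]

theorem lineSpan_smul {l : Fin 3 → B} {a : B} (ha : a ≠ 0) :
    lineSpan Q (a • l) = lineSpan Q l := by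
  simp only [lineSpan, smul_dotProduct, smul_eq_zero, ha, false_or]

theorem veroneseSpaces_base : veroneseSpaces Q {0} = {ξ | ∃ l, l ≠ 0 ∧ ξ = lineSpan Q l} := by
  have key : ∀ l : Fin 3 → B, pspan (veroneseImage Q {0} {p | Incident p l}) = lineSpan Q l := by
    intro l
    apply le_antisymm
    · apply pspan_le
      rintro _ ⟨p, hp, hi, h0, rfl⟩
      rw [mk_mem_pts, veroneseVec_mem_lineSpan_iff Q (mem_geomPoints_zero.1 hp).ne_zero]
      exact incident_iff.1 hi
    · rw [lineSpan, Submodule.span_le]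
      rintro _ ⟨x, hx, hl, rfl⟩
      obtain ⟨y, a, ha, hy, rfl⟩ := exists_normalized hx
      rw [dotProduct_right_mul, mul_eq_zero, or_iff_left ha] at hl
      rw [veroneseVec_right_mul]
      apply Submodule.smul_mem
      have h0 := veroneseVec_ne_zero Q hy.ne_zero
      exact mk_mem_pspan h0 ⟨y, mem_geomPoints_zero.2 hy, incident_iff.2 hl, h0, rfl⟩
  ext ξ
  constructor
  · rintro ⟨l, hl, rfl⟩
    exact ⟨l, geomLines_ne_zero hl, key l⟩
  · rintro ⟨l, hl, rfl⟩
    obtain ⟨r, l', hr, rfl, hl'⟩ := exists_normalized_line hl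
    exact ⟨l', hl', by rw [lineSpan_smul Q hr, key]⟩

/-! ### The tubes -/

/-- The parametrization of `lineSpace Q l s` with respect to the points `e`, `f` of the line. -/
def tubeMap (l e f : Fin 3 → B) (s : Ambient K B →ₗ[K] (Fin 3 → B)) :
    ((K × K × B) × B) →ₗ[K] Ambient K (CD Q (0 : K)) :=
  (shiftMap Q l s).comp ((lineParam Q e f).prodMap LinearMap.id)

theorem tubeMap_apply (l e f : Fin 3 → B) (s : Ambient K B →ₗ[K] (Fin 3 → B)) (m : K × K × B)
    (r : B) : tubeMap Q l e f s (m, r) =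
      ambientCoord Q (lineParam Q e f m, s (lineParam Q e f m) + r • l) := rfl

variable {Q} {l e f g h : Fin 3 → B} {s : Ambient K B →ₗ[K] (Fin 3 → B)}

theorem LineFrame.tubeMap_injective (F : LineFrame l e f g h) (hl : l ≠ 0) :
    Function.Injective (tubeMap Q l e f s) := by
  rw [← LinearMap.ker_eq_bot, LinearMap.ker_eq_bot']
  rintro ⟨m, r⟩ h
  rw [tubeMap_apply, ambientCoord_eq_zero] at h
  have h1 : lineParam Q e f m = 0 := congrArg Prod.fst h
  have h2 : s (lineParam Q e f m) + r • l = 0 := congrArg Prod.snd h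
  rw [h1, map_zero, zero_add, smul_eq_zero, or_iff_left hl] at h2
  rw [h2, F.lineParam_injective Q (h1.trans (map_zero _).symm)]
  rfl

theorem LineFrame.range_tubeMap (F : LineFrame l e f g h) :
    LinearMap.range (tubeMap Q l e f s) = lineSpace Q l s := by
  rw [lineSpace, F.lineSpan_eq Q, tubeMap, LinearMap.range_comp, LinearMap.range_prodMap,
    LinearMap.range_id]

theorem tubeVertex_tubeMap :
    tubeVertex (tubeMap Q l e f s) = rowSpace Q (Submodule.span B {l}) := by
  ext v
  rw [mem_rowSpace_span]
  have : ∀ r : B, (tubeMap Q l e f s).comp (LinearMap.inr K (K × K × B) B) r =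
      ambientCoord Q (0, r • l) := by
    intro r
    change tubeMap Q l e f s (0, r) = _
    rw [tubeMap_apply, map_zero, map_zero, zero_add]
  constructor
  · rintro ⟨r, rfl⟩; exact ⟨r, this r⟩
  · rintro ⟨r, rfl⟩; exact ⟨r, this r⟩

/-- Every point of the quadric comes from a point of the line: for `t ≠ 0` the choice `a = y`, `b =
t` gives `(N y, t², t y) = t (x, t, y)`. -/
theorem exists_eq_smul_of_hyperbolicForm_eq_zero {m : K × K × B} (hm : m ≠ 0)
    (hq : hyperbolicForm Q.norm m = 0) : ∃ (k : K) (a b : B), k ≠ 0 ∧ (a ≠ 0 ∨ b ≠ 0) ∧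
      m = k • (Q.norm a, Q.norm b, a * Q.conj b) := by
  obtain ⟨x, t, y⟩ := m
  rw [hyperbolicForm_apply, sub_eq_zero] at hq
  replace hq : x * t = Q.norm y := hq
  by_cases ht : t = 0
  · subst ht
    rw [mul_zero, eq_comm, Q.norm_eq_zero] at hq
    subst hq
    refine ⟨x, 1, 0, ?_, Or.inl one_ne_zero, ?_⟩
    · rintro rfl; exact hm rfl
    · simp [Q.norm_one]
  · refine ⟨t⁻¹, y, t • 1, inv_ne_zero ht, Or.inr (by simpa using ht), ?_⟩
    rw [Q.norm_smul, Q.norm_one, map_smul, Q.conj_one, ← hq]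
    refine Prod.ext ?_ (Prod.ext ?_ ?_)
    · simp only [Prod.smul_mk, smul_eq_mul]; field_simp
    · simp [ht]
    · simp [ht]

theorem LineFrame.rcomb_ne_zero (F : LineFrame l e f g h) {a b : B} (hab : a ≠ 0 ∨ b ≠ 0) :
    rcomb e f a b ≠ 0 := by
  intro h0
  have h1 := dotProduct_rcomb g e f a b
  have h2 := dotProduct_rcomb h e f a b
  rw [h0, dotProduct_zero, F.ge, F.gf, one_mul, zero_mul, add_zero] at h1
  rw [h0, dotProduct_zero, F.he, F.hf, one_mul, zero_mul, zero_add] at h2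
  rcases hab with h | h
  · exact h h1.symm
  · exact h h2.symm

theorem LineFrame.exists_lineParam_eq_smul (F : LineFrame l e f g h) {m : K × K × B} (hm : m ≠ 0)
    (hq : hyperbolicForm Q.norm m = 0) : ∃ (k : K) (x : Fin 3 → B), k ≠ 0 ∧ x ≠ 0 ∧ l ⬝ᵥ x = 0 ∧
      lineParam Q e f m = k • veroneseVec Q x := by
  obtain ⟨k, a, b, hk, hab, rfl⟩ := exists_eq_smul_of_hyperbolicForm_eq_zero hm hq
  refine ⟨k, rcomb e f a b, hk, F.rcomb_ne_zero hab, ?_, ?_⟩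
  · rw [dotProduct_rcomb, F.le, F.lf, zero_mul, zero_mul, add_zero]
  · rw [map_smul, veroneseVec_rcomb]

theorem LineFrame.hyperbolicForm_eq_zero (F : LineFrame l e f g h) {m : K × K × B} {k : K}
    {x : Fin 3 → B} (hx : l ⬝ᵥ x = 0) (hm : lineParam Q e f m = k • veroneseVec Q x) :
    hyperbolicForm Q.norm m = 0 := by
  rw [F.exists_rcomb hx, veroneseVec_rcomb, ← map_smul] at hm
  rw [F.lineParam_injective Q hm, QuadraticMap.map_smul, hyperbolicForm_apply]
  simp [Q.norm_mul, Q.norm_conj]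

/-- A point `(x x*, h)` of `X` in the span has `x` on `l` and `h` in `s (x x*) + B l`. Conversely
each such `h` annihilates `x`, so no part of the cone is missed. -/
theorem LineShift.inter_pts {ℓ : Fin 3 → CD Q (0 : K)} (H : LineShift Q ℓ l s)
    (F : LineFrame l e f g h) :
    veronesePoints (cdStructure Q 0) (tSet Q) ∩ pts (lineSpace Q l s) =
      tubeSet Q.norm (tubeMap Q l e f s) := by
  ext P
  constructor
  · rintro ⟨hP, hPξ⟩
    obtain ⟨x, c, hx, hc, hPs⟩ := (mem_veronesePoints_cd Q).1 hP
    rw [pts, Set.mem_ofPred_eq, hPs, Submodule.span_singleton_le_iff_mem, pointVec,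
      mem_lineSpace] at hPξ
    obtain ⟨hxl, r, rfl⟩ := hPξ
    have hw := hxl
    rw [F.lineSpan_eq Q] at hw
    obtain ⟨m, hm⟩ := hw
    refine ⟨m, r, ?_, ?_, ?_⟩
    · rintro rfl
      exact veroneseVec_ne_zero Q hx (by rw [← hm, map_zero])
    · exact F.hyperbolicForm_eq_zero ((veroneseVec_mem_lineSpan_iff Q hx).1 hxl)
        (k := 1) (hm.trans (one_smul _ _).symm)
    · rw [hPs, tubeMap_apply, hm]; rfl
  · rintro ⟨m, r, hm, hq, hP⟩
    obtain ⟨k, x, hk, hx, hl, hmx⟩ := F.exists_lineParam_eq_smul hm hq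
    have heq : tubeMap Q l e f s (m, r) =
        k • pointVec Q x (s (veroneseVec Q x) + (k⁻¹ • r) • l) := by
      rw [tubeMap_apply, hmx, pointVec, ← map_smul (ambientCoord Q)]
      congr 1
      refine Prod.ext rfl ?_
      change _ = k • (s (veroneseVec Q x) + (k⁻¹ • r) • l)
      rw [map_smul, smul_add, smul_assoc, smul_smul, mul_inv_cancel₀ hk, one_smul]
    rw [heq, Submodule.span_singleton_smul_eq (IsUnit.mk0 _ hk)] at hP
    refine ⟨(mem_veronesePoints_cd Q).2 ⟨x, _, hx, ?_, hP⟩, ?_⟩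
    · rw [add_dotProduct, H.dotProduct_eq_zero hx hl, smul_dotProduct, hl, smul_zero, add_zero]
    · rw [pts, Set.mem_ofPred_eq, hP, Submodule.span_singleton_le_iff_mem, pointVec, mem_lineSpace]
      exact ⟨(veroneseVec_mem_lineSpan_iff Q hx).2 hl, _, rfl⟩

theorem LineShift.isTubeVertex_iff {ℓ : Fin 3 → CD Q (0 : K)} (H : LineShift Q ℓ l s)
    {V : Submodule K (Ambient K (CD Q (0 : K)))} :
    IsTubeVertex (lineSpace Q l s)
      (veronesePoints (cdStructure Q 0) (tSet Q) ∩ pts (lineSpace Q l s)) V ↔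
    V = rowSpace Q (Submodule.span B {l}) := by
  obtain ⟨e, f, g, h, F⟩ := exists_frame H.ne_zero
  have hN : ∀ b, Q.norm b = 0 → b = 0 := fun b => Q.norm_eq_zero.1
  have hinj := F.tubeMap_injective (Q := Q) (s := s) H.ne_zero
  rw [H.inter_pts F, ← F.range_tubeMap, ← tubeVertex_tubeMap (Q := Q) (e := e) (f := f) (s := s)]
  constructor
  · rintro ⟨W, O, h⟩
    exact h.vertex_eq hN Q.norm_one hinj
  · rintro rfl
    exact isTube_tubeSet hN hinj

theorem LineShift.isTube {ℓ : Fin 3 → CD Q (0 : K)} (H : LineShift Q ℓ l s)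
    {V W : Submodule K (Ambient K (CD Q (0 : K)))} {O : Set (ℙ K (Ambient K (CD Q (0 : K))))}
    (hT : IsTube (lineSpace Q l s) V W O
      (veronesePoints (cdStructure Q 0) (tSet Q) ∩ pts (lineSpace Q l s))) :
    Module.rank K V = Cardinal.lift.{u} (Module.rank K B) ∧
      Module.rank K W = Cardinal.lift.{u} (Module.rank K B) + 2 ∧ IsWittIndexOneQuadric W O := by
  have hV := H.isTubeVertex_iff.1 ⟨W, O, hT⟩
  obtain ⟨e, f, g, h, F⟩ := exists_frame H.ne_zero
  have hN : ∀ b, Q.norm b = 0 → b = 0 := fun b => Q.norm_eq_zero.1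
  have hinj := F.tubeMap_injective (Q := Q) (s := s) H.ne_zero
  rw [H.inter_pts F, ← F.range_tubeMap] at hT
  obtain ⟨⟨E⟩, hO⟩ := hT.base_param hN Q.norm_one hinj
  refine ⟨?_, ?_, hO⟩
  · rw [hV, rank_rowSpace, finrank_span_singleton H.ne_zero, Nat.cast_one, one_mul]
  · rw [← E.rank_eq, rank_lineModel]

end Subspaces

/-! ### The plane of vertices and the sections with the complement. -/

section Plane

variable {K : Type u} {B : Type v} [Field K] [DivisionRing B] [Algebra K B]
  (Q : QuadraticStructure K B)

/-! ### The spread of vertices -/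

theorem exists_eq_span {U : Submodule B (Fin 3 → B)} (hU : Module.finrank B U = 1) :
    ∃ l : Fin 3 → B, l ≠ 0 ∧ U = Submodule.span B {l} := by
  have hbot : U ≠ ⊥ := by rintro rfl; simp at hU
  obtain ⟨l, hlU, hl⟩ := U.ne_bot_iff.1 hbot
  refine ⟨l, hl, (Submodule.eq_of_le_of_finrank_eq ?_ ?_).symm⟩
  · rwa [Submodule.span_singleton_le_iff_mem]
  · rw [finrank_span_singleton hl, hU]

theorem finrank_sup_eq_two {U V : Submodule B (Fin 3 → B)} (hU : Module.finrank B U = 1)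
    (hV : Module.finrank B V = 1) (hUV : U ≠ V) :
    Module.finrank B ↥(U ⊔ V) = 2 := by
  have h := Submodule.finrank_sup_add_finrank_inf_eq U V
  have h0 : Module.finrank B ↥(U ⊓ V) = 0 := by
    by_contra hne
    have hle : Module.finrank B ↥(U ⊓ V) ≤ Module.finrank B U :=
      Submodule.finrank_mono inf_le_left
    have e1 : U ⊓ V = U := Submodule.eq_of_le_of_finrank_eq inf_le_left (by omega)
    have e2 : U ⊓ V = V := Submodule.eq_of_le_of_finrank_eq inf_le_right (by omega)
    exact hUV (e1.symm.trans e2)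
  omega

/-- The vertex depends on the underlying line `l` only, not on the shift, and every `l` occurs with
shift zero. -/
theorem vertices_eq : {V | ∃ ξ ∈ veroneseSpaces (cdStructure Q 0) (tSet Q),
      IsTubeVertex ξ (veronesePoints (cdStructure Q 0) (tSet Q) ∩ pts ξ) V} =
    rowSpace Q '' {U | Module.finrank B U = 1} := by
  ext V
  constructor
  · rintro ⟨ξ, hξ, hV⟩
    rw [veroneseSpaces_cd] at hξ
    obtain ⟨ℓ, hℓ, l, s, H, rfl⟩ := hξ
    exact ⟨_, finrank_span_singleton H.ne_zero, (H.isTubeVertex_iff.1 hV).symm⟩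
  · rintro ⟨U, hU, rfl⟩
    obtain ⟨l, hl, rfl⟩ := exists_eq_span hU
    obtain ⟨ℓ, hℓ, H⟩ := exists_lineShift_zero Q hl
    refine ⟨lineSpace Q l 0, ?_, H.isTubeVertex_iff.2 rfl⟩
    rw [veroneseSpaces_cd]
    exact ⟨ℓ, hℓ, l, 0, H, rfl⟩

theorem spans_eq : {L | ∃ V₁ ∈ rowSpace Q '' {U | Module.finrank B U = 1},
      ∃ V₂ ∈ rowSpace Q '' {U | Module.finrank B U = 1}, V₁ ≠ V₂ ∧ L = V₁ ⊔ V₂} =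
    rowSpace Q '' {U | Module.finrank B U = 2} := by
  ext L
  constructor
  · rintro ⟨_, ⟨U, hU, rfl⟩, _, ⟨V, hV, rfl⟩, hne, rfl⟩
    exact ⟨U ⊔ V, finrank_sup_eq_two hU hV fun h => hne (by rw [h]), rowSpace_sup Q U V⟩
  · rintro ⟨L, hL, rfl⟩
    have hL : Module.finrank B L = 2 := hL
    have hbot : L ≠ ⊥ := by rintro rfl; simp at hL
    obtain ⟨a, haL, ha⟩ := L.ne_bot_iff.1 hbot
    have hle : Submodule.span B {a} ≤ L := by rwa [Submodule.span_singleton_le_iff_mem]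
    have hlt : Submodule.span B {a} < L := lt_of_le_of_ne hle fun h => by
      have := finrank_span_singleton (K := B) ha
      rw [h, hL] at this
      omega
    obtain ⟨b, hbL, hb⟩ := SetLike.exists_of_lt hlt
    have hb0 : b ≠ 0 := by rintro rfl; exact hb (zero_mem _)
    have hab : Submodule.span B {a} ≠ Submodule.span B {b} := fun h =>
      hb (h ▸ Submodule.mem_span_singleton_self b)
    have ha1 : Module.finrank B (Submodule.span B {a}) = 1 := finrank_span_singleton ha
    have hb1 : Module.finrank B (Submodule.span B {b}) = 1 := finrank_span_singleton hb0
    have hsup : Submodule.span B {a} ⊔ Submodule.span B {b} = L := by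
      refine Submodule.eq_of_le_of_finrank_eq
        (sup_le hle (by rwa [Submodule.span_singleton_le_iff_mem])) ?_
      exact (finrank_sup_eq_two ha1 hb1 hab).trans hL.symm
    refine ⟨rowSpace Q (Submodule.span B {a}), ⟨_, ha1, rfl⟩,
      rowSpace Q (Submodule.span B {b}), ⟨_, hb1, rfl⟩, ?_, ?_⟩
    · exact fun h => hab (rowSpace_injective Q h)
    · rw [← rowSpace_sup, hsup]

theorem isIsoToPG2_rowSpace : IsIsoToPG2 B (rowSpace Q '' {U | Module.finrank B U = 1})
    (rowSpace Q '' {U | Module.finrank B U = 2}) :=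
  ⟨Equiv.Set.image (rowSpace Q) {U | Module.finrank B U = 1} (rowSpace_injective Q),
    Equiv.Set.image (rowSpace Q) {U | Module.finrank B U = 2} (rowSpace_injective Q),
    fun _ _ => (rowSpace_le_iff Q).symm⟩

/-- `(a, b) ↦ a g + b h`. -/
def pairMap (K : Type u) {B : Type v} [Field K] [DivisionRing B] [Algebra K B]
    (g h : Fin 3 → B) : (B × B) →ₗ[K] (Fin 3 → B) where
  toFun v := v.1 • g + v.2 • h
  map_add' v v' := by
    rw [Prod.fst_add, Prod.snd_add, add_smul, add_smul, add_add_add_comm]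
  map_smul' k v := by
    rw [Prod.smul_fst, Prod.smul_snd, smul_assoc, smul_assoc, smul_add]; rfl

/-- The embedding `(a, b) ↦ a g + b h` into the ambient space. -/
def pairEmb (g h : Fin 3 → B) : (B × B) →ₗ[K] Ambient K (CD Q (0 : K)) :=
  ((ambientCoord Q).comp (LinearMap.inr K (Ambient K B) (Fin 3 → B))).comp (pairMap K g h)

theorem pairEmb_apply (g h : Fin 3 → B) (a b : B) :
    pairEmb Q g h (a, b) = ambientCoord Q (0, a • g + b • h) := rfl

theorem regulusMember_pairEmb (g h : Fin 3 → B) (w : Fin 2 → K) :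
    regulusMember (pairEmb Q g h) w = rowSpace Q (Submodule.span B {w 1 • g - w 0 • h}) := by
  ext y
  rw [mem_regulusMember, mem_rowSpace_span]
  refine exists_congr fun b => ?_
  rw [transversalMap_apply, pairEmb_apply]
  have : (w 1 • b) • g + -(w 0 • b) • h = b • (w 1 • g - w 0 • h) := by
    rw [smul_sub, smul_comm b, smul_comm b, neg_smul, smul_assoc, smul_assoc, sub_eq_add_neg]
  rw [this]

/-- A non-zero row spans a unique one-dimensional left `B`-subspace, which yields the partition and
the closure under spans. For reguli, coordinates are chosen so that the three members become the
standard ones; all members of the standard regulus are again left `B`-subspaces. -/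
theorem isRegularSpread_rowSpace : IsRegularSpread (Cardinal.lift.{u} (Module.rank K B))
    (rowSpace Q '' {U | Module.finrank B U = 1}) (rowSpace Q ⊤) := by
  refine ⟨?_, ?_, ?_, ?_⟩
  · rintro _ ⟨U, hU, rfl⟩
    have hU : Module.finrank B U = 1 := hU
    refine ⟨(rowSpace_le_iff Q).2 le_top, ?_⟩
    rw [rank_rowSpace, hU, Nat.cast_one, one_mul]
  · intro P hP
    induction P using Projectivization.ind with | h y hy => ?_
    obtain ⟨h, -, rfl⟩ := exists_of_mem_rowSpace Q ((mk_mem_pts hy).1 hP)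
    have hh : h ≠ 0 := by
      rintro rfl
      exact hy (map_zero (ambientCoord Q))
    refine ⟨rowSpace Q (Submodule.span B {h}), ⟨⟨_, finrank_span_singleton hh, rfl⟩, ?_⟩, ?_⟩
    · rw [mk_mem_pts, mem_rowSpace]
      exact ⟨rfl, Submodule.mem_span_singleton_self _⟩
    · rintro _ ⟨⟨U, hU, rfl⟩, hPU⟩
      rw [mk_mem_pts, mem_rowSpace] at hPU
      congr 1
      refine (Submodule.eq_of_le_of_finrank_eq ?_ ?_).symm
      · rw [Submodule.span_singleton_le_iff_mem]; exact hPU.2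
      · rw [finrank_span_singleton hh]; exact hU.symm
  · rintro _ ⟨U₁, h₁, rfl⟩ _ ⟨U₂, h₂, rfl⟩ - _ ⟨U, hU, rfl⟩ hne
    rw [← rowSpace_sup] at hne ⊢
    obtain ⟨v, ⟨hv1, hv2⟩, hv0⟩ := Submodule.ne_bot_iff _ |>.1 hne
    obtain ⟨h, hh, rfl⟩ := exists_of_mem_rowSpace Q hv1
    have hh0 : h ≠ 0 := by
      rintro rfl
      exact hv0 (map_zero (ambientCoord Q))
    have hspan : Submodule.span B {h} = U := by
      refine Submodule.eq_of_le_of_finrank_eq ?_ ?_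
      · rwa [Submodule.span_singleton_le_iff_mem]
      · rw [finrank_span_singleton hh0]; exact hU.symm
    rw [rowSpace_le_iff, ← hspan, Submodule.span_singleton_le_iff_mem]
    exact ((mem_rowSpace Q).1 hv2).2
  · rintro _ ⟨U₁, h₁, rfl⟩ _ ⟨U₂, h₂, rfl⟩ _ ⟨U₃, h₃, rfl⟩ h12 h13 h23 hle
    obtain ⟨x, hx, rfl⟩ := exists_eq_span h₁
    obtain ⟨y, hy, rfl⟩ := exists_eq_span h₂
    obtain ⟨z, hz, rfl⟩ := exists_eq_span h₃
    rw [← rowSpace_sup, rowSpace_le_iff, Submodule.span_singleton_le_iff_mem] at hle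
    obtain ⟨_, hx', _, hy', hzxy⟩ := Submodule.mem_sup.1 hle
    obtain ⟨a, rfl⟩ := Submodule.mem_span_singleton.1 hx'
    obtain ⟨b, rfl⟩ := Submodule.mem_span_singleton.1 hy'
    have ha : a ≠ 0 := by
      rintro rfl
      rw [zero_smul, zero_add] at hzxy
      have hb : b ≠ 0 := by rintro rfl; exact hz (by rw [← hzxy, zero_smul])
      apply h23
      rw [← hzxy, Submodule.span_singleton_smul_eq (IsUnit.mk0 b hb)]
    have hb : b ≠ 0 := by
      rintro rfl
      rw [zero_smul, add_zero] at hzxy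
      apply h13
      rw [← hzxy, Submodule.span_singleton_smul_eq (IsUnit.mk0 a ha)]
    have hspan : Submodule.span B {x} ≠ Submodule.span B {y} := fun h => h12 (by rw [h])
    have hind : ∀ p q : B, p • x + q • y = 0 → p = 0 ∧ q = 0 := by
      intro p q hpq
      have hq : q = 0 := by
        by_contra hq
        have hp : p ≠ 0 := by
          rintro rfl
          rw [zero_smul, zero_add, smul_eq_zero] at hpq
          exact hpq.elim hq hy
        apply hspan
        rw [← Submodule.span_singleton_smul_eq (IsUnit.mk0 p hp), eq_neg_of_add_eq_zero_left hpq,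
          ← neg_smul, Submodule.span_singleton_smul_eq (IsUnit.mk0 (-q) (neg_ne_zero.2 hq))]
      rw [hq, zero_smul, add_zero, smul_eq_zero] at hpq
      exact ⟨hpq.resolve_right hx, hq⟩
    -- With `g = b y` and `h = -a x`, the parameters `(1, 0)`, `(0, 1)`, `(1, 1)` give `B x`, `B y`
    -- and `B (a x + b y) = B z`.
    have hj : Function.Injective (pairEmb Q (b • y) (-(a • x))) := by
      rw [← LinearMap.ker_eq_bot, LinearMap.ker_eq_bot']
      rintro ⟨p, q⟩ hpq
      rw [pairEmb_apply, ambientCoord_eq_zero] at hpq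
      have h0 : p • b • y + q • -(a • x) = 0 := congrArg Prod.snd hpq
      obtain ⟨h3, h4⟩ := hind (-(q * a)) (p * b) (by
        rw [← h0, neg_smul, mul_smul, mul_smul, smul_neg, add_comm])
      rw [neg_eq_zero, mul_eq_zero, or_iff_left ha] at h3
      rw [mul_eq_zero, or_iff_left hb] at h4
      rw [h3, h4]; rfl
    have e1 : rowSpace Q (Submodule.span B {x}) =
        regulusMember (pairEmb Q (b • y) (-(a • x))) ![(1 : K), 0] := by
      rw [regulusMember_pairEmb]
      simp [Submodule.span_singleton_smul_eq (IsUnit.mk0 a ha)]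
    have e2 : rowSpace Q (Submodule.span B {y}) =
        regulusMember (pairEmb Q (b • y) (-(a • x))) ![(0 : K), 1] := by
      rw [regulusMember_pairEmb]
      simp [Submodule.span_singleton_smul_eq (IsUnit.mk0 b hb)]
    have e3 : rowSpace Q (Submodule.span B {z}) =
        regulusMember (pairEmb Q (b • y) (-(a • x))) ![(1 : K), 1] := by
      rw [regulusMember_pairEmb, ← hzxy]
      simp [add_comm]
    rw [e1, e2, e3, regulus_eq hj]
    rintro _ ⟨w, hw, rfl⟩
    rw [regulusMember_pairEmb]
    refine ⟨_, finrank_span_singleton fun h0 => hw ?_, rfl⟩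
    apply transversalMap_injective hj one_ne_zero
    rw [map_zero, transversalMap_apply, pairEmb_apply, ambientCoord_eq_zero]
    have : (w 1 • (1 : B)) • b • y + -(w 0 • (1 : B)) • -(a • x) =
        w 1 • b • y - w 0 • -(a • x) := by
      rw [neg_smul, smul_assoc, smul_assoc, one_smul, one_smul, sub_eq_add_neg]
    rw [this, h0]; rfl

/-! ### The complementary space -/

theorem isCompl_rowSpace_baseEmb : IsCompl (rowSpace Q ⊤) (LinearMap.range (baseEmb Q)) := by
  constructor
  · rw [disjoint_iff, eq_bot_iff]
    rintro v ⟨h1, h2⟩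
    obtain ⟨h, -, rfl⟩ := exists_of_mem_rowSpace Q h1
    have := (mem_range_baseEmb Q).1 h2
    subst this
    rw [Submodule.mem_bot]
    exact map_zero (ambientCoord Q)
  · rw [codisjoint_iff, eq_top_iff]
    intro v _
    obtain ⟨⟨w, h⟩, rfl⟩ := ambientCoord_surjective Q v
    have : ambientCoord Q (w, h) = ambientCoord Q (0, h) + ambientCoord Q (w, 0) := by
      rw [← map_add, Prod.mk_add_mk, add_zero, zero_add]
    rw [this]
    exact Submodule.add_mem_sup ((mem_rowSpace Q).2 ⟨rfl, trivial⟩) ⟨w, rfl⟩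

theorem mem_map_baseEmb {L : Submodule K (Ambient K B)} {w : Ambient K B} {h : Fin 3 → B} :
    ambientCoord Q (w, h) ∈ L.map (baseEmb Q) ↔ w ∈ L ∧ h = 0 := by
  constructor
  · rintro ⟨w', hw', heq⟩
    have := ambientCoord_injective Q heq
    have h1 : w' = w := congrArg Prod.fst this
    have h2 : 0 = h := congrArg Prod.snd this
    exact ⟨h1 ▸ hw', h2.symm⟩
  · rintro ⟨hw, rfl⟩
    exact ⟨w, hw, rfl⟩

/-- Joining with all rows erases the shift, so the projection depends on `l` alone. -/
theorem lineSpace_sup_inf (l : Fin 3 → B) (s : Ambient K B →ₗ[K] (Fin 3 → B)) :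
    (lineSpace Q l s ⊔ rowSpace Q ⊤) ⊓ LinearMap.range (baseEmb Q) =
      (lineSpan Q l).map (baseEmb Q) := by
  apply le_antisymm
  · rintro _ ⟨h1, ⟨w, rfl⟩⟩
    refine ⟨w, ?_, rfl⟩
    obtain ⟨a, ha, b, hb, hab⟩ := Submodule.mem_sup.1 h1
    obtain ⟨⟨wa, ha'⟩, rfl⟩ := ambientCoord_surjective Q a
    obtain ⟨h, -, rfl⟩ := exists_of_mem_rowSpace Q hb
    rw [← map_add] at hab
    have : wa + 0 = w := congrArg Prod.fst (ambientCoord_injective Q hab)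
    rw [add_zero] at this
    subst this
    exact ((mem_lineSpace Q).1 ha).1
  · rintro _ ⟨w, hw, rfl⟩
    refine ⟨?_, w, rfl⟩
    have : baseEmb Q w = ambientCoord Q (w, s w) + ambientCoord Q (0, -s w) := by
      rw [← map_add, Prod.mk_add_mk, add_zero, add_neg_cancel]; rfl
    rw [this]
    exact Submodule.add_mem_sup ((mem_lineSpace Q).2 ⟨hw, 0, by rw [zero_smul, add_zero]⟩)
      ((mem_rowSpace Q).2 ⟨rfl, trivial⟩)

theorem lineSpace_zero_inf (l : Fin 3 → B) :
    lineSpace Q l 0 ⊓ LinearMap.range (baseEmb Q) = (lineSpan Q l).map (baseEmb Q) := by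
  apply le_antisymm
  · rw [← lineSpace_sup_inf Q l 0]
    exact inf_le_inf_right _ le_sup_left
  · rintro _ ⟨w, hw, rfl⟩
    exact ⟨(mem_lineSpace Q).2 ⟨hw, 0, by rw [zero_smul, add_zero]; rfl⟩, w, rfl⟩

theorem rank_map_lineSpan {l : Fin 3 → B} (hl : l ≠ 0) :
    Module.rank K ((lineSpan Q l).map (baseEmb Q)) =
      Cardinal.lift.{u} (Module.rank K B) + 2 := by
  obtain ⟨e, f, g, h, F⟩ := exists_frame hl
  rw [F.lineSpan_eq Q, ← LinearMap.range_comp, ← rank_lineModel (K := K) (B := B)]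
  have hinj : Function.Injective ((baseEmb Q).comp (lineParam Q e f)) :=
    (baseEmb_injective Q).comp (F.lineParam_injective Q)
  exact (LinearEquiv.ofInjective _ hinj).rank_eq.symm

variable {Q}

/-- The field `proper` leaves two cases: shift zero, where the section is the full line span, or an
embedding of the section into `K × K`. The second would give `d + 2 ≤ 2`, impossible since `d ≥ 1`,
also for infinite `d`. -/
theorem LineShift.inf_eq_of_rank {ℓ : Fin 3 → CD Q (0 : K)} {l : Fin 3 → B}
    {s : Ambient K B →ₗ[K] (Fin 3 → B)} (H : LineShift Q ℓ l s)
    (hr : Module.rank K ↥(lineSpace Q l s ⊓ LinearMap.range (baseEmb Q)) =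
      Cardinal.lift.{u} (Module.rank K B) + 2) :
    lineSpace Q l s ⊓ LinearMap.range (baseEmb Q) = (lineSpan Q l).map (baseEmb Q) := by
  rcases H.proper with rfl | ⟨π, hπ⟩
  · exact lineSpace_zero_inf Q l
  · exfalso
    let φ : ↥(lineSpace Q l s ⊓ LinearMap.range (baseEmb Q)) →ₗ[K] (K × K) :=
      (π.comp (baseProj Q)).comp (Submodule.subtype _)
    have hφ : Function.Injective φ := by
      rw [← LinearMap.ker_eq_bot, LinearMap.ker_eq_bot']
      rintro ⟨_, h1, w, rfl⟩ h0
      have h0 : π w = 0 := h0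
      obtain ⟨hw, r, hr⟩ := (mem_lineSpace Q).1 h1
      have hrow : lineSpan Q l ≤ LinearMap.ker (rowMul Q l) := by
        rw [lineSpan, Submodule.span_le]
        rintro _ ⟨y, hy, hly, rfl⟩
        exact (rowMul_veroneseVec_eq_zero_iff Q hy).2 hly
      have := hπ w (hrow hw) ⟨-r, by
        rw [neg_smul, eq_neg_iff_add_eq_zero]; exact hr.symm⟩ h0
      subst this
      exact Subtype.ext (map_zero (baseEmb Q))
    have hle := LinearMap.lift_rank_le_of_injective φ hφ
    rw [hr, rank_prod] at hle
    have h1 : (1 : Cardinal.{max u v}) ≤ Cardinal.lift.{u} (Module.rank K B) := by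
      rw [Cardinal.one_le_iff_ne_zero, Ne, Cardinal.lift_eq_zero, rank_zero_iff]
      exact not_subsingleton B
    have h2 : (2 + 1 : Cardinal.{max u v}) ≤ Cardinal.lift.{u} (Module.rank K B) + 2 := by
      rw [add_comm]; gcongr
    have h3 : ((3 : ℕ) : Cardinal.{max u v}) ≤ ((2 : ℕ) : Cardinal.{max u v}) := by
      calc ((3 : ℕ) : Cardinal.{max u v}) = 2 + 1 := by norm_num
        _ ≤ Cardinal.lift.{u} (Module.rank K B) + 2 := h2
        _ = Cardinal.lift.{u, max u v} (Cardinal.lift.{u} (Module.rank K B) + 2) :=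
          (Cardinal.lift_id'.{u, max u v} _).symm
        _ ≤ _ := hle
        _ = _ := by simp; norm_num
    rw [Nat.cast_le] at h3
    omega

variable (Q)

theorem trace_spaces_eq : {η | ∃ ξ ∈ veroneseSpaces (cdStructure Q 0) (tSet Q),
      η = (ξ ⊔ rowSpace Q ⊤) ⊓ LinearMap.range (baseEmb Q)} =
    {η | ∃ l : Fin 3 → B, l ≠ 0 ∧ η = (lineSpan Q l).map (baseEmb Q)} := by
  ext η
  rw [veroneseSpaces_cd]
  constructor
  · rintro ⟨_, ⟨ℓ, hℓ, l, s, H, rfl⟩, rfl⟩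
    exact ⟨l, H.ne_zero, lineSpace_sup_inf Q l s⟩
  · rintro ⟨l, hl, rfl⟩
    obtain ⟨ℓ, hℓ, H⟩ := exists_lineShift_zero Q hl
    exact ⟨_, ⟨ℓ, hℓ, l, 0, H, rfl⟩, (lineSpace_sup_inf Q l 0).symm⟩

theorem section_spaces_eq : {η | ∃ ξ ∈ veroneseSpaces (cdStructure Q 0) (tSet Q),
      η = ξ ⊓ LinearMap.range (baseEmb Q) ∧
      Module.rank K η = Cardinal.lift.{u} (Module.rank K B) + 2} =
    {η | ∃ l : Fin 3 → B, l ≠ 0 ∧ η = (lineSpan Q l).map (baseEmb Q)} := by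
  ext η
  rw [veroneseSpaces_cd]
  constructor
  · rintro ⟨_, ⟨ℓ, hℓ, l, s, H, rfl⟩, rfl, hr⟩
    exact ⟨l, H.ne_zero, H.inf_eq_of_rank hr⟩
  · rintro ⟨l, hl, rfl⟩
    obtain ⟨ℓ, hℓ, H⟩ := exists_lineShift_zero Q hl
    exact ⟨_, ⟨ℓ, hℓ, l, 0, H, rfl⟩, (lineSpace_zero_inf Q l).symm, rank_map_lineSpan Q hl⟩

theorem mem_section_points {P : ℙ K (Ambient K (CD Q (0 : K)))} :
    P ∈ veronesePoints (cdStructure Q 0) (tSet Q) ∩ pts (LinearMap.range (baseEmb Q)) ↔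
      ∃ x, x ≠ 0 ∧ P.submodule = Submodule.span K {pointVec Q x 0} := by
  constructor
  · rintro ⟨h1, h2⟩
    obtain ⟨x, h, hx, -, hP⟩ := (mem_veronesePoints_cd Q).1 h1
    rw [pts, Set.mem_ofPred_eq, hP, Submodule.span_singleton_le_iff_mem, pointVec,
      mem_range_baseEmb] at h2
    subst h2
    exact ⟨x, hx, hP⟩
  · rintro ⟨x, hx, hP⟩
    refine ⟨(mem_veronesePoints_cd Q).2 ⟨x, 0, hx, zero_dotProduct x, hP⟩, ?_⟩
    rw [pts, Set.mem_ofPred_eq, hP, Submodule.span_singleton_le_iff_mem]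
    exact ⟨_, rfl⟩

theorem projectivelyEquivalentIn_base : ProjectivelyEquivalentIn (LinearMap.range (baseEmb Q))
    (veronesePoints (cdStructure Q 0) (tSet Q) ∩ pts (LinearMap.range (baseEmb Q)))
    {η | ∃ l : Fin 3 → B, l ≠ 0 ∧ η = (lineSpan Q l).map (baseEmb Q)}
    (veronesePoints Q {0}) (veroneseSpaces Q {0}) := by
  refine ⟨baseEmb Q, baseEmb_injective Q, rfl, ?_, ?_⟩
  · ext P
    rw [mem_section_points]
    constructor
    · rintro ⟨x, hx, hP⟩
      refine ⟨Projectivization.mk K _ (veroneseVec_ne_zero Q hx),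
        (mem_veronesePoints_base Q).2 ⟨x, hx, Projectivization.submodule_mk _ _⟩, ?_⟩
      apply Projectivization.submodule_injective
      rw [hP, Projectivization.map_mk, Projectivization.submodule_mk]
      rfl
    · rintro ⟨P', hP', rfl⟩
      obtain ⟨x, hx, h⟩ := (mem_veronesePoints_base Q).1 hP'
      obtain rfl := eq_mk_of_submodule (veroneseVec_ne_zero Q hx) h
      refine ⟨x, hx, ?_⟩
      rw [Projectivization.map_mk, Projectivization.submodule_mk]
      rfl
  · rw [veroneseSpaces_base]
    ext η
    constructor
    · rintro ⟨l, hl, rfl⟩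
      exact ⟨_, ⟨l, hl, rfl⟩, rfl⟩
    · rintro ⟨_, ⟨l, hl, rfl⟩, rfl⟩
      exact ⟨l, hl, rfl⟩

theorem ambientCoord_mem_pspan {w : Ambient K B} (i : Fin 3) {x : Fin 3 → B} (hx : x ≠ 0)
    (hw : w = veroneseVec Q x) (hi : x i = 0) (b : B) :
    ambientCoord Q (w, Pi.single i b) ∈
      pspan (veronesePoints (cdStructure Q 0) (tSet Q)) := by
  subst hw
  refine mk_mem_pspan (pointVec_ne_zero Q hx _) ((mem_veronesePoints_cd Q).2
    ⟨x, Pi.single i b, hx, ?_, Projectivization.submodule_mk _ _⟩)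
  rw [single_dotProduct, hi, mul_zero]

/-- Differences of points over the same coordinate column give the rows; the columns `eᵢ` and `eᵢ b
+ eⱼ` give the diagonal and off-diagonal parts of the Hermitian matrices. -/
theorem pspan_veronesePoints_cd : pspan (veronesePoints (cdStructure Q 0) (tSet Q)) = ⊤ := by
  set Z := pspan (veronesePoints (cdStructure Q 0) (tSet Q)) with hZ
  have hbase : ∀ x : Fin 3 → B, x ≠ 0 → baseEmb Q (veroneseVec Q x) ∈ Z := fun x hx =>
    mk_mem_pspan (pointVec_ne_zero Q hx 0) ((mem_veronesePoints_cd Q).2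
      ⟨x, 0, hx, zero_dotProduct x, Projectivization.submodule_mk _ _⟩)
  have hrow : ∀ (i : Fin 3) (b : B), ambientCoord Q (0, Pi.single i b) ∈ Z := by
    intro i b
    -- Any column with zero entry at `i` is annihilated by the rows supported at `i`; index `i + 1`
    -- is taken cyclically.
    have hx : (Pi.single (i + 1) 1 : Fin 3 → B) ≠ 0 := by simp
    have h1 := ambientCoord_mem_pspan Q i hx rfl
      (Pi.single_eq_of_ne (by fin_cases i <;> decide) _) b
    have h2 := sub_mem h1 (hbase _ hx)
    rw [baseEmb_apply, ← map_sub, Prod.mk_sub_mk, sub_self, sub_zero] at h2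
    exact h2
  have hspan : ∀ l : Fin 3 → B, ∀ w ∈ lineSpan Q l, baseEmb Q w ∈ Z := by
    intro l w hw
    have : lineSpan Q l ≤ Z.comap (baseEmb Q) := by
      rw [lineSpan, Submodule.span_le]
      rintro _ ⟨x, hx, -, rfl⟩
      exact hbase x hx
    exact this hw
  have hpair : ∀ (i j : Fin 3), i ≠ j → ∀ b : B,
      baseEmb Q (lineParam Q (Pi.single i 1) (Pi.single j 1) (0, 0, b)) ∈ Z := by
    intro i j hij b
    have hi : (Pi.single i 1 : Fin 3 → B) ≠ 0 := by simp
    have hj : (Pi.single j 1 : Fin 3 → B) ≠ 0 := by simp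
    have hx : rcomb (Pi.single i 1) (Pi.single j 1) b (1 : B) ≠ 0 := by
      intro h0
      have := congrFun h0 j
      simp [rcomb, hij.symm] at this
    have h1 := hbase _ hx
    have : lineParam Q (Pi.single i 1) (Pi.single j 1) (0, 0, b) =
        veroneseVec Q (rcomb (Pi.single i 1) (Pi.single j 1) b (1 : B)) -
        Q.norm b • veroneseVec Q (Pi.single i 1) - veroneseVec Q (Pi.single j 1) := by
      rw [veroneseVec_rcomb, lineParam_apply, lineParam_apply, Q.norm_one, Q.conj_one, mul_one]
      module
    rw [this, map_sub, map_sub, map_smul]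
    exact sub_mem (sub_mem h1 (Z.smul_mem _ (hbase _ hi))) (hbase _ hj)
  rw [eq_top_iff]
  intro v _
  obtain ⟨⟨⟨n, w⟩, h⟩, rfl⟩ := ambientCoord_surjective Q v
  have hw : ((n, w) : Ambient K B) =
      n 0 • veroneseVec Q (Pi.single 0 1) + n 1 • veroneseVec Q (Pi.single 1 1) +
      n 2 • veroneseVec Q (Pi.single 2 1) +
      lineParam Q (Pi.single 1 1) (Pi.single 2 1) (0, 0, w 0) +
      lineParam Q (Pi.single 2 1) (Pi.single 0 1) (0, 0, w 1) +
      lineParam Q (Pi.single 0 1) (Pi.single 1 1) (0, 0, w 2) := by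
    refine Prod.ext (row_ext ?_ ?_ ?_) (row_ext ?_ ?_ ?_) <;>
    simp [lineParam_apply, veroneseVec, crossTerm, Q.norm_one, Q.conj_one]
  have hh : ambientCoord Q ((n, w), h) = baseEmb Q (n, w) + ambientCoord Q (0, Pi.single 0 (h 0)) +
      ambientCoord Q (0, Pi.single 1 (h 1)) + ambientCoord Q (0, Pi.single 2 (h 2)) := by
    rw [baseEmb_apply, ← map_add, ← map_add, ← map_add]
    congr 1
    refine Prod.ext (by simp) (row_ext ?_ ?_ ?_) <;> simp
  rw [hh, hw]
  simp only [map_add, map_smul]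
  have hs : ∀ i, baseEmb Q (veroneseVec Q (Pi.single i 1)) ∈ Z := fun i => hbase _ (by simp)
  exact add_mem (add_mem (add_mem (add_mem (add_mem (add_mem (add_mem (add_mem
    (Z.smul_mem _ (hs 0)) (Z.smul_mem _ (hs 1))) (Z.smul_mem _ (hs 2)))
    (hpair 1 2 (by decide) _)) (hpair 2 0 (by decide) _)) (hpair 0 1 (by decide) _))
    (hrow 0 _)) (hrow 1 _)) (hrow 2 _)

end Plane

/-! ### The linear duality between points and spans of vertices. -/

section Duality

variable {K : Type u} {B : Type v} [Field K] [DivisionRing B] [Algebra K B]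
  (Q : QuadraticStructure K B)

theorem rowMul_add_left (h h' : Fin 3 → B) (w : Ambient K B) :
    rowMul Q (h + h') w = rowMul Q h w + rowMul Q h' w := by
  apply row_ext <;> simp [rowMul, add_mul] <;> abel

theorem rowMul_smul_left (a : B) (h : Fin 3 → B) (w : Ambient K B) :
    rowMul Q (a • h) w = a • rowMul Q h w := by
  apply row_ext <;> simp [rowMul, mul_add, mul_assoc]

/-- The rows annihilating the matrices of the projection of `W`. -/
def annRow (W : Submodule K (Ambient K (CD Q (0 : K)))) : Submodule B (Fin 3 → B) where
  carrier := {h | ∀ w ∈ W, rowMul Q h (baseProj Q w) = 0}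
  add_mem' {a b} ha hb w hw := by rw [rowMul_add_left, ha w hw, hb w hw, add_zero]
  zero_mem' w _ := by
    have := rowMul_smul_left Q 0 0 (baseProj Q w)
    rwa [zero_smul, zero_smul] at this
  smul_mem' a h hh w hw := by rw [rowMul_smul_left, hh w hw, smul_zero]

theorem annRow_point {x : Fin 3 → B} (hx : x ≠ 0) (h : Fin 3 → B) :
    annRow Q (Submodule.span K {pointVec Q x h}) = perp x := by
  ext v
  rw [mem_perp, ← rowMul_veroneseVec_eq_zero_iff Q hx]
  constructor
  · intro hv
    exact hv _ (Submodule.mem_span_singleton_self _)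
  · intro hv w hw
    obtain ⟨c, rfl⟩ := Submodule.mem_span_singleton.1 hw
    rw [map_smul, map_smul]
    change c • rowMul Q v (veroneseVec Q x) = 0
    rw [hv, smul_zero]

/-- A row killing the matrices of a line kills its points `e` and `f`, hence is a multiple of `l`.
One annihilator construction thus serves both halves of the duality. -/
theorem annRow_line {l : Fin 3 → B} (hl : l ≠ 0) :
    annRow Q ((lineSpan Q l).map (baseEmb Q)) = Submodule.span B {l} := by
  obtain ⟨e, f, g, h, F⟩ := exists_frame hl
  ext v
  constructor
  · intro hv
    have key : ∀ x : Fin 3 → B, x ≠ 0 → l ⬝ᵥ x = 0 → v ⬝ᵥ x = 0 := by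
      intro x hx hlx
      rw [← rowMul_veroneseVec_eq_zero_iff Q hx]
      exact hv _ ⟨_, (veroneseVec_mem_lineSpan_iff Q hx).2 hlx, rfl⟩
    have hf : f ≠ 0 := by rintro rfl; simpa using F.hf
    obtain ⟨r, hr⟩ := F.row v
    rw [key e F.e_ne_zero F.le, key f hf F.lf, zero_smul, zero_smul, add_zero, add_zero] at hr
    exact Submodule.mem_span_singleton.2 ⟨r, hr.symm⟩
  · intro hv
    obtain ⟨r, rfl⟩ := Submodule.mem_span_singleton.1 hv
    apply Submodule.smul_mem
    rintro _ ⟨w, hw, rfl⟩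
    have : lineSpan Q l ≤ LinearMap.ker (rowMul Q l) := by
      rw [lineSpan, Submodule.span_le]
      rintro _ ⟨y, hy, hly, rfl⟩
      exact (rowMul_veroneseVec_eq_zero_iff Q hy).2 hly
    exact this hw

variable {Q} in
theorem span_pointVec_eq_of_perp_eq {x y : Fin 3 → B} (hx : x ≠ 0) (hy : y ≠ 0)
    (h : perp x = perp y) :
    Submodule.span K {pointVec Q x 0} = Submodule.span K {pointVec Q y 0} := by
  obtain ⟨a, rfl⟩ := exists_right_mul_of_perp_le hx h.le
  have ha : a ≠ 0 := by rintro rfl; exact hy (by simp; rfl)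
  rw [pointVec_right_mul Q ha, smul_zero,
    Submodule.span_singleton_smul_eq (IsUnit.mk0 _ (mt Q.norm_eq_zero.1 ha))]

theorem isDuality_annRow : IsDuality
    (veronesePoints (cdStructure Q 0) (tSet Q) ∩ pts (LinearMap.range (baseEmb Q)))
    {η | ∃ l : Fin 3 → B, l ≠ 0 ∧ η = (lineSpan Q l).map (baseEmb Q)}
    (rowSpace Q '' {U | Module.finrank B U = 1}) (rowSpace Q '' {U | Module.finrank B U = 2})
    (fun P => rowSpace Q (annRow Q P.submodule)) (fun η => rowSpace Q (annRow Q η)) := by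
  refine ⟨⟨?_, ?_, ?_⟩, ⟨?_, ?_, ?_⟩, ?_⟩
  · intro P hP
    obtain ⟨x, hx, h⟩ := (mem_section_points Q).1 hP
    refine ⟨perp x, finrank_perp hx, ?_⟩
    simp only
    rw [h, annRow_point Q hx]
  · intro P hP P' hP' heq
    obtain ⟨x, hx, h⟩ := (mem_section_points Q).1 hP
    obtain ⟨x', hx', h'⟩ := (mem_section_points Q).1 hP'
    have heq := rowSpace_injective Q heq
    rw [h, h', annRow_point Q hx, annRow_point Q hx'] at heq
    apply Projectivization.submodule_injective
    rw [h, h', span_pointVec_eq_of_perp_eq hx hx' heq]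
  · rintro _ ⟨U, hU, rfl⟩
    obtain ⟨x, hx, rfl⟩ := exists_eq_perp hU
    refine ⟨Projectivization.mk K _ (pointVec_ne_zero Q hx 0),
      (mem_section_points Q).2 ⟨x, hx, Projectivization.submodule_mk _ _⟩, ?_⟩
    simp only
    rw [Projectivization.submodule_mk, annRow_point Q hx]
  · rintro _ ⟨l, hl, rfl⟩
    refine ⟨Submodule.span B {l}, finrank_span_singleton hl, ?_⟩
    simp only
    rw [annRow_line Q hl]
  · rintro _ ⟨l, hl, rfl⟩ _ ⟨l', hl', rfl⟩ heq
    have heq := rowSpace_injective Q heq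
    rw [annRow_line Q hl, annRow_line Q hl'] at heq
    have hmem : l ∈ Submodule.span B {l'} := by
      rw [← heq]; exact Submodule.mem_span_singleton_self _
    obtain ⟨a, rfl⟩ := Submodule.mem_span_singleton.1 hmem
    have ha : a ≠ 0 := by rintro rfl; exact hl (zero_smul _ _)
    rw [lineSpan_smul Q ha]
  · rintro _ ⟨U, hU, rfl⟩
    obtain ⟨l, hl, rfl⟩ := exists_eq_span hU
    refine ⟨_, ⟨l, hl, rfl⟩, ?_⟩
    simp only
    rw [annRow_line Q hl]
  · rintro P hP _ ⟨l, hl, rfl⟩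
    obtain ⟨x, hx, h⟩ := (mem_section_points Q).1 hP
    rw [rowSpace_le_iff, h, annRow_point Q hx, annRow_line Q hl,
      Submodule.span_singleton_le_iff_mem, mem_perp, ← veroneseVec_mem_lineSpan_iff Q hx, pts,
      Set.mem_ofPred_eq, h, Submodule.span_singleton_le_iff_mem, pointVec, mem_map_baseEmb]
    exact and_iff_left rfl

/-- The description of `X` by pairs `(x x*, h)` with `h x = 0`, read fibrewise over `x`. -/
theorem points_eq_union : veronesePoints (cdStructure Q 0) (tSet Q) =
    {P | ∃ x ∈ veronesePoints (cdStructure Q 0) (tSet Q) ∩ pts (LinearMap.range (baseEmb Q)),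
      P ∈ pts (x.submodule ⊔ rowSpace Q (annRow Q x.submodule)) ∧
      P ∉ pts (rowSpace Q (annRow Q x.submodule))} := by
  ext P
  constructor
  · intro hP
    obtain ⟨x, h, hx, hh, hP⟩ := (mem_veronesePoints_cd Q).1 hP
    have hsm : (Projectivization.mk K (pointVec Q x 0) (pointVec_ne_zero Q hx 0)).submodule =
        Submodule.span K {pointVec Q x 0} := Projectivization.submodule_mk _ _
    refine ⟨Projectivization.mk K _ (pointVec_ne_zero Q hx 0),
      (mem_section_points Q).2 ⟨x, hx, hsm⟩, ?_, ?_⟩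
    · rw [hsm, annRow_point Q hx, pts, Set.mem_ofPred_eq, hP, Submodule.span_singleton_le_iff_mem]
      have : pointVec Q x h = pointVec Q x 0 + ambientCoord Q (0, h) := by
        rw [pointVec, pointVec, ← map_add, Prod.mk_add_mk, add_zero, zero_add]
      rw [this]
      exact Submodule.add_mem_sup (Submodule.mem_span_singleton_self _)
        ((mem_rowSpace Q).2 ⟨rfl, hh⟩)
    · rw [hsm, annRow_point Q hx, pts, Set.mem_ofPred_eq, hP, Submodule.span_singleton_le_iff_mem,
        pointVec, mem_rowSpace]
      exact fun h => veroneseVec_ne_zero Q hx h.1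
  · rintro ⟨R, hR, h1, h2⟩
    obtain ⟨x, hx, hR⟩ := (mem_section_points Q).1 hR
    rw [hR, annRow_point Q hx] at h1 h2
    induction P using Projectivization.ind with | h y hy => ?_
    rw [mk_mem_pts] at h1 h2
    obtain ⟨_, ha, v, hv, rfl⟩ := Submodule.mem_sup.1 h1
    obtain ⟨k, rfl⟩ := Submodule.mem_span_singleton.1 ha
    have hk : k ≠ 0 := by
      rintro rfl
      rw [zero_smul, zero_add] at h2
      exact h2 hv
    obtain ⟨h, hh, rfl⟩ := exists_of_mem_rowSpace Q hv
    rw [mem_veronesePoints_cd]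
    refine ⟨x, k⁻¹ • h, hx, ?_, ?_⟩
    · rw [smul_row_dotProduct, mem_perp.1 hh, smul_zero]
    · rw [Projectivization.submodule_mk, span_singleton_eq_iff_exists hy]
      refine ⟨k, hk, ?_⟩
      rw [pointVec, pointVec, ← map_smul, ← map_smul, ← map_add]
      congr 1
      refine Prod.ext (add_zero _) ?_
      change k • (0 : Fin 3 → B) + h = k • k⁻¹ • h
      rw [smul_zero, zero_add, smul_smul, mul_inv_cancel₀ hk, one_smul]

variable {Q} {l e f g h : Fin 3 → B}

/-- Modulo `l` a row `v` is determined by `(v e, v f)`. It annihilates `e w₀ + f w₁` exactly if this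
pair is `(w₁ b, -w₀ b)` for some `b`, which is the standard regulus member with parameter `w`. -/
theorem LineFrame.isRegulusParam (F : LineFrame l e f g h)
    {ρ : ℙ K (Fin 2 → K) → Submodule K
      (Ambient K (CD Q (0 : K)) ⧸ rowSpace Q (Submodule.span B {l}))}
    (hρ : ∀ w (hw : w ≠ 0), ρ (Projectivization.mk K w hw) =
      (rowSpace Q (perp (rcomb e f (w 0 • 1) (w 1 • 1)))).map
        (rowSpace Q (Submodule.span B {l})).mkQ) :
    IsRegulusParam ρ := by
  set V := rowSpace Q (Submodule.span B {l}) with hV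
  have hj : Function.Injective (V.mkQ.comp (pairEmb Q g h)) := by
    rw [← LinearMap.ker_eq_bot, LinearMap.ker_eq_bot']
    rintro ⟨a, b⟩ hab
    rw [LinearMap.comp_apply, Submodule.mkQ_apply, Submodule.Quotient.mk_eq_zero, pairEmb_apply,
      hV, mem_rowSpace, Submodule.mem_span_singleton] at hab
    obtain ⟨-, r, hr⟩ := hab
    have h1 := congrArg (· ⬝ᵥ e) hr
    have h2 := congrArg (· ⬝ᵥ f) hr
    simp only [add_dotProduct, smul_dotProduct, F.le, F.lf, F.ge, F.gf, F.he, F.hf, smul_eq_mul,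
      mul_zero, mul_one, add_zero, zero_add] at h1 h2
    rw [← h1, ← h2]; rfl
  refine isRegulusParam_of_regulusMember hj fun w hw => ?_
  rw [hρ w hw]
  have hdot : ∀ v : Fin 3 → B, v ⬝ᵥ rcomb e f (w 0 • 1) (w 1 • 1) =
      w 0 • (v ⬝ᵥ e) + w 1 • (v ⬝ᵥ f) := by
    intro v
    rw [dotProduct_rcomb, mul_smul_comm, mul_smul_comm, mul_one, mul_one]
  apply le_antisymm
  · rintro _ ⟨_, hy, rfl⟩
    obtain ⟨v, hv, rfl⟩ := exists_of_mem_rowSpace Q hy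
    rw [mem_perp, hdot] at hv
    obtain ⟨r, hr⟩ := F.row v
    obtain ⟨b, hb1, hb2⟩ : ∃ b : B, v ⬝ᵥ e = w 1 • b ∧ v ⬝ᵥ f = -(w 0 • b) := by
      by_cases h0 : w 0 = 0
      · have h1 : w 1 ≠ 0 := fun h1 => hw (by ext i; fin_cases i <;> assumption)
        rw [h0, zero_smul, zero_add, smul_eq_zero, or_iff_right h1] at hv
        refine ⟨(w 1)⁻¹ • (v ⬝ᵥ e), ?_, ?_⟩
        · rw [smul_smul, mul_inv_cancel₀ h1, one_smul]
        · rw [hv, h0, zero_smul, neg_zero]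
      · refine ⟨-((w 0)⁻¹ • (v ⬝ᵥ f)), ?_, ?_⟩
        · rw [smul_neg, smul_comm, ← smul_neg, ← eq_neg_of_add_eq_zero_left hv, smul_smul,
            inv_mul_cancel₀ h0, one_smul]
        · rw [smul_neg, smul_smul, mul_inv_cancel₀ h0, one_smul, neg_neg]
    refine ⟨b, ?_⟩
    rw [transversalMap_apply, LinearMap.comp_apply, Submodule.mkQ_apply, Submodule.mkQ_apply,
      Submodule.Quotient.eq, pairEmb_apply, ← map_sub, Prod.mk_sub_mk, sub_self, mem_rowSpace]
    refine ⟨rfl, Submodule.mem_span_singleton.2 ⟨r, ?_⟩⟩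
    rw [← hb1, ← hb2, eq_sub_iff_add_eq, ← add_assoc, ← hr]
  · rintro _ ⟨b, rfl⟩
    refine ⟨pairEmb Q g h (w 1 • b, -(w 0 • b)), ?_, rfl⟩
    refine (mem_rowSpace Q).2 ⟨rfl, ?_⟩
    change pairMap K g h (w 1 • b, -(w 0 • b)) ∈ _
    rw [mem_perp, hdot]
    simp only [pairMap, LinearMap.coe_mk, AddHom.coe_mk, add_dotProduct, smul_dotProduct, F.ge,
      F.gf, F.he, F.hf, smul_eq_mul, mul_one, mul_zero, add_zero, zero_add]
    rw [smul_neg, smul_comm, add_neg_cancel]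

/-- A conic on the image of a line is parametrized by the sublines `e w₀ + f w₁` of the line. -/
theorem exists_frame_of_conic (hl : l ≠ 0) {γ : ℙ K (Fin 2 → K) → ℙ K (Ambient K (CD Q (0 : K)))}
    (hγ : IsConicParam γ)
    (hmem : ∀ p, γ p ∈ (veronesePoints (cdStructure Q 0) (tSet Q) ∩
      pts (LinearMap.range (baseEmb Q))) ∩ pts ((lineSpan Q l).map (baseEmb Q))) :
    ∃ e f g h, LineFrame l e f g h ∧ ∀ w (hw : w ≠ 0),
      rcomb e f (w 0 • 1) (w 1 • 1) ≠ 0 ∧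
      (γ (Projectivization.mk K w hw)).submodule =
        Submodule.span K {pointVec Q (rcomb e f (w 0 • 1) (w 1 • 1)) 0} := by
  obtain ⟨a, b, c, hli, hγ⟩ := hγ
  have hind : ∀ r s t : K, r • a + s • b + t • c = 0 → r = 0 ∧ s = 0 ∧ t = 0 := by
    intro r s t hrst
    have := Fintype.linearIndependent_iff.1 hli ![r, s, t] (by
      rw [Fin.sum_univ_three]; simpa using hrst)
    exact ⟨this 0, this 1, this 2⟩
  have hpt : ∀ w : Fin 2 → K, w ≠ 0 → ∃ (k : K) (x : Fin 3 → B), k ≠ 0 ∧ x ≠ 0 ∧ l ⬝ᵥ x = 0 ∧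
      (w 0) ^ 2 • a + (w 0 * w 1) • b + (w 1) ^ 2 • c = k • baseEmb Q (veroneseVec Q x) := by
    intro w hw
    obtain ⟨h1, h2⟩ := hmem (Projectivization.mk K w hw)
    obtain ⟨x, hx, h⟩ := (mem_section_points Q).1 h1
    rw [pts, Set.mem_ofPred_eq, h, Submodule.span_singleton_le_iff_mem, pointVec,
      mem_map_baseEmb, veroneseVec_mem_lineSpan_iff Q hx] at h2
    rw [hγ w hw, span_singleton_eq_iff_exists] at h
    · obtain ⟨k, hk, h⟩ := h
      exact ⟨k, x, hk, hx, h2.1, h⟩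
    · intro h0
      obtain ⟨h3, -, h4⟩ := hind _ _ _ h0
      apply hw
      ext i
      fin_cases i
      · exact pow_eq_zero_iff two_ne_zero |>.1 h3
      · exact pow_eq_zero_iff two_ne_zero |>.1 h4
  obtain ⟨k, e, hk, he, hle, hae⟩ := hpt ![1, 0] (by simp)
  obtain ⟨k', f, hk', hf, hlf, hcf⟩ := hpt ![0, 1] (by simp)
  simp only [cons_val_zero, cons_val_one, one_pow, one_smul, mul_zero, zero_mul, zero_smul,
    add_zero, zero_add, ne_eq, OfNat.ofNat_ne_zero, not_false_eq_true, zero_pow] at hae hcf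
  have hef : perp e ≠ perp f := by
    intro hperp
    have h1 := span_pointVec_eq_of_perp_eq (Q := Q) he hf hperp
    rw [span_singleton_eq_iff_exists (pointVec_ne_zero Q he 0)] at h1
    obtain ⟨m, hm, h1⟩ := h1
    have h2 : baseEmb Q (veroneseVec Q e) = m • baseEmb Q (veroneseVec Q f) := h1
    have h3 := hind k' 0 (-(k * m)) (by
      rw [hae, hcf, h2]; module)
    exact hk' h3.1
  obtain ⟨g, h, F⟩ := exists_lineFrame hl he hf hle hlf hef
  -- The conic points with parameters `(1, 0)` and `(0, 1)` serve as `e` and `f`; the point `(1, 1)`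
  -- then places `b` in the span of the line.
  obtain ⟨r, s, β, hb⟩ : ∃ (r s : K) (β : B), b = baseEmb Q (lineParam Q e f (r, s, β)) := by
    obtain ⟨m, x, -, hx, hlx, hsum⟩ := hpt ![1, 1] (by simp)
    simp only [cons_val_zero, cons_val_one, one_pow, one_smul, mul_one] at hsum
    rw [F.exists_rcomb hlx, veroneseVec_rcomb, hae, hcf] at hsum
    refine ⟨m * Q.norm (g ⬝ᵥ x) - k, m * Q.norm (h ⬝ᵥ x) - k',
      m • ((g ⬝ᵥ x) * Q.conj (h ⬝ᵥ x)), ?_⟩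
    have : b = m • baseEmb Q (lineParam Q e f (Q.norm (g ⬝ᵥ x), Q.norm (h ⬝ᵥ x),
        (g ⬝ᵥ x) * Q.conj (h ⬝ᵥ x))) - k • baseEmb Q (veroneseVec Q e) -
        k' • baseEmb Q (veroneseVec Q f) := by
      rw [← hsum]; abel
    simp only [this, ← map_smul (baseEmb Q), ← map_sub (baseEmb Q)]
    refine congrArg (baseEmb Q) ?_
    rw [lineParam_apply, lineParam_apply, map_smul]
    module
  have hparam : ∀ w : Fin 2 → K, (w 0) ^ 2 • a + (w 0 * w 1) • b + (w 1) ^ 2 • c =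
      baseEmb Q (lineParam Q e f ((w 0) ^ 2 * k + w 0 * w 1 * r, w 0 * w 1 * s + (w 1) ^ 2 * k',
        (w 0 * w 1) • β)) := by
    intro w
    simp only [hae, hcf, hb, ← map_smul (baseEmb Q), ← map_add (baseEmb Q)]
    refine congrArg (baseEmb Q) ?_
    rw [lineParam_apply, lineParam_apply, map_smul]
    module
  -- The quadric equation at each conic point. Only its values at chosen `w` are used, never a
  -- comparison of polynomial coefficients, so small fields need no separate treatment.
  have hquad : ∀ w : Fin 2 → K, w ≠ 0 →
      ((w 0) ^ 2 * k + w 0 * w 1 * r) * (w 0 * w 1 * s + (w 1) ^ 2 * k') =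
        Q.norm ((w 0 * w 1) • β) := by
    intro w hw
    obtain ⟨m, x, -, hx, hlx, hsum⟩ := hpt w hw
    rw [hparam, ← map_smul (baseEmb Q)] at hsum
    have := F.hyperbolicForm_eq_zero hlx (baseEmb_injective Q hsum)
    rw [hyperbolicForm_apply, sub_eq_zero] at this
    exact this
  -- Otherwise `b` would lie in the span of `a` and `c`, against their independence.
  have hzero : ∀ w : Fin 2 → K, w 0 ≠ 0 → w 1 ≠ 0 → (w 0 * w 1) • β ≠ 0 := by
    intro w h0 h1 hβ
    have hw : w ≠ 0 := fun h => h0 (congrFun h 0)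
    have hq := hquad w hw
    have hp := hparam w
    rw [hβ, QuadraticMap.map_zero] at hq
    rw [hβ] at hp
    have e0 : ∀ p q : K, baseEmb Q (lineParam Q e f (p, q, 0)) =
        (p * k⁻¹) • a + (q * k'⁻¹) • c := by
      intro p q
      rw [lineParam_apply, hae, hcf, map_zero, add_zero, map_add, map_smul, map_smul, smul_smul,
        smul_smul, mul_assoc, inv_mul_cancel₀ hk, mul_assoc, inv_mul_cancel₀ hk', mul_one, mul_one]
    rw [e0] at hp
    have hrel : ((w 0) ^ 2 - ((w 0) ^ 2 * k + w 0 * w 1 * r) * k⁻¹) • a + (w 0 * w 1) • b +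
        ((w 1) ^ 2 - (w 0 * w 1 * s + (w 1) ^ 2 * k') * k'⁻¹) • c = 0 := by
      rw [← sub_eq_zero.2 hp]
      module
    exact mul_ne_zero h0 h1 (hind _ _ _ hrel).2.1
  have hβ : β ≠ 0 := by
    rintro rfl
    exact hzero ![1, 1] one_ne_zero one_ne_zero (smul_zero _)
  have hr : r = 0 := by
    by_contra hr
    have := hquad ![-r, k] (fun h0 => hk (congrFun h0 1))
    simp only [cons_val_zero, cons_val_one] at this
    rw [show (-r) ^ 2 * k + -r * k * r = 0 by ring, zero_mul, eq_comm, Q.norm_eq_zero] at this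
    exact hzero ![-r, k] (neg_ne_zero.2 hr) hk this
  have hs : s = 0 := by
    by_contra hs
    have := hquad ![k', -s] (fun h0 => hk' (congrFun h0 0))
    simp only [cons_val_zero, cons_val_one] at this
    rw [show k' * -s * s + (-s) ^ 2 * k' = 0 by ring, mul_zero, eq_comm, Q.norm_eq_zero] at this
    exact hzero ![k', -s] hk' (neg_ne_zero.2 hs) this
  subst hr hs
  have hN : k * k' = Q.norm β := by
    have := hquad ![1, 1] (by simp)
    simpa using this
  -- With `r = s = 0` and `k k' = N β`, the new frame is `e β`, `f k'`.
  have he' : (fun i => e i * β) ≠ 0 := by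
    intro h0
    have := dotProduct_right_mul g e β
    rw [h0, dotProduct_zero, F.ge, one_mul] at this
    exact hβ this.symm
  have hf' : (fun i => f i * (k' • (1 : B))) ≠ 0 := by
    intro h0
    have := dotProduct_right_mul h f (k' • (1 : B))
    rw [h0, dotProduct_zero, F.hf, one_mul, eq_comm, smul_eq_zero] at this
    exact this.elim hk' one_ne_zero
  have hk1 : k' • (1 : B) ≠ 0 := smul_ne_zero hk' one_ne_zero
  have hpe : ∀ (x : Fin 3 → B) (m : B), m ≠ 0 → perp (fun i => x i * m) = perp x := by
    intro x m hm
    ext v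
    rw [mem_perp, mem_perp, dotProduct_right_mul, mul_eq_zero, or_iff_left hm]
  obtain ⟨g', h', F'⟩ := exists_lineFrame hl he' hf' (by rw [dotProduct_right_mul, hle, zero_mul])
    (by rw [dotProduct_right_mul, hlf, zero_mul]) (by rw [hpe _ _ hβ, hpe _ _ hk1]; exact hef)
  refine ⟨_, _, g', h', F', fun w hw => ?_⟩
  have hne : rcomb (fun i => e i * β) (fun i => f i * (k' • (1 : B))) (w 0 • 1) (w 1 • 1) ≠ 0 := by
    apply F'.rcomb_ne_zero
    by_contra hcon
    push Not at hcon
    apply hw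
    ext i
    fin_cases i
    · exact (smul_eq_zero.1 hcon.1).resolve_right one_ne_zero
    · exact (smul_eq_zero.1 hcon.2).resolve_right one_ne_zero
  refine ⟨hne, ?_⟩
  have hx : rcomb (fun i => e i * β) (fun i => f i * (k' • (1 : B))) (w 0 • 1) (w 1 • 1) =
      rcomb e f (w 0 • β) ((w 1 * k') • 1) := by
    ext i
    simp [rcomb, smul_smul, mul_comm]
  rw [hx] at hne ⊢
  rw [hγ w hw, eq_comm, span_singleton_eq_iff_exists (pointVec_ne_zero Q hne 0)]
  -- The Veronese vector of `e β w₀ + f k' w₁` has parameters `(w₀² N β, w₁² k'², w₀ w₁ k' β)`,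
  -- which is `k'` times those of the conic point.
  refine ⟨k', hk', ?_⟩
  change baseEmb Q (veroneseVec Q _) = _
  rw [hparam, ← map_smul (baseEmb Q)]
  refine congrArg (baseEmb Q) ?_
  rw [veroneseVec_rcomb, ← map_smul (lineParam Q e f), Q.norm_smul, Q.norm_smul, Q.norm_one,
    map_smul, Q.conj_one, ← hN]
  congr 1
  refine Prod.ext ?_ (Prod.ext ?_ ?_)
  · simp only [Prod.smul_mk, smul_eq_mul]; ring
  · simp only [Prod.smul_mk, smul_eq_mul]; ring
  · simp only [Prod.smul_mk, mul_smul_comm, mul_one, smul_smul]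
    congr 1
    ring

variable (Q)

theorem isLinearDuality_annRow : IsLinearDuality
    (veronesePoints (cdStructure Q 0) (tSet Q) ∩ pts (LinearMap.range (baseEmb Q)))
    {η | ∃ l : Fin 3 → B, l ≠ 0 ∧ η = (lineSpan Q l).map (baseEmb Q)}
    (rowSpace Q '' {U | Module.finrank B U = 1}) (rowSpace Q '' {U | Module.finrank B U = 2})
    (fun P => rowSpace Q (annRow Q P.submodule)) (fun η => rowSpace Q (annRow Q η)) := by
  refine ⟨isDuality_annRow Q, ?_⟩
  rintro _ ⟨l, hl, rfl⟩ γ hγ hmem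
  obtain ⟨e, f, g, h, F, hF⟩ := exists_frame_of_conic hl hγ hmem
  -- The quotient space depends on the vertex, so the vertex is generalized before being replaced by
  -- `B l`.
  have key : ∀ V, V = rowSpace Q (Submodule.span B {l}) → IsRegulusParam fun p =>
      (rowSpace Q (annRow Q (γ p).submodule)).map V.mkQ := by
    rintro _ rfl
    refine F.isRegulusParam fun w hw => ?_
    obtain ⟨h1, h2⟩ := hF w hw
    rw [h2, annRow_point Q h1]
  exact key _ (congrArg (rowSpace Q) (annRow_line Q hl))

end Duality

end

end HjVeronese

/-! ### Assembly of the theorem. -/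

theorem corollary4p2 {K : Type u} {B : Type v} [Field K] [DivisionRing B] [Algebra K B]
    (Q : QuadraticStructure K B)
    -- the point-subspace structure `(X, Ξ)` of `CD(B, 0)` and the set `S` of vertices
    (X : Set (ℙ K (Ambient K (CD Q (0 : K)))))
    (hX : X = veronesePoints (cdStructure Q 0) (tSet Q))
    (Ξ : Set (Submodule K (Ambient K (CD Q (0 : K)))))
    (hΞ : Ξ = veroneseSpaces (cdStructure Q 0) (tSet Q))
    (S : Set (Submodule K (Ambient K (CD Q (0 : K)))))
    (hS : S = {V | ∃ ξ ∈ Ξ, IsTubeVertex ξ (X ∩ pts ξ) V})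
    -- the set of spans of two distinct vertices
    (ℬ : Set (Submodule K (Ambient K (CD Q (0 : K)))))
    (hℬ : ℬ = {L | ∃ V₁ ∈ S, ∃ V₂ ∈ S, V₁ ≠ V₂ ∧ L = V₁ ⊔ V₂})
    (d : Cardinal.{max u v}) (hd : d = Cardinal.lift.{u} (Module.rank K B)) :
    -- `X` spans a projective space of dimension `6d + 2`
    pspan X = ⊤ ∧ Module.rank K (Ambient K (CD Q (0 : K))) = 6 * d + 3 ∧
    -- each member of `Ξ` meets `X` in a `(d, d - 1)`-tube with base a quadric of Witt index 1
    (∀ ξ ∈ Ξ, (∃! V, IsTubeVertex ξ (X ∩ pts ξ) V) ∧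
      ∀ V W O, IsTube ξ V W O (X ∩ pts ξ) →
        Module.rank K V = d ∧ Module.rank K W = d + 2 ∧ IsWittIndexOneQuadric W O) ∧
    -- the vertices form a regular spread of a `(3v + 2)`-space, `v = d - 1`
    ∃ Y : Submodule K (Ambient K (CD Q (0 : K))),
      Module.rank K Y = 3 * d ∧ IsRegularSpread d S Y ∧
      -- the spread with the spans of pairs of vertices is a plane isomorphic to `PG(2, B)`
      (∀ L ∈ ℬ, Module.rank K L = 2 * d) ∧ IsIsoToPG2 B S ℬ ∧
      -- the complementary space
      ∃ F : Submodule K (Ambient K (CD Q (0 : K))), IsCompl Y F ∧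
        ∃ (X' : Set (ℙ K (Ambient K (CD Q (0 : K)))))
          (Ξ' : Set (Submodule K (Ambient K (CD Q (0 : K))))),
          X' = X ∩ pts F ∧
          Ξ' = {η | ∃ ξ ∈ Ξ, η = ξ ⊓ F ∧ Module.rank K η = d + 2} ∧
          -- the members of `Ξ'` are also the projections of the members of `Ξ` from `Y` onto `F`
          Ξ' = {η | ∃ ξ ∈ Ξ, η = (ξ ⊔ Y) ⊓ F} ∧
          ProjectivelyEquivalentIn F X' Ξ' (veronesePoints Q {0}) (veroneseSpaces Q {0}) ∧
          -- the linear duality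
          ∃ (χ₀ : ℙ K (Ambient K (CD Q (0 : K))) → Submodule K (Ambient K (CD Q (0 : K))))
            (χ₁ : Submodule K (Ambient K (CD Q (0 : K))) →
              Submodule K (Ambient K (CD Q (0 : K)))),
            IsLinearDuality X' Ξ' S ℬ χ₀ χ₁ ∧
            X = {P | ∃ x ∈ X', P ∈ pts (x.submodule ⊔ χ₀ x) ∧ P ∉ pts (χ₀ x)} := by
  have hS' := vertices_eq Q
  rw [← hX, ← hΞ, ← hS] at hS'
  have hℬ' := spans_eq Q
  rw [← hS', ← hℬ] at hℬ'
  have hr : ∀ L ∈ ℬ, Module.rank K L = 2 * d := by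
    rw [hℬ']
    rintro _ ⟨U, hU, rfl⟩
    have hU : Module.finrank B U = 2 := hU
    rw [rank_rowSpace, hU, hd, Nat.cast_ofNat]
  have hY : Module.rank K (rowSpace Q ⊤) = 3 * d := by
    rw [rank_rowSpace, finrank_top, Module.finrank_pi, Fintype.card_fin, hd, Nat.cast_ofNat]
  refine ⟨hX ▸ pspan_veronesePoints_cd Q, hd ▸ rank_ambient_cd Q, ?_, rowSpace Q ⊤, hY,
    ?_, hr, ?_, LinearMap.range (baseEmb Q), isCompl_rowSpace_baseEmb Q,
    X ∩ pts (LinearMap.range (baseEmb Q)), _, rfl, rfl, ?_, ?_, ?_⟩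
  · intro ξ hξ
    rw [hΞ, veroneseSpaces_cd] at hξ
    obtain ⟨ℓ, hℓ, l, s, H, rfl⟩ := hξ
    subst hX hd
    exact ⟨⟨_, H.isTubeVertex_iff.2 rfl, fun V hV => H.isTubeVertex_iff.1 hV⟩,
      fun V W O hT => H.isTube hT⟩
  · rw [hS', hd]
    exact isRegularSpread_rowSpace Q
  · rw [hℬ', hS']
    exact isIsoToPG2_rowSpace Q
  · rw [hΞ, hd, section_spaces_eq, trace_spaces_eq]
  · rw [hΞ, hd, section_spaces_eq, hX]
    exact projectivelyEquivalentIn_base Q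
  · refine ⟨fun P => rowSpace Q (annRow Q P.submodule), fun η => rowSpace Q (annRow Q η), ?_, ?_⟩
    · rw [hΞ, hd, section_spaces_eq, hX, hℬ', hS']
      exact isLinearDuality_annRow Q
    · rw [hX]
      exact points_eq_union Q
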